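/- Write $(x,y)^\perp=(-y,x)$, let $\mathcal R$ be the Riesz transform on $\mathbb R^2$ with kernel $K(z)=\frac1{2\pi}\frac{z}{|z|^{3}}$ and $\mathcal R^\perp\theta=(\mathcal R\theta)^\perp$. For $\theta\in L^\infty(\mathbb R^2)$, $\mathcal R\theta$ is the class in $\mathrm{BMO}(\mathbb R^2;\mathbb R^2)$, modulo constants, given on each ball $B\ni x_0$ by $$\mathcal R\theta(x)=\mathrm{p.v.}\!\int_B K(x-x')\theta(x')\,dx'+\int_{\mathbb R^2\setminus B}[K(x-x')-K(x_0-x')]\theta(x')\,dx'\qquad (x\in B).$$ Let $T>0$ and let $\varphi:\mathbb R\times[0,T]\to\mathbb R$ be bounded and differentiable in $t$, such that for each $t$: $\varphi(\cdot,t)\in C^{1}$ with $\varphi_x(\cdot,t)$ Hölder continuous of some exponent $\alpha>0$, and $\varphi_x(x,t)=O(|x|^{-\beta})$ as $|x|\to\infty$ for some $\beta>0$. Let $\theta=2\pi\,\mathbf 1_{\{y>\varphi(x,t)\}}$, let $\mathbf n=(1+\varphi_x^2)^{-1/2}(-\varphi_x,1)$ be the upward normal to the front $y=\varphi(x,t)$,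 and let $\gamma$ be the Euler–Mascheroni constant. Then, at each time $t\in[0,T]$: 1. There is a representative $u$ of the BMO class $-\mathcal R^\perp\theta$ with $u(x,y)=(2\log|y|,0)+o(1)$ as $|y|\to\infty$ (uniformly in $x$), and it is unique up to null sets. 2. For every $h$ with $-h<\inf_x\varphi(x,t)$, let $\tilde u_h=(2\log|y+h|,0)$, $\theta^*=\theta-2\pi\mathbf 1_{\{y>-h\}}$, and $u^*=-\mathcal R^\perp\theta^*$ (principal value integral). Then $u=\tilde u_h+u^*$ almost everywhere. 3. There is exactly one continuous function, denoted $\log|\partial_x|\varphi_x$, such that $\int(\log|\partial_x|\varphi_x)\,\psi\,dx=\int\varphi_x\,(\log|\partial_x|\psi)\,dx$ for all Schwartz functions $\psi$, with both integrals absolutely convergent, where $\log|\partial_x|\psi$ is defined by the Fourier multiplier $\log|\xi|$. 4. At each point $(x,\varphi(x,t))$ of the front, the normal velocity $u\cdot\mathbf n$ exists as a principal value (of the $\mathbf n$-component of the singular integral that defines $u$), it equals $\tilde u_h\cdot\mathbf n+u^*\cdot\mathbf n$ (also a principal value) for every $h$ as in 2, and the front moves with this normal velocity at $(x,t)$, that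 is, $\varphi_t/\sqrt{1+\varphi_x^2}=u\cdot\mathbf n$, if and only if the front equation $$\varphi_t+2(\log2-\gamma)\varphi_x+\int_{\mathbb R}[\varphi_x(x,t)-\varphi_x(x',t)]\left\{\frac1{|x-x'|}-\frac1{\sqrt{(x-x')^2+(\varphi(x,t)-\varphi(x',t))^2}}\right\}dx'=2\log|\partial_x|\varphi_x$$ holds at $(x,t)$, where the integral converges absolutely. So a front that moves with the normal velocity $u\cdot\mathbf n$, in either description of $u$, satisfies the front equation. 5. If $\varphi$ is moreover differentiable as a function of $(x,t)$, then, with $c=2(\log 2-\gamma)$, $\varphi$ satisfies the front equation at $(x+ct,t)$ if and only if $\psi(x,t)=\varphi(x+ct,t)$ satisfies, at $(x,t)$, the same equation without the drift term $2(\log2-\gamma)\varphi_x$ (the Hunter–Shu regularized equation). -/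

import Mathlib

open MeasureTheory Filter Topology Set
open scoped NNReal FourierTransform SchwartzMap

noncomputable section

/-! ### The Riesz transform on the plane, and BMO -/

/-- The Euclidean plane. -/
abbrev Plane : Type := EuclideanSpace ℝ (Fin 2)

/-- The rotation `(x, y)^⊥ = (-y, x)`. -/
def perp (z : Plane) : Plane := !₂[-(z 1), z 0]

/-- The kernel `C₂ z / |z|³` of the Riesz transform in two dimensions, `C₂ = 1 / (2π)`. -/
def rieszKernel (z : Plane) : Plane := ((2 * Real.pi)⁻¹ * (‖z‖ ^ 3)⁻¹) • z

/-- The truncated Riesz transform `C₂ ∫_{|x - x'| ≥ ε} (x - x') / |x - x'|³ f(x') dx'`; its limit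
as `ε → 0+` is the principal value Riesz transform of a function that decays at infinity. -/
def rieszTrunc (f : Plane → ℝ) (ε : ℝ) (x : Plane) : Plane :=
  ∫ x' in (Metric.ball x ε)ᶜ, f x' • rieszKernel (x - x')

/-- The Riesz transform of a bounded function, truncated at distance `ε` from the singularity:
with `B` the ball of centre `c` and radius `r`, and `x, x₀ ∈ B`, it is
`C₂ ∫_{B, |x - x'| ≥ ε} K(x - x') f(x') dx' + C₂ ∫_{Bᶜ} [K(x - x') - K(x₀ - x')] f(x') dx'`,
where `K(z) = z / |z|³`. -/
def rieszTruncBdd (f : Plane → ℝ) (c : Plane) (r : ℝ) (x₀ : Plane) (ε : ℝ) (x : Plane) : Plane :=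
  rieszTrunc ((Metric.ball c r).indicator f) ε x
    + ∫ x' in (Metric.ball c r)ᶜ, f x' • (rieszKernel (x - x') - rieszKernel (x₀ - x'))

/-- Functions of bounded mean oscillation on the plane. -/
def MemBMO (g : Plane → Plane) : Prop :=
  LocallyIntegrable g volume ∧
    ∃ C : ℝ, ∀ (c : Plane) (r : ℝ), 0 < r →
      (⨍ x in Metric.ball c r, ‖g x - ⨍ y in Metric.ball c r, g y‖) ≤ C

/-- `g` is a representative of the BMO-valued Riesz transform of the bounded function `f`:
`g` is in BMO, and on each ball it agrees almost everywhere, up to an additive constant, with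
the principal value formula for the Riesz transform of bounded functions. -/
def IsRieszTransform (f : Plane → ℝ) (g : Plane → Plane) : Prop :=
  MemBMO g ∧
    ∀ (c : Plane) (r : ℝ) (x₀ : Plane), x₀ ∈ Metric.ball c r →
      ∃ a : Plane, ∀ᵐ x, x ∈ Metric.ball c r →
        Tendsto (fun ε => rieszTruncBdd f c r x₀ ε x + a) (𝓝[>] 0) (𝓝 (g x))

/-! ### Fronts and their velocity fields -/

/-- The front solution at a fixed time, with profile `f`: `2π` above the graph of `f` and `0`
below it. -/
def frontTheta (f : ℝ → ℝ) (p : Plane) : ℝ := if f (p 0) < p 1 then 2 * Real.pi else 0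

/-- `u = -ℛ^⊥ θ`, as an equality of BMO classes. -/
def IsSQGVelocity (θ : Plane → ℝ) (u : Plane → Plane) : Prop :=
  ∃ g : Plane → Plane, IsRieszTransform θ g ∧ ∀ x, u x = -perp (g x)

/-- `u(x, y) = (2 log |y|, 0) + o(1)` as `|y| → ∞`, uniformly in `x`. -/
def HasShearFarField (u : Plane → Plane) : Prop :=
  Tendsto (fun p : Plane => u p - !₂[2 * Real.log |p 1|, 0])
    (comap (fun p : Plane => |p 1|) atTop) (𝓝 0)

/-- `u` is the velocity field of the front with profile `f`: the representative of `-ℛ^⊥ θ` that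
is asymptotic to `(2 log |y|, 0)`. -/
def IsFrontVelocity (f : ℝ → ℝ) (u : Plane → Plane) : Prop :=
  IsSQGVelocity (frontTheta f) u ∧ HasShearFarField u

/-- The point of the graph of `f` with abscissa `x`. -/
def frontPoint (f : ℝ → ℝ) (x : ℝ) : Plane := !₂[x, f x]

/-- The upward unit normal `(-f', 1) / √(1 + f'²)` to the graph of `f`. -/
def frontNormal (f : ℝ → ℝ) (x : ℝ) : Plane :=
  (Real.sqrt (1 + deriv f x ^ 2))⁻¹ • !₂[-(deriv f x), 1]

/-- `V` is the value at the point `X` of `u · n`, for a representative `u` of `-ℛ^⊥ θ`, in the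
principal value sense: whenever `a` is the additive constant for which
`u = a - ℛ^⊥ θ` almost everywhere on a ball that contains `X`, the principal value of
`(a - ℛ^⊥ θ) · n` at `X` is `V`. (On a front, the tangential component diverges.) -/
def IsNormalVelocity (θ : Plane → ℝ) (u : Plane → Plane) (X n : Plane) (V : ℝ) : Prop :=
  ∀ (c : Plane) (r : ℝ) (x₀ a : Plane), x₀ ∈ Metric.ball c r → X ∈ Metric.ball c r →
    (∀ᵐ x, x ∈ Metric.ball c r →
      Tendsto (fun ε => a - perp (rieszTruncBdd θ c r x₀ ε x)) (𝓝[>] 0) (𝓝 (u x))) →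
    Tendsto (fun ε => inner ℝ (a - perp (rieszTruncBdd θ c r x₀ ε X)) n) (𝓝[>] 0) (𝓝 V)

/-- The velocity `(2 log |y + h|, 0)` of the planar front `y = -h`. -/
def planarVelocity (h : ℝ) (p : Plane) : Plane := !₂[2 * Real.log |p 1 + h|, 0]

/-- The difference between the front with profile `f` and the planar front `y = -h`. -/
def thetaStar (h : ℝ) (f : ℝ → ℝ) (p : Plane) : ℝ := frontTheta f p - frontTheta (fun _ => -h) p

/-- The velocity of the front with profile `f` obtained by adding the velocity of the planar
front `y = -h` and the velocity `u* = -ℛ^⊥ θ*`, the latter truncated at distance `ε` from the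
singularity. -/
def splitVelocityTrunc (h : ℝ) (f : ℝ → ℝ) (ε : ℝ) (x : Plane) : Plane :=
  planarVelocity h x - perp (rieszTrunc (thetaStar h f) ε x)

/-! ### The front equation -/

/-- The multiplier `log |∂ₓ|` on Schwartz functions. In the normalization
`𝓕 ψ ξ = ∫ exp (-2π i x ξ) ψ x dx`, the operator `∂ₓ` has symbol `2π i ξ`, so that the symbol of
`log |∂ₓ|` is `log |2π ξ|`. -/
def logAbsDerivSchwartz (ψ : 𝓢(ℝ, ℂ)) : ℝ → ℂ :=
  𝓕⁻ (fun ξ : ℝ => (Real.log |2 * Real.pi * ξ| : ℂ) * 𝓕 (ψ : ℝ → ℂ) ξ)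

/-- `g = log |∂ₓ| f` for a continuous function `g`, in the sense of distributions:
`∫ g ψ = ∫ f (log |∂ₓ| ψ)` for all Schwartz functions `ψ` (the symbol is even), where both
integrals converge absolutely. -/
def IsLogAbsDeriv (f g : ℝ → ℝ) : Prop :=
  Continuous g ∧ ∀ ψ : 𝓢(ℝ, ℂ),
    Integrable (fun x => (f x : ℂ) * logAbsDerivSchwartz ψ x) ∧
    Integrable (fun x => (g x : ℂ) * ψ x) ∧
    ∫ x, (g x : ℂ) * ψ x = ∫ x, (f x : ℂ) * logAbsDerivSchwartz ψ x

/-- The integrand of the nonlinear term of the front equation, for the profile `f`. -/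
def frontIntegrand (f : ℝ → ℝ) (x x' : ℝ) : ℝ :=
  (deriv f x - deriv f x') *
    (1 / |x - x'| - 1 / Real.sqrt ((x - x') ^ 2 + (f x - f x') ^ 2))

/-- The time derivative of `φ` on `[0, T]` (one-sided at the endpoints). -/
def timeDeriv (T : ℝ) (φ : ℝ → ℝ → ℝ) (x t : ℝ) : ℝ :=
  derivWithin (fun s => φ x s) (Icc 0 T) t

/-- The front equation with drift velocity `c`, at the point `(x, t)`:
`φ_t + c φ_x + ∫ [φ_x(x) - φ_x(x')] {1/|x-x'| - 1/√((x-x')² + (φ(x)-φ(x'))²)} dx'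
  = 2 log |∂ₓ| φ_x`, where the integral converges absolutely. -/
def FrontEquationAt (c T : ℝ) (φ : ℝ → ℝ → ℝ) (x t : ℝ) : Prop :=
  Integrable (frontIntegrand (fun y => φ y t) x) ∧
  ∃ L : ℝ → ℝ, IsLogAbsDeriv (deriv (fun y => φ y t)) L ∧
    timeDeriv T φ x t + c * deriv (fun y => φ y t) x
      + ∫ x', frontIntegrand (fun y => φ y t) x x' = 2 * L x

/-- The standing assumptions on the front `y = φ(x, t)`, `0 ≤ t ≤ T`. -/
structure FrontAssumptions (T : ℝ) (φ : ℝ → ℝ → ℝ) : Prop where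
  bounded : ∃ M : ℝ, ∀ x, ∀ t ∈ Icc 0 T, |φ x t| ≤ M
  contDiff : ∀ t ∈ Icc 0 T, ContDiff ℝ 1 (fun x => φ x t)
  holder : ∀ t ∈ Icc 0 T, ∃ α C : ℝ≥0, 0 < α ∧ HolderWith C α (deriv (fun x => φ x t))
  decay : ∀ t ∈ Icc 0 T, ∃ β : ℝ, 0 < β ∧
    deriv (fun x => φ x t) =O[cocompact ℝ] (fun x => |x| ^ (-β))

end

/-! Off the front. The Riesz kernel is odd and homogeneous of degree `-2`. Where the density is
constant on a ball around `X`, oddness makes the truncated transform independent of the truncation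
radius (`rieszNormalized_eq_of_const`), so off a Lipschitz front no limit is needed, and each ball
formula differs from one global function by a constant (`rieszTruncBdd_eq`). By homogeneity this
function varies by a bounded amount between points whose distance is comparable with their gaps to
the front, even across it (`norm_rieszNormalized_sub_le`). Doubling the gap repeatedly reaches any
point from a reference point in about `log (ρ / gap)` steps; this is dominated by `√(ρ / gap)`,
which is integrable, whence BMO (`memBMO_of_gap`).

The far field. The front is a planar front plus a density `θ*` supported in a horizontal strip. For
the planar part the kernel is regularized by a height `η`, integrated first along horizontal lines
and then vertically, which gives a logarithm; then `η` tends to zero (`rieszNormalized_planar`). The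
strip contributes `O(1 / |y|)`. Two representatives differ by a constant, which the far field forces
to vanish.

The normal velocity. Up to sign, the normal component of the velocity is the tangential component of
the Riesz transform. The half-disc below the tangent line contributes nothing to it, by reflection
in the normal. What remains of `θ*` near the point is a cusp of thickness `|s|^(1+α)`, against which
the kernel `|z|⁻²` converges absolutely. So the principal value may be computed with any radial
regularization (`IsProfile.tendsto_tangential`). At height `η` the vertical integrals are
elementary, an integration by parts with `arsinh` brings in the slope, and the limit is a convergent
integral over the line (`IsProfile.tendsto_split_inner`).

The front equation. Since `∫₀^∞ (1_{s<1} - cos (k s)) / s ds = log k + γ`, the multiplier `log |∂ₓ|`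
is `-γ` plus a singular integral of symmetric differences (`logAbsDerivSchwartz_eq`), which extends
by duality to Hölder continuous functions with decay. Comparing that kernel with the integral over
the line leaves the nonlinear term of the front equation and a tail worth `2 log H - 2 log 2`, where
`H` is the height of the point above the auxiliary line. The term `log H` cancels the planar
velocity, so the choice of `h` is immaterial, and `log 2` and `γ` form the drift
(`IsProfile.integral_tangentialIntegrand`). The remaining terms are translation invariant, so the
chain rule removes the drift in a moving frame. -/

/-! ### Regularized and truncated Riesz kernels -/

/-- The Riesz kernel of the plane at height `η` above it. -/
noncomputable def regKernel (η : ℝ) (z : Plane) : Plane :=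
  ((2 * Real.pi)⁻¹ * (Real.sqrt (‖z‖ ^ 2 + η ^ 2) ^ 3)⁻¹) • z

/-- The regularized kernel, truncated at distance `ε` from the singularity. -/
noncomputable def truncKernel (η ε : ℝ) (z : Plane) : Plane :=
  if ε ≤ ‖z‖ then regKernel η z else 0

lemma regKernel_zero (z : Plane) : regKernel 0 z = rieszKernel z := by
  simp [regKernel, rieszKernel, Real.sqrt_sq (norm_nonneg z)]

lemma regKernel_neg (η : ℝ) (z : Plane) : regKernel η (-z) = -regKernel η z := by
  simp [regKernel]

lemma truncKernel_neg (η ε : ℝ) (z : Plane) : truncKernel η ε (-z) = -truncKernel η ε z := by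
  unfold truncKernel
  rw [norm_neg, regKernel_neg]
  split_ifs <;> simp

lemma inv_two_pi_le_one : (2 * Real.pi)⁻¹ ≤ 1 :=
  inv_le_one_of_one_le₀ (by linarith [Real.pi_gt_three])

lemma norm_le_sqrt_sq_add_sq {E : Type*} [SeminormedAddGroup E] (z : E) (η : ℝ) :
    ‖z‖ ≤ Real.sqrt (‖z‖ ^ 2 + η ^ 2) :=
  Real.le_sqrt_of_sq_le (by linarith [sq_nonneg η])

/-- `√(‖z‖² + η²)` is the norm of the plane vector `(‖z‖, η)`, so this is the triangle inequality.
-/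
lemma abs_sqrt_sub_sqrt_le (z z' : Plane) (η : ℝ) :
    |Real.sqrt (‖z‖ ^ 2 + η ^ 2) - Real.sqrt (‖z'‖ ^ 2 + η ^ 2)| ≤ ‖z - z'‖ := by
  have key : ∀ a b : ℝ, Real.sqrt (a ^ 2 + b ^ 2) = ‖(!₂[a, b] : Plane)‖ := by
    intro a b
    rw [EuclideanSpace.norm_eq]; simp
  rw [key, key]
  refine (abs_norm_sub_norm_le _ _).trans ?_
  have : (!₂[‖z‖, η] : Plane) - !₂[‖z'‖, η] = !₂[‖z‖ - ‖z'‖, 0] := by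
    ext i; fin_cases i <;> simp
  rw [this, ← key]
  simp only [ne_eq, OfNat.ofNat_ne_zero, not_false_eq_true, zero_pow, add_zero]
  rw [Real.sqrt_sq_eq_abs]
  exact abs_norm_sub_norm_le z z'

lemma norm_regKernel_le (η : ℝ) (z : Plane) : ‖regKernel η z‖ ≤ (‖z‖ ^ 2)⁻¹ := by
  unfold regKernel
  rcases eq_or_ne z 0 with rfl | hz
  · simp
  have hz' : 0 < ‖z‖ := norm_pos_iff.2 hz
  rw [norm_smul, Real.norm_of_nonneg (by positivity)]
  have h1 : (Real.sqrt (‖z‖ ^ 2 + η ^ 2) ^ 3)⁻¹ ≤ (‖z‖ ^ 3)⁻¹ := by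
    gcongr; exact norm_le_sqrt_sq_add_sq z η
  calc (2 * Real.pi)⁻¹ * (Real.sqrt (‖z‖ ^ 2 + η ^ 2) ^ 3)⁻¹ * ‖z‖
      ≤ 1 * (‖z‖ ^ 3)⁻¹ * ‖z‖ := by
        gcongr; exact inv_two_pi_le_one
    _ = (‖z‖ ^ 2)⁻¹ := by field_simp

/-- The condition on `v` makes the radii `a` and `b` comparable up to a factor of two, and the
difference of the inverse cubes is factored algebraically. The bound is uniform in `η`, as is needed
to remove the regularization by dominated convergence. -/
lemma norm_regKernel_sub_le (η : ℝ) {z v : Plane} (hz : 0 < ‖z‖) (h : ‖v‖ ≤ ‖z‖ / 2) :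
    ‖regKernel η z - regKernel η (z - v)‖ ≤ 30 * ‖v‖ / ‖z‖ ^ 3 := by
  set a := Real.sqrt (‖z‖ ^ 2 + η ^ 2) with ha
  set b := Real.sqrt (‖z - v‖ ^ 2 + η ^ 2) with hb
  have hza : ‖z‖ ≤ a := norm_le_sqrt_sq_add_sq z η
  have hzb : ‖z - v‖ ≤ b := norm_le_sqrt_sq_add_sq _ η
  have hab : |a - b| ≤ ‖v‖ := by
    have := abs_sqrt_sub_sqrt_le z (z - v) η
    simpa using this
  obtain ⟨hab1, hab2⟩ := abs_le.1 hab
  have ha0 : 0 < a := by linarith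
  have hb2 : a / 2 ≤ b := by linarith
  have hb0 : 0 < b := by linarith
  have hb3 : b ≤ 2 * a := by linarith
  have e : regKernel η z - regKernel η (z - v)
      = (2 * Real.pi)⁻¹ • ((a ^ 3)⁻¹ • v + ((a ^ 3)⁻¹ - (b ^ 3)⁻¹) • (z - v)) := by
    simp only [regKernel, ← ha, ← hb]
    module
  have hd : |(a ^ 3)⁻¹ - (b ^ 3)⁻¹| ≤ ‖v‖ * (a ^ 2 + a * b + b ^ 2) / (a ^ 3 * b ^ 3) := by
    have : (a ^ 3)⁻¹ - (b ^ 3)⁻¹ = (b - a) * (a ^ 2 + a * b + b ^ 2) / (a ^ 3 * b ^ 3) := by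
      field_simp; ring
    rw [this, abs_div, abs_mul, abs_of_pos (by positivity : 0 < a ^ 2 + a * b + b ^ 2),
      abs_of_pos (by positivity : 0 < a ^ 3 * b ^ 3), abs_sub_comm]
    gcongr
  have h7 : ‖v‖ * (a ^ 2 + a * b + b ^ 2) / (a ^ 3 * b ^ 3) * b ≤ 28 * ‖v‖ / a ^ 3 := by
    have : ‖v‖ * (a ^ 2 + a * b + b ^ 2) / (a ^ 3 * b ^ 3) * b
        = ‖v‖ * (a ^ 2 + a * b + b ^ 2) / (b ^ 2) / a ^ 3 := by field_simp
    rw [this]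
    gcongr
    rw [div_le_iff₀ (by positivity)]
    have : a ^ 2 + a * b + b ^ 2 ≤ 28 * b ^ 2 := by nlinarith
    calc _ ≤ ‖v‖ * (28 * b ^ 2) := by gcongr
      _ = _ := by ring
  calc ‖regKernel η z - regKernel η (z - v)‖
      ≤ 1 * ‖(a ^ 3)⁻¹ • v + ((a ^ 3)⁻¹ - (b ^ 3)⁻¹) • (z - v)‖ := by
        rw [e, norm_smul, Real.norm_of_nonneg (by positivity)]
        gcongr; exact inv_two_pi_le_one
    _ ≤ (a ^ 3)⁻¹ * ‖v‖ + |(a ^ 3)⁻¹ - (b ^ 3)⁻¹| * ‖z - v‖ := by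
        rw [one_mul]
        refine (norm_add_le _ _).trans ?_
        rw [norm_smul, norm_smul, Real.norm_of_nonneg (by positivity), Real.norm_eq_abs]
    _ ≤ (a ^ 3)⁻¹ * ‖v‖ + ‖v‖ * (a ^ 2 + a * b + b ^ 2) / (a ^ 3 * b ^ 3) * b := by gcongr
    _ ≤ (a ^ 3)⁻¹ * ‖v‖ + 28 * ‖v‖ / a ^ 3 := by gcongr
    _ = 29 * ‖v‖ / a ^ 3 := by field_simp; ring
    _ ≤ 30 * ‖v‖ / ‖z‖ ^ 3 := by gcongr; norm_num

lemma norm_truncKernel_le (η : ℝ) {ε r : ℝ} (hr : 0 < r) (h : r ≤ ε) (z : Plane) :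
    ‖truncKernel η ε z‖ ≤ (r ^ 2)⁻¹ := by
  unfold truncKernel
  split_ifs with hz
  · refine (norm_regKernel_le η z).trans ?_
    gcongr
    exact h.trans hz
  · simp; positivity

/-- The constant in the decay estimate for differences of truncated kernels. -/
noncomputable def kernelConst (A : ℝ) : ℝ := 240 * A + 2 * (1 + 2 * A) ^ 3

lemma kernelConst_pos {A : ℝ} (hA : 1 ≤ A) : 0 < kernelConst A := by
  unfold kernelConst; positivity

/-- The profile `r⁻² (1 + |z| / r)⁻³`, of integral independent of `r`. -/
noncomputable def decayProfile (r : ℝ) (z : Plane) : ℝ := (r ^ 2)⁻¹ * ((1 + ‖z‖ / r) ^ 3)⁻¹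

/-- For `‖z‖ ≥ 2 A r` neither truncation is active and smoothness gains a factor `‖v‖ / ‖z‖`. For
smaller `z` each kernel is at most `r⁻²`, and the profile is at least a constant multiple of that.
The two terms of `kernelConst` come from these two regions. -/
lemma norm_truncKernel_sub_le (η : ℝ) {A r ε ε' : ℝ} (hA : 1 ≤ A) (hr : 0 < r)
    (hε : r ≤ ε) (hε' : r ≤ ε') (hεA : ε ≤ A * r) (hεA' : ε' ≤ A * r)
    {v : Plane} (hv : ‖v‖ ≤ A * r) (z : Plane) :
    ‖truncKernel η ε z - truncKernel η ε' (z - v)‖ ≤ kernelConst A * decayProfile r z := by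
  unfold decayProfile kernelConst
  by_cases hz : 2 * A * r ≤ ‖z‖
  · have hAr : r ≤ A * r := by nlinarith
    have h0 : 0 < ‖z‖ := by nlinarith
    have hzv : A * r ≤ ‖z - v‖ := by
      have := norm_sub_norm_le z v
      linarith
    have e1 : truncKernel η ε z = regKernel η z := if_pos (by nlinarith)
    have e2 : truncKernel η ε' (z - v) = regKernel η (z - v) := if_pos (by linarith)
    rw [e1, e2]
    refine (norm_regKernel_sub_le η h0 (by linarith)).trans ?_
    have h1 : 1 + ‖z‖ / r ≤ 2 * ‖z‖ / r := by
      rw [le_div_iff₀ hr, add_mul, div_mul_cancel₀ _ hr.ne']; nlinarith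
    calc 30 * ‖v‖ / ‖z‖ ^ 3 ≤ 30 * (A * r) / ‖z‖ ^ 3 := by gcongr
      _ = 240 * A * ((r ^ 2)⁻¹ * ((2 * ‖z‖ / r) ^ 3)⁻¹) := by field_simp; ring
      _ ≤ (240 * A + 2 * (1 + 2 * A) ^ 3) * ((r ^ 2)⁻¹ * ((1 + ‖z‖ / r) ^ 3)⁻¹) := by
        gcongr
        have : 0 ≤ 2 * (1 + 2 * A) ^ 3 := by positivity
        linarith
  · push Not at hz
    have h1 : 1 + ‖z‖ / r ≤ 1 + 2 * A := by
      have : ‖z‖ / r ≤ 2 * A := by rw [div_le_iff₀ hr]; linarith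
      linarith
    calc ‖truncKernel η ε z - truncKernel η ε' (z - v)‖ ≤ (r ^ 2)⁻¹ + (r ^ 2)⁻¹ :=
          (norm_sub_le _ _).trans
            (add_le_add (norm_truncKernel_le η hr hε _) (norm_truncKernel_le η hr hε' _))
      _ = 2 * (1 + 2 * A) ^ 3 * ((r ^ 2)⁻¹ * ((1 + 2 * A) ^ 3)⁻¹) := by field_simp; ring
      _ ≤ (240 * A + 2 * (1 + 2 * A) ^ 3) * ((r ^ 2)⁻¹ * ((1 + ‖z‖ / r) ^ 3)⁻¹) := by
        gcongr
        linarith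

lemma integrable_decayProfile {r : ℝ} (hr : 0 < r) : Integrable (decayProfile r) := by
  have h : Integrable (fun z : Plane => (1 + ‖z‖) ^ (-3 : ℝ)) :=
    integrable_one_add_norm (by simp; norm_num)
  have h2 := (h.comp_smul (inv_ne_zero hr.ne')).const_mul (r ^ 2)⁻¹
  refine h2.congr (ae_of_all _ fun z => ?_)
  simp only [decayProfile, norm_smul, norm_inv, Real.norm_of_nonneg hr.le]
  rw [Real.rpow_neg (by positivity), div_eq_inv_mul]
  norm_cast

lemma integral_decayProfile {r : ℝ} (hr : 0 < r) :
    ∫ z, decayProfile r z = ∫ z, decayProfile 1 z := by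
  have h := Measure.integral_comp_inv_smul (volume : Measure Plane) (decayProfile 1) r
  have e : ∀ z, decayProfile r z = (r ^ 2)⁻¹ • decayProfile 1 (r⁻¹ • z) := by
    intro z
    simp [decayProfile, norm_smul, abs_of_pos hr, div_eq_inv_mul]
  simp_rw [e]
  rw [integral_smul, h]
  simp only [finrank_euclideanSpace, Fintype.card_fin, smul_eq_mul]
  rw [abs_of_pos (by positivity), ← mul_assoc, inv_mul_cancel₀ (by positivity), one_mul]

lemma measurable_regKernel (η : ℝ) : Measurable (regKernel η) := by
  unfold regKernel; fun_prop

lemma measurable_truncKernel (η ε : ℝ) : Measurable (truncKernel η ε) := by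
  unfold truncKernel
  exact Measurable.ite (measurableSet_le measurable_const measurable_norm)
    (measurable_regKernel η) measurable_const

lemma integrable_truncKernel_sub (η : ℝ) {ε ε' : ℝ} (hε : 0 < ε) (hε' : 0 < ε') (v : Plane) :
    Integrable (fun z => truncKernel η ε z - truncKernel η ε' (z - v)) := by
  -- Any two radii and any shift fit the estimate above, with `r` the smaller radius and `A` so
  -- large that `A * r` dominates both radii and the shift.
  set r := min ε ε'
  have hr : 0 < r := lt_min hε hε'
  set A := max 1 (max (max ε ε') ‖v‖ / r)
  have hA : max (max ε ε') ‖v‖ ≤ A * r := by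
    rw [← div_le_iff₀ hr]; exact le_max_right _ _
  refine ((integrable_decayProfile hr).const_mul (kernelConst A)).mono'
    ((measurable_truncKernel η ε).sub
      ((measurable_truncKernel η ε').comp (measurable_id.sub_const v))).aestronglyMeasurable
    (ae_of_all _ fun z => norm_truncKernel_sub_le η (le_max_left _ _) hr (min_le_left _ _)
      (min_le_right _ _) ?_ ?_ ?_ z)
  · exact ((le_max_left _ _).trans (le_max_left _ _)).trans hA
  · exact ((le_max_right _ _).trans (le_max_left _ _)).trans hA
  · exact (le_max_right _ _).trans hA

lemma integrable_truncKernel_sub_left (η : ℝ) {ε ε' : ℝ} (hε : 0 < ε) (hε' : 0 < ε')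
    (X X' : Plane) :
    Integrable (fun x' => truncKernel η ε (X - x') - truncKernel η ε' (X' - x')) := by
  have h := (integrable_truncKernel_sub η hε hε' (X - X')).comp_sub_left X
  refine h.congr (ae_of_all _ fun x' => ?_)
  simp only
  congr 2; abel

/-- A bounded measurable density. -/
structure IsBddDensity (C : ℝ) (θ : Plane → ℝ) : Prop where
  measurable : Measurable θ
  bound : ∀ x, |θ x| ≤ C

lemma IsBddDensity.nonneg {C : ℝ} {θ : Plane → ℝ} (h : IsBddDensity C θ) : 0 ≤ C :=
  (abs_nonneg _).trans (h.bound 0)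

lemma IsBddDensity.integrable_smul {C : ℝ} {θ : Plane → ℝ} (h : IsBddDensity C θ)
    {k : Plane → Plane} (hk : Integrable k) : Integrable (fun x => θ x • k x) :=
  hk.bdd_smul C h.measurable.aestronglyMeasurable (ae_of_all _ h.bound)

/-- The Riesz transform of a bounded density, truncated at distance `ε`, with a fixed
normalization at infinity. -/
noncomputable def rieszNormalized (θ : Plane → ℝ) (ε : ℝ) (X : Plane) : Plane :=
  ∫ x', θ x' • (truncKernel 0 ε (X - x') - truncKernel 0 1 (0 - x'))

lemma rieszNormalized_sub {C : ℝ} {θ : Plane → ℝ} (h : IsBddDensity C θ) {ε ε' : ℝ} (hε : 0 < ε)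
    (hε' : 0 < ε') (X X' : Plane) :
    rieszNormalized θ ε X - rieszNormalized θ ε' X'
      = ∫ x', θ x' • (truncKernel 0 ε (X - x') - truncKernel 0 ε' (X' - x')) := by
  unfold rieszNormalized
  rw [← integral_sub
    (h.integrable_smul (integrable_truncKernel_sub_left 0 hε one_pos X 0))
    (h.integrable_smul (integrable_truncKernel_sub_left 0 hε' one_pos X' 0))]
  congr 1; ext1 x'; module

/-- Dilation invariance: the bound depends on `A` but not on `r`. Only the size of `θ` enters, so
the two points may be on different sides of a jump. This is the source of bounded mean oscillation.
-/
lemma norm_rieszNormalized_sub_le {C : ℝ} {θ : Plane → ℝ} (h : IsBddDensity C θ) {A r : ℝ}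
    (hA : 1 ≤ A) (hr : 0 < r) {X X' : Plane} (hX : ‖X - X'‖ ≤ A * r) :
    ‖rieszNormalized θ r X - rieszNormalized θ r X'‖
      ≤ C * (kernelConst A * ∫ z, decayProfile 1 z) := by
  rw [rieszNormalized_sub h hr hr, ← integral_decayProfile hr, ← integral_const_mul,
    ← integral_const_mul, ← integral_sub_left_eq_self
      (fun z => C * (kernelConst A * decayProfile r z)) volume X]
  have hi := (((integrable_decayProfile hr).const_mul (kernelConst A)).const_mul C)
  refine norm_integral_le_of_norm_le (hi.comp_sub_left X) (ae_of_all _ fun x' => ?_)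
  rw [norm_smul]
  refine mul_le_mul (h.bound _) ?_ (norm_nonneg _) h.nonneg
  have hAr : r ≤ A * r := by nlinarith
  have := norm_truncKernel_sub_le 0 hA hr le_rfl le_rfl hAr hAr hX (X - x')
  rwa [show X - x' - (X - X') = X' - x' by abel] at this

/-- An odd kernel integrates to zero over a ball. -/
lemma integral_truncKernel_sub_self (η : ℝ) (ε ε' : ℝ) (X : Plane) :
    ∫ x', (truncKernel η ε (X - x') - truncKernel η ε' (X - x')) = 0 := by
  have h := integral_sub_left_eq_self
    (fun z => truncKernel η ε z - truncKernel η ε' z) volume X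
  have h2 := integral_neg_eq_self (fun z => truncKernel η ε z - truncKernel η ε' z) volume
  simp only [truncKernel_neg] at h2
  have h3 : ∀ z : Plane, -truncKernel η ε z - -truncKernel η ε' z
      = -(truncKernel η ε z - truncKernel η ε' z) := fun z => by abel
  simp_rw [h3] at h2
  rw [integral_neg] at h2
  rw [neg_eq_iff_add_eq_zero, ← two_smul ℝ] at h2
  rw [h]
  simpa using h2

/-- The two truncations differ by the kernel on an annulus where `θ` is constant, and there the odd
kernel integrates to zero. The principal value is therefore attained before the limit. -/
lemma rieszNormalized_eq_of_const {C : ℝ} {θ : Plane → ℝ} (h : IsBddDensity C θ) {ε r k : ℝ}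
    (hε : 0 < ε) (hr : ε ≤ r) {X : Plane} (hk : ∀ x' ∈ Metric.ball X r, θ x' = k) :
    rieszNormalized θ ε X = rieszNormalized θ r X := by
  rw [← sub_eq_zero, rieszNormalized_sub h hε (hε.trans_le hr)]
  have e : ∀ x', θ x' • (truncKernel 0 ε (X - x') - truncKernel 0 r (X - x'))
      = k • (truncKernel 0 ε (X - x') - truncKernel 0 r (X - x')) := by
    intro x'
    by_cases hx : x' ∈ Metric.ball X r
    · rw [hk x' hx]
    · have h1 : r ≤ ‖X - x'‖ := by
        rw [← dist_eq_norm, dist_comm]; simpa using hx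
      simp [truncKernel, h1, hr.trans h1]
  simp_rw [e]
  rw [integral_smul, integral_truncKernel_sub_self, smul_zero]

/-! ### The localized Riesz transform -/

lemma rieszTrunc_eq (f : Plane → ℝ) (ε : ℝ) (x : Plane) :
    rieszTrunc f ε x = ∫ x', f x' • truncKernel 0 ε (x - x') := by
  unfold rieszTrunc
  rw [← integral_indicator measurableSet_ball.compl]
  congr 1; ext1 x'
  have : x' ∈ (Metric.ball x ε)ᶜ ↔ ε ≤ ‖x - x'‖ := by
    rw [← dist_eq_norm, dist_comm]; simp
  by_cases h : ε ≤ ‖x - x'‖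
  · rw [indicator_of_mem (this.2 h), truncKernel, if_pos h, regKernel_zero]
  · rw [indicator_of_notMem (fun h' => h (this.1 h')), truncKernel, if_neg h, smul_zero]

/-- The constant by which the normalization of `rieszTruncBdd` differs from that of
`rieszNormalized`. -/
noncomputable def rieszShift (θ : Plane → ℝ) (c : Plane) (r : ℝ) (x₀ : Plane) : Plane :=
  ∫ x', θ x' • (truncKernel 0 1 (0 - x')
    - (Metric.ball c r)ᶜ.indicator (fun x' => rieszKernel (x₀ - x')) x')

lemma integrable_bdd_on_ball {k : Plane → Plane} (hk : Measurable k) {B : ℝ} (hB : ∀ x, ‖k x‖ ≤ B)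
    (c : Plane) (r : ℝ) : Integrable ((Metric.ball c r).indicator k) := by
  rw [integrable_indicator_iff measurableSet_ball]
  exact Measure.integrableOn_of_bounded (M := B) measure_ball_lt_top.ne hk.aestronglyMeasurable
    (ae_of_all _ hB)

lemma truncKernel_eq_of_notMem_ball {c x₀ x' : Plane} {r : ℝ} (h : x' ∉ Metric.ball c r) {δ : ℝ}
    (hδ : δ ≤ r - dist x₀ c) : truncKernel 0 δ (x₀ - x') = rieszKernel (x₀ - x') := by
  rw [truncKernel, if_pos, regKernel_zero]
  rw [← dist_eq_norm, dist_comm]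
  have : r ≤ dist x' c := by simpa using h
  linarith [dist_triangle x' x₀ c]

lemma integrable_rieszShift_aux {c x₀ : Plane} {r : ℝ} (h : x₀ ∈ Metric.ball c r) :
    Integrable (fun x' => truncKernel 0 1 (0 - x')
      - (Metric.ball c r)ᶜ.indicator (fun x' => rieszKernel (x₀ - x')) x') := by
  have hδ : 0 < r - dist x₀ c := sub_pos.2 h
  have h1 := integrable_truncKernel_sub_left 0 one_pos hδ 0 x₀
  have hm : Measurable (fun x' => truncKernel 0 (r - dist x₀ c) (x₀ - x')) :=
    (measurable_truncKernel _ _).comp (measurable_const.sub measurable_id)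
  have h2 := integrable_bdd_on_ball hm
    (fun x' => norm_truncKernel_le 0 hδ le_rfl (x₀ - x')) c r
  refine (h1.add h2).congr (ae_of_all _ fun x' => ?_)
  by_cases hx : x' ∈ Metric.ball c r
  · simp [hx]
  · simp [hx, truncKernel_eq_of_notMem_ball hx le_rfl]

/-- When `X` is at distance at least `ε` from the complement of the ball, the truncation acts only
inside the ball, and both formulas depend on `X` in the same way. They differ in what is subtracted
at infinity, which is a constant. Statements on all balls thus reduce to one global function. -/
lemma rieszTruncBdd_eq {C : ℝ} {θ : Plane → ℝ} (h : IsBddDensity C θ) {c x₀ X : Plane} {r ε : ℝ}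
    (hx₀ : x₀ ∈ Metric.ball c r) (hε : 0 < ε) (hX : ε ≤ r - dist X c) :
    rieszTruncBdd θ c r x₀ ε X = rieszNormalized θ ε X + rieszShift θ c r x₀ := by
  have hm : Measurable (fun x' => truncKernel 0 ε (X - x')) :=
    (measurable_truncKernel _ _).comp (measurable_const.sub measurable_id)
  have i1 : Integrable (fun x' => (Metric.ball c r).indicator θ x' • truncKernel 0 ε (X - x')) := by
    refine (h.integrable_smul (integrable_bdd_on_ball hm
      (fun x' => norm_truncKernel_le 0 hε le_rfl (X - x')) c r)).congr (ae_of_all _ fun x' => ?_)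
    by_cases hx : x' ∈ Metric.ball c r <;> simp [hx]
  have i2 := h.integrable_smul (integrable_truncKernel_sub_left 0 hε one_pos X 0)
  have i3 := h.integrable_smul (integrable_rieszShift_aux hx₀)
  have e : ∀ x', θ x' • (truncKernel 0 ε (X - x') - truncKernel 0 1 (0 - x'))
      + θ x' • (truncKernel 0 1 (0 - x')
        - (Metric.ball c r)ᶜ.indicator (fun x' => rieszKernel (x₀ - x')) x')
      - (Metric.ball c r).indicator θ x' • truncKernel 0 ε (X - x')
      = (Metric.ball c r)ᶜ.indicator
          (fun x' => θ x' • (rieszKernel (X - x') - rieszKernel (x₀ - x'))) x' := by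
    intro x'
    by_cases hx : x' ∈ Metric.ball c r
    · simp [hx, smul_sub]
    · simp [hx, truncKernel_eq_of_notMem_ball hx hX, smul_sub]
  rw [rieszTruncBdd, rieszTrunc_eq, rieszNormalized, rieszShift,
    ← integral_indicator measurableSet_ball.compl, ← integral_add i2 i3]
  simp_rw [← e]
  rw [integral_sub _ i1]
  · abel
  · exact i2.add i3

/-! ### Coordinates relative to a graph -/

/-- The abscissa, and the height above the graph of `f`. -/
def graphCoord (f : ℝ → ℝ) (X : Plane) : ℝ × ℝ := (X 0, X 1 - f (X 0))

lemma measurePreserving_graphCoord {f : ℝ → ℝ} (hf : Measurable f) :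
    MeasurePreserving (graphCoord f) := by
  have h1 := EuclideanSpace.volume_preserving_symm_measurableEquiv_toLp (Fin 2)
  have h2 := volume_preserving_finTwoArrow ℝ
  have h3 : MeasurePreserving (fun p : ℝ × ℝ => (p.1, p.2 - f p.1)) := by
    have := (MeasurePreserving.id (volume : Measure ℝ)).skew_product
      (g := fun x y => y - f x) (μc := (volume : Measure ℝ)) (μd := (volume : Measure ℝ))
      (by fun_prop) (ae_of_all _ fun x => (measurePreserving_sub_right volume (f x)).map_eq)
    exact this
  exact h3.comp (h2.comp h1)

lemma integral_comp_graphCoord {E : Type*} [NormedAddCommGroup E] [NormedSpace ℝ E] {f : ℝ → ℝ}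
    (hf : Measurable f) {F : ℝ × ℝ → E} (hF : AEStronglyMeasurable F) :
    ∫ X, F (graphCoord f X) = ∫ p, F p := by
  have h := measurePreserving_graphCoord hf
  rw [← h.map_eq, integral_map h.aemeasurable]
  rwa [h.map_eq]

/-- The point with given Cartesian coordinates. -/
def ofCoord (p : ℝ × ℝ) : Plane := !₂[p.1, p.2]

@[simp] lemma ofCoord_zero (p : ℝ × ℝ) : ofCoord p 0 = p.1 := rfl

@[simp] lemma ofCoord_one (p : ℝ × ℝ) : ofCoord p 1 = p.2 := rfl

lemma ofCoord_graphCoord (X : Plane) : ofCoord (graphCoord (fun _ => 0) X) = X := by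
  ext i; fin_cases i <;> simp [ofCoord, graphCoord]

lemma measurePreserving_ofCoord : MeasurePreserving ofCoord := by
  have h1 := (EuclideanSpace.volume_preserving_symm_measurableEquiv_toLp (Fin 2)).symm
  have h2 := (volume_preserving_finTwoArrow ℝ).symm
  exact h1.comp h2

lemma integral_plane {E : Type*} [NormedAddCommGroup E] [NormedSpace ℝ E] {F : Plane → E}
    (hF : AEStronglyMeasurable F) : ∫ X, F X = ∫ p, F (ofCoord p) := by
  have h := measurePreserving_ofCoord
  rw [← h.map_eq, integral_map h.aemeasurable]
  rwa [h.map_eq]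

lemma integrable_plane {E : Type*} [NormedAddCommGroup E] {F : Plane → E}
    (hF : Integrable (fun p => F (ofCoord p))) : Integrable F := by
  have h := (measurePreserving_graphCoord (f := fun _ => 0) measurable_const).integrable_comp_of_integrable hF
  simpa [Function.comp_def, ofCoord_graphCoord] using h

lemma ae_off_graph {f : ℝ → ℝ} (hf : Measurable f) : ∀ᵐ X : Plane, X 1 ≠ f (X 0) := by
  have h := measurePreserving_graphCoord hf
  have h0 : ∀ᵐ p : ℝ × ℝ, p.2 ≠ 0 :=
    Measure.quasiMeasurePreserving_snd.ae (Measure.ae_ne volume (0 : ℝ))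
  filter_upwards [h.quasiMeasurePreserving.ae h0] with X hX h'
  exact hX (by simp [graphCoord, h'])

lemma plane_norm_sq (z : Plane) : ‖z‖ ^ 2 = z 0 ^ 2 + z 1 ^ 2 := by
  rw [EuclideanSpace.norm_sq_eq]; simp

lemma abs_coord_le_norm (z : Plane) (i : Fin 2) : |z i| ≤ ‖z‖ := by
  simpa using PiLp.norm_apply_le z i

lemma plane_norm_le (z : Plane) : ‖z‖ ≤ |z 0| + |z 1| := by
  apply le_of_sq_le_sq _ (by positivity)
  rw [plane_norm_sq, add_sq, sq_abs, sq_abs]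
  have : 0 ≤ 2 * |z 0| * |z 1| := by positivity
  linarith

/-- The vertical distance to the graph of `f`. -/
def graphGap (f : ℝ → ℝ) (X : Plane) : ℝ := |X 1 - f (X 0)|

lemma graphGap_pos_iff {f : ℝ → ℝ} {X : Plane} : 0 < graphGap f X ↔ X 1 ≠ f (X 0) := by
  rw [graphGap, abs_pos, sub_ne_zero]

/-- The height above a `Λ`-Lipschitz graph is `(1 + Λ)`-Lipschitz. -/
lemma graphGap_le_add {f : ℝ → ℝ} {Λ : ℝ} (hf : ∀ a b, |f a - f b| ≤ Λ * |a - b|) (hΛ : 0 ≤ Λ)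
    (X Y : Plane) : graphGap f X ≤ graphGap f Y + (1 + Λ) * ‖X - Y‖ := by
  have h0 := abs_coord_le_norm (X - Y) 0
  have h1 := abs_coord_le_norm (X - Y) 1
  simp only [PiLp.sub_apply] at h0 h1
  have h2 := hf (Y 0) (X 0)
  rw [abs_sub_comm (Y 0)] at h2
  have h3 : X 1 - f (X 0) = (Y 1 - f (Y 0)) + ((X 1 - Y 1) + (f (Y 0) - f (X 0))) := by ring
  unfold graphGap
  rw [h3]
  calc _ ≤ |Y 1 - f (Y 0)| + (|X 1 - Y 1| + |f (Y 0) - f (X 0)|) :=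
        (abs_add_le _ _).trans (by gcongr; exact abs_add_le _ _)
    _ ≤ |Y 1 - f (Y 0)| + (‖X - Y‖ + Λ * ‖X - Y‖) := by
        gcongr; exact h2.trans (by gcongr)
    _ = _ := by ring

/-! ### A criterion for bounded mean oscillation -/

lemma integrableOn_abs_rpow {a : ℝ} (ha : -1 < a) (K : ℝ) :
    IntegrableOn (fun u : ℝ => |u| ^ a) (Icc (-K) K) := by
  have h : LocallyIntegrable (fun u : ℝ => |u| ^ a) := by
    rw [locallyIntegrable_iff]
    intro k hk
    obtain ⟨R, hR⟩ := hk.isBounded.subset_ball 0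
    have h1 : IntegrableOn (fun u : ℝ => u ^ a) (Ioc 0 (max R 0)) :=
      ((intervalIntegral.intervalIntegrable_rpow' ha).1)
    have h2 : IntegrableOn (fun u : ℝ => |u| ^ a) (Ioc 0 (max R 0)) :=
      h1.congr_fun (fun u hu => by simp [abs_of_pos hu.1]) measurableSet_Ioc
    have h3 : IntegrableOn (fun u : ℝ => |u| ^ a) (Ico (-(max R 0)) 0) := by
      have := h2.comp_neg
      simpa using this
    have h4 := (h3.union h2).union (integrableOn_singleton (f := fun u : ℝ => |u| ^ a) (x := 0) (μ := volume) (by simp) (by simp))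
    refine h4.mono_set fun x hx => ?_
    have := hR hx
    simp only [Metric.mem_ball, dist_zero_right, Real.norm_eq_abs, abs_lt] at this
    rcases lt_trichotomy x 0 with h | h | h
    · left; left; exact ⟨by have := le_max_left R 0; linarith, h⟩
    · right; exact h
    · left; right; exact ⟨h, this.2.le.trans (le_max_left _ _)⟩
  exact h.integrableOn_isCompact isCompact_Icc

/-- The mean of `g` is as close to `k` as `g` is on average, so an arbitrary constant may replace
the mean at the cost of a factor of two. -/
lemma average_oscillation_le {g : Plane → Plane} {s : Set Plane} (hs : volume s ≠ ⊤)
    (hs0 : volume s ≠ 0) (hg : IntegrableOn g s) (k : Plane) :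
    (⨍ x in s, ‖g x - ⨍ y in s, g y‖) ≤ 2 * ⨍ x in s, ‖g x - k‖ := by
  have hf : IsFiniteMeasure (volume.restrict s) := ⟨by simpa using hs.lt_top⟩
  have hp : IsProbabilityMeasure (ProbabilityTheory.cond volume s) := 
    ProbabilityTheory.cond_isProbabilityMeasure_of_finite hs0 hs
  set μ := (ProbabilityTheory.cond volume s) with hμ
  have e : ∀ {E : Type} [NormedAddCommGroup E] [NormedSpace ℝ E] (h : Plane → E),
      ⨍ x in s, h x = ∫ x, h x ∂μ := by
    intro E _ _ h
    simp only [average, hμ, ProbabilityTheory.cond]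
    simp
  have hgμ : Integrable g μ := by
    simp only [hμ, ProbabilityTheory.cond]
    exact Integrable.smul_measure hg (by simpa using hs0)
  rw [e, e, e]
  set m := ∫ x, g x ∂μ
  have hk : ‖k - m‖ ≤ ∫ x, ‖g x - k‖ ∂μ := by
    have : m - k = ∫ x, (g x - k) ∂μ := by
      rw [integral_sub hgμ (integrable_const k)]; simp [m]
    rw [← norm_neg, neg_sub, this]
    exact norm_integral_le_integral_norm _
  calc ∫ x, ‖g x - m‖ ∂μ ≤ ∫ x, (‖g x - k‖ + ‖k - m‖) ∂μ := by
        refine integral_mono (hgμ.sub (integrable_const m)).norm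
          ((hgμ.sub (integrable_const k)).norm.add (integrable_const _)) fun x => ?_
        exact norm_sub_le_norm_sub_add_norm_sub _ _ _
    _ = ∫ x, ‖g x - k‖ ∂μ + ‖k - m‖ := by
        have h1 : Integrable (fun x => ‖g x - k‖) μ := (hgμ.sub (integrable_const k)).norm
        rw [integral_add h1 (integrable_const _)]
        simp
    _ ≤ _ := by linarith

lemma plane_volume_real_ball (c : Plane) {ρ : ℝ} (hρ : 0 < ρ) :
    volume.real (Metric.ball c ρ) = ρ ^ 2 * volume.real (Metric.ball (0 : Plane) 1) := by
  rw [measureReal_def, Measure.addHaar_ball volume c hρ.le, ENNReal.toReal_mul,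
    ENNReal.toReal_ofReal (by positivity), measureReal_def]
  simp

lemma memBMO_of_integral_le {g : Plane → Plane} (hg : AEStronglyMeasurable g) {C : ℝ}
    (h : ∀ (c : Plane) (ρ : ℝ), 0 < ρ → ∃ k : Plane,
      IntegrableOn (fun X => ‖g X - k‖) (Metric.ball c ρ) ∧
      ∫ X in Metric.ball c ρ, ‖g X - k‖ ≤ C * ρ ^ 2) : MemBMO g := by
  have hi : ∀ (c : Plane) (ρ : ℝ), 0 < ρ → IntegrableOn g (Metric.ball c ρ) := by
    intro c ρ hρ
    obtain ⟨k, hk, -⟩ := h c ρ hρ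
    have h1 : IntegrableOn (fun X => g X - k) (Metric.ball c ρ) :=
      (integrable_norm_iff (hg.sub aestronglyMeasurable_const).restrict).1 hk
    have h2 : IntegrableOn (fun _ : Plane => k) (Metric.ball c ρ) :=
      integrableOn_const (measure_ball_lt_top.ne)
    exact (h1.add h2).congr (ae_of_all _ fun x => by simp)
  refine ⟨fun x => ⟨Metric.ball x 1, Metric.ball_mem_nhds x one_pos, hi x 1 one_pos⟩,
    2 * ((volume.real (Metric.ball (0 : Plane) 1))⁻¹ * C), fun c ρ hρ => ?_⟩
  obtain ⟨k, hk, hk'⟩ := h c ρ hρ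
  have hpos := (Metric.measure_ball_pos volume c hρ).ne'
  refine (average_oscillation_le measure_ball_lt_top.ne hpos (hi c ρ hρ) k).trans ?_
  gcongr
  rw [setAverage_eq, smul_eq_mul, plane_volume_real_ball c hρ]
  have hp : 0 < volume.real (Metric.ball (0 : Plane) 1) :=
    ENNReal.toReal_pos (Metric.measure_ball_pos _ _ one_pos).ne' measure_ball_lt_top.ne
  calc (ρ ^ 2 * volume.real (Metric.ball (0 : Plane) 1))⁻¹ * ∫ X in Metric.ball c ρ, ‖g X - k‖
      ≤ (ρ ^ 2 * volume.real (Metric.ball (0 : Plane) 1))⁻¹ * (C * ρ ^ 2) := by gcongr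
    _ = _ := by field_simp

/-- The integral of `√(ρ / gap)` over a ball of radius `ρ`. -/
lemma setIntegral_sqrt_div_gap_le {f : ℝ → ℝ} (hf : Measurable f) (K : ℝ) :
    ∃ C, ∀ (c : Plane) (ρ : ℝ), 0 < ρ →
      (∀ X ∈ Metric.ball c ρ, graphGap f X ≤ K * ρ) →
      IntegrableOn (fun X => Real.sqrt (ρ / graphGap f X)) (Metric.ball c ρ) ∧
      ∫ X in Metric.ball c ρ, Real.sqrt (ρ / graphGap f X) ≤ C * ρ ^ 2 := by
  -- With `u = height / ρ` the integrand is `|u|^(-1/2)`, integrable at zero; the bound `K * ρ` on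
  -- the gap confines `u` to a fixed interval.
  set φ : ℝ → ℝ := (Icc (-K) K).indicator (fun u => |u| ^ (-(1 / 2) : ℝ)) with hφ
  have hφi : Integrable φ :=
    (integrable_indicator_iff measurableSet_Icc).2 (integrableOn_abs_rpow (by norm_num) K)
  refine ⟨2 * ∫ u, φ u, fun c ρ hρ hK => ?_⟩
  set χ : ℝ → ℝ := (Icc (c 0 - ρ) (c 0 + ρ)).indicator (fun _ => 1) with hχ
  have hχi : Integrable χ := (integrable_indicator_iff measurableSet_Icc).2
    (integrableOn_const (by simp))
  have hφρ : Integrable (fun v => φ (v / ρ)) := hφi.comp_div hρ.ne'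
  have hprod : Integrable (fun p : ℝ × ℝ => χ p.1 * φ (p.2 / ρ)) := hχi.mul_prod hφρ
  have hmp := measurePreserving_graphCoord hf
  have hcomp := hmp.integrable_comp_of_integrable hprod
  have hnn : ∀ X, 0 ≤ χ (graphCoord f X).1 * φ ((graphCoord f X).2 / ρ) := fun X =>
    mul_nonneg (indicator_nonneg (fun _ _ => zero_le_one) _)
      (indicator_nonneg (fun _ _ => by positivity) _)
  have heq : ∀ X ∈ Metric.ball c ρ, Real.sqrt (ρ / graphGap f X)
      = χ (graphCoord f X).1 * φ ((graphCoord f X).2 / ρ) := by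
    intro X hX
    have h1 : (graphCoord f X).1 ∈ Icc (c 0 - ρ) (c 0 + ρ) := by
      have := (abs_coord_le_norm (X - c) 0).trans (mem_ball_iff_norm.1 hX).le
      simp only [PiLp.sub_apply, abs_le] at this
      exact ⟨by simp only [graphCoord]; linarith, by simp only [graphCoord]; linarith⟩
    have h2 : (graphCoord f X).2 / ρ ∈ Icc (-K) K := by
      have := hK X hX
      rw [mem_Icc, ← abs_le, abs_div, abs_of_pos hρ, div_le_iff₀ hρ]
      exact this
    rw [hχ, hφ, indicator_of_mem h1, indicator_of_mem h2, one_mul, abs_div, abs_of_pos hρ,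
      Real.rpow_neg (by positivity), ← Real.sqrt_eq_rpow, ← Real.sqrt_inv, inv_div]
    rfl
  constructor
  · exact hcomp.integrableOn.congr_fun (fun X hX => (heq X hX).symm) measurableSet_ball
  · rw [setIntegral_congr_fun measurableSet_ball heq]
    refine (setIntegral_le_integral hcomp (ae_of_all _ hnn)).trans_eq ?_
    have e := integral_comp_graphCoord hf hprod.aestronglyMeasurable
    have e2 := integral_prod_mul (μ := (volume : Measure ℝ)) (ν := (volume : Measure ℝ))
      χ (fun v => φ (v / ρ))
    have e3 : ∫ x, χ x = 2 * ρ := by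
      rw [hχ, integral_indicator measurableSet_Icc]
      simp
      ring_nf
      simp [hρ.le]
    have e4 : ∫ v, φ (v / ρ) = ρ * ∫ u, φ u := by
      rw [Measure.integral_comp_div φ ρ, abs_of_pos hρ, smul_eq_mul]
    rw [e3, e4] at e2
    exact e.trans (e2.trans (by ring))

/-- A function that varies by a bounded amount over distances comparable to the distance to a
Lipschitz graph, also across the graph, is in BMO. -/
theorem memBMO_of_gap {g : Plane → Plane} (hg : AEStronglyMeasurable g) {f : ℝ → ℝ} {Λ : ℝ}
    (hf : ∀ a b, |f a - f b| ≤ Λ * |a - b|) (hfm : Measurable f) (hΛ : 0 ≤ Λ)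
    (hD : ∀ A : ℝ, 1 ≤ A → ∃ C, 0 ≤ C ∧ ∀ r : ℝ, 0 < r → ∀ X X' : Plane,
      (1 + Λ) * r ≤ graphGap f X → (1 + Λ) * r ≤ graphGap f X' → ‖X - X'‖ ≤ A * r →
        ‖g X - g X'‖ ≤ C) : MemBMO g := by
  -- A ball of radius `ρ` whose centre has gap below `2 (1 + Λ) ρ` has gaps at most `K * ρ`. The
  -- constant `C0` serves balls far from the graph, `C1` one doubling of the gap, and `C2` the
  -- comparison with the reference point at height `ρ` above the graph.
  set K := 3 * (1 + Λ) with hKdef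
  obtain ⟨C0, hC0, h0⟩ := hD 1 le_rfl
  obtain ⟨C1, hC1, h1⟩ := hD (1 + Λ) (by linarith)
  obtain ⟨C2, hC2, h2⟩ := hD ((1 + Λ) * (2 + K + Λ)) (by nlinarith)
  obtain ⟨CK, hCK⟩ := setIntegral_sqrt_div_gap_le hfm K
  set vol := volume.real (Metric.ball (0 : Plane) 1)
  have hvol : ∀ (c : Plane) (ρ : ℝ), 0 < ρ → volume.real (Metric.ball c ρ) = ρ ^ 2 * vol :=
    fun c ρ hρ => plane_volume_real_ball c hρ
  -- the chain of points moving away from the graph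
  have chain : ∀ (c : Plane) (ρ : ℝ), 0 < ρ → ∀ n : ℕ, ∀ X : Plane, |X 0 - c 0| ≤ ρ →
      0 < graphGap f X → graphGap f X ≤ K * ρ → ρ ≤ 2 ^ n * graphGap f X →
      ‖g X - g !₂[c 0, f (c 0) + ρ]‖ ≤ C2 + 4 * C1 * Real.sqrt (ρ / graphGap f X) := by
    intro c ρ hρ n
    have base : ∀ X : Plane, |X 0 - c 0| ≤ ρ → graphGap f X ≤ K * ρ → ρ ≤ graphGap f X →
        ‖g X - g !₂[c 0, f (c 0) + ρ]‖ ≤ C2 := by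
      intro X hX hK hgap
      have hr : (1 + Λ) * (ρ / (1 + Λ)) = ρ := by field_simp
      refine h2 (ρ / (1 + Λ)) (by positivity) _ _ (by rw [hr]; exact hgap) ?_ ?_
      · rw [hr]; simp [graphGap, abs_of_pos hρ]
      · have e : (1 + Λ) * (2 + K + Λ) * (ρ / (1 + Λ)) = ρ + (K * ρ + Λ * ρ + ρ) := by
          field_simp; ring
        rw [e]
        refine (plane_norm_le _).trans (add_le_add (by simpa using hX) ?_)
        have e2 : (X - !₂[c 0, f (c 0) + ρ]) 1 = (X 1 - f (X 0)) + (f (X 0) - f (c 0)) + -ρ := by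
          simp; ring
        rw [e2]
        refine (abs_add_three _ _ _).trans ?_
        have := (hf (X 0) (c 0)).trans (mul_le_mul_of_nonneg_left hX hΛ)
        rw [abs_neg, abs_of_pos hρ]
        have h3 : |X 1 - f (X 0)| ≤ K * ρ := hK
        linarith
    induction n with
    | zero =>
      intro X hX _ hK hgap
      rw [pow_zero, one_mul] at hgap
      have := base X hX hK hgap
      have : 0 ≤ 4 * C1 * Real.sqrt (ρ / graphGap f X) := by positivity
      linarith [base X hX hK hgap]
    | succ n ih =>
      intro X hX hpos hK hgap
      rcases le_or_gt ρ (graphGap f X) with h | h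
      · have : 0 ≤ 4 * C1 * Real.sqrt (ρ / graphGap f X) := by positivity
        linarith [base X hX hK h]
      -- Doubling the signed height keeps the side of the graph and moves the point by exactly its
      -- gap. A crossing to the reference point, which is above the graph, takes place only in the
      -- base case.
      set Y : Plane := !₂[X 0, f (X 0) + 2 * (X 1 - f (X 0))] with hY
      have hYgap : graphGap f Y = 2 * graphGap f X := by
        simp [graphGap, hY, abs_mul]
      have hstep : ‖g X - g Y‖ ≤ C1 := by
        have hr : (1 + Λ) * (graphGap f X / (1 + Λ)) = graphGap f X := by field_simp
        refine h1 (graphGap f X / (1 + Λ)) (by positivity) _ _ (by rw [hr]) ?_ ?_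
        · rw [hr, hYgap]; linarith
        · rw [hr]
          have : X - Y = !₂[0, -(X 1 - f (X 0))] := by
            ext i; fin_cases i
            · simp [hY]
            · simp [hY]; ring
          rw [this]
          refine (plane_norm_le _).trans ?_
          simp only [Matrix.cons_val_zero, Matrix.cons_val_one, abs_neg]
          simp [graphGap]
      have hrec := ih Y (by simpa [hY] using hX) (by rw [hYgap]; linarith)
        (by rw [hYgap]; nlinarith) (by rw [hYgap]; rw [pow_succ] at hgap; linarith)
      -- Since `√(1/2) ≤ 3/4` and `1 + 4 * (3/4) = 4`, the growth of the square root absorbs the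
      -- cost `C1` of each step, and the number of steps need not be counted.
      have hs : Real.sqrt (ρ / graphGap f Y) ≤ 3 / 4 * Real.sqrt (ρ / graphGap f X) := by
        rw [hYgap]
        apply Real.sqrt_le_iff.2 ⟨by positivity, ?_⟩
        rw [mul_pow, Real.sq_sqrt (by positivity)]
        have : ρ / (2 * graphGap f X) = 1 / 2 * (ρ / graphGap f X) := by field_simp
        rw [this]
        gcongr; norm_num
      have hone : 1 ≤ Real.sqrt (ρ / graphGap f X) := by
        rw [Real.one_le_sqrt, one_le_div hpos]; exact h.le
      calc ‖g X - g !₂[c 0, f (c 0) + ρ]‖ ≤ ‖g X - g Y‖ + ‖g Y - g !₂[c 0, f (c 0) + ρ]‖ :=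
            norm_sub_le_norm_sub_add_norm_sub _ _ _
        _ ≤ C1 * Real.sqrt (ρ / graphGap f X)
            + (C2 + 4 * C1 * (3 / 4 * Real.sqrt (ρ / graphGap f X))) := by
            refine add_le_add (hstep.trans (le_mul_of_one_le_right hC1 hone)) (hrec.trans ?_)
            gcongr
        _ = _ := by ring
  refine memBMO_of_integral_le hg (C := (C0 + C2) * vol + 4 * C1 * |CK|) fun c ρ hρ => ?_
  have hball := measure_ball_lt_top (μ := (volume : Measure Plane)) (x := c) (r := ρ)
  -- Far from the graph `g` is compared with its value at the centre; near it, the chain bound is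
  -- integrated over the ball.
  by_cases hc : 2 * (1 + Λ) * ρ ≤ graphGap f c
  · refine ⟨g c, ?_⟩
    have hb : ∀ X ∈ Metric.ball c ρ, ‖g X - g c‖ ≤ C0 := by
      intro X hX
      have hX' : ‖X - c‖ ≤ ρ := (mem_ball_iff_norm.1 hX).le
      have h3 := graphGap_le_add hf hΛ c X
      rw [norm_sub_rev] at h3
      have h4 : (1 + Λ) * ‖X - c‖ ≤ (1 + Λ) * ρ := by gcongr
      exact h0 ρ hρ X c (by linarith) (by nlinarith) (by linarith)
    have hi : IntegrableOn (fun X => ‖g X - g c‖) (Metric.ball c ρ) :=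
      Measure.integrableOn_of_bounded (M := C0) hball.ne
        (hg.sub aestronglyMeasurable_const).norm
        ((ae_restrict_iff' measurableSet_ball).2 (ae_of_all _ fun X hX => by simpa using hb X hX))
    refine ⟨hi, ?_⟩
    calc ∫ X in Metric.ball c ρ, ‖g X - g c‖ ≤ ∫ X in Metric.ball c ρ, C0 :=
          setIntegral_mono_on hi (integrableOn_const hball.ne) measurableSet_ball hb
      _ = C0 * vol * ρ ^ 2 := by
          rw [setIntegral_const, hvol c ρ hρ, smul_eq_mul]; ring
      _ ≤ _ := by
          gcongr
          have : 0 ≤ C2 * vol := by positivity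
          have : 0 ≤ 4 * C1 * |CK| := by positivity
          linarith
  · push Not at hc
    refine ⟨g !₂[c 0, f (c 0) + ρ], ?_⟩
    have hK : ∀ X ∈ Metric.ball c ρ, graphGap f X ≤ K * ρ := by
      intro X hX
      have hX' : ‖X - c‖ ≤ ρ := (mem_ball_iff_norm.1 hX).le
      have h3 := graphGap_le_add hf hΛ X c
      have h4 : (1 + Λ) * ‖X - c‖ ≤ (1 + Λ) * ρ := by gcongr
      rw [hKdef]; linarith
    have hb : ∀ X ∈ Metric.ball c ρ, 0 < graphGap f X → ‖g X - g !₂[c 0, f (c 0) + ρ]‖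
        ≤ C2 + 4 * C1 * Real.sqrt (ρ / graphGap f X) := by
      intro X hX hpos
      obtain ⟨n, hn⟩ := pow_unbounded_of_one_lt (ρ / graphGap f X) one_lt_two
      refine chain c ρ hρ n X ?_ hpos (hK X hX) (by rw [div_lt_iff₀ hpos] at hn; exact hn.le)
      have := (abs_coord_le_norm (X - c) 0).trans (mem_ball_iff_norm.1 hX).le
      simpa using this
    obtain ⟨hsi, hsle⟩ := hCK c ρ hρ hK
    have hdom : IntegrableOn (fun X => C2 + 4 * C1 * Real.sqrt (ρ / graphGap f X))
        (Metric.ball c ρ) := (integrableOn_const hball.ne).add (hsi.const_mul _)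
    have hbae : ∀ᵐ X ∂(volume.restrict (Metric.ball c ρ)), ‖g X - g !₂[c 0, f (c 0) + ρ]‖
        ≤ C2 + 4 * C1 * Real.sqrt (ρ / graphGap f X) := by
      rw [ae_restrict_iff' measurableSet_ball]
      filter_upwards [ae_off_graph hfm] with X hX hXb
      exact hb X hXb (graphGap_pos_iff.2 hX)
    have hi : IntegrableOn (fun X => ‖g X - g !₂[c 0, f (c 0) + ρ]‖) (Metric.ball c ρ) :=
      hdom.mono' (hg.sub aestronglyMeasurable_const).norm.restrict
        (by filter_upwards [hbae] with X hX; simpa using hX)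
    refine ⟨hi, ?_⟩
    calc ∫ X in Metric.ball c ρ, ‖g X - g !₂[c 0, f (c 0) + ρ]‖
        ≤ ∫ X in Metric.ball c ρ, (C2 + 4 * C1 * Real.sqrt (ρ / graphGap f X)) :=
          integral_mono_ae hi hdom hbae
      _ = C2 * vol * ρ ^ 2 + 4 * C1 * ∫ X in Metric.ball c ρ, Real.sqrt (ρ / graphGap f X) := by
          have hcst : IntegrableOn (fun _ : Plane => C2) (Metric.ball c ρ) :=
            integrableOn_const hball.ne
          rw [integral_add hcst (hsi.const_mul _), setIntegral_const,
            hvol c ρ hρ, smul_eq_mul, integral_const_mul]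
          ring
      _ ≤ C2 * vol * ρ ^ 2 + 4 * C1 * (|CK| * ρ ^ 2) := by
          gcongr
          exact hsle.trans (by gcongr; exact le_abs_self _)
      _ ≤ _ := by
          have : 0 ≤ C0 * vol * ρ ^ 2 := by positivity
          linarith

/-! ### One-dimensional integrals -/

lemma integral_eq_zero_of_odd {E : Type*} [NormedAddCommGroup E] [NormedSpace ℝ E] {f : ℝ → E}
    (hf : ∀ x, f (-x) = -f x) : ∫ x, f x = 0 := by
  have h := integral_neg_eq_self f volume
  simp_rw [hf] at h
  rw [integral_neg, neg_eq_iff_add_eq_zero, ← two_smul ℝ] at h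
  simpa using h

lemma min_one_mul_le (s a : ℝ) : min 1 (a ^ 2) * (1 + s ^ 2) ≤ s ^ 2 + a ^ 2 := by
  have h1 := min_le_left 1 (a ^ 2)
  have h2 := min_le_right 1 (a ^ 2)
  nlinarith [sq_nonneg s]

lemma integrable_inv_sq_add_sq {a : ℝ} (ha : a ≠ 0) :
    Integrable (fun s : ℝ => (s ^ 2 + a ^ 2)⁻¹) := by
  have hm : 0 < min 1 (a ^ 2) := lt_min one_pos (by positivity)
  refine (integrable_inv_one_add_sq.const_mul (min 1 (a ^ 2))⁻¹).mono'
    (by fun_prop) (ae_of_all _ fun s => ?_)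
  rw [Real.norm_of_nonneg (by positivity), ← mul_inv]
  exact inv_anti₀ (by positivity) (min_one_mul_le s a)

lemma abs_le_sqrt_sq_add (s a : ℝ) : |s| ≤ Real.sqrt (s ^ 2 + a ^ 2) :=
  Real.abs_le_sqrt (by linarith [sq_nonneg a])

lemma sqrt_sq_add_pos (s : ℝ) {a : ℝ} (ha : a ≠ 0) : 0 < Real.sqrt (s ^ 2 + a ^ 2) :=
  Real.sqrt_pos.2 (by positivity)

lemma integrable_inv_sqrt_cube {a : ℝ} (ha : a ≠ 0) :
    Integrable (fun s : ℝ => (Real.sqrt (s ^ 2 + a ^ 2) ^ 3)⁻¹) := by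
  refine ((integrable_inv_sq_add_sq ha).const_mul |a|⁻¹).mono' (by fun_prop)
    (ae_of_all _ fun s => ?_)
  have h := sqrt_sq_add_pos s ha
  have h2 : |a| ≤ Real.sqrt (s ^ 2 + a ^ 2) := Real.abs_le_sqrt (by linarith [sq_nonneg s])
  have h3 : 0 < |a| := abs_pos.2 ha
  rw [Real.norm_of_nonneg (by positivity), ← mul_inv]
  refine inv_anti₀ (by positivity) ?_
  have h4 : Real.sqrt (s ^ 2 + a ^ 2) ^ 2 = s ^ 2 + a ^ 2 := Real.sq_sqrt (by positivity)
  calc |a| * (s ^ 2 + a ^ 2) ≤ Real.sqrt (s ^ 2 + a ^ 2) * (s ^ 2 + a ^ 2) := by gcongr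
    _ = Real.sqrt (s ^ 2 + a ^ 2) ^ 3 := by rw [pow_succ' _ 2, h4]

lemma integrable_mul_inv_sqrt_cube {a : ℝ} (ha : a ≠ 0) :
    Integrable (fun s : ℝ => s * (Real.sqrt (s ^ 2 + a ^ 2) ^ 3)⁻¹) := by
  refine (integrable_inv_sq_add_sq ha).mono' (by fun_prop) (ae_of_all _ fun s => ?_)
  have h := sqrt_sq_add_pos s ha
  have h2 := abs_le_sqrt_sq_add s a
  have h4 : Real.sqrt (s ^ 2 + a ^ 2) ^ 2 = s ^ 2 + a ^ 2 := Real.sq_sqrt (by positivity)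
  rw [norm_mul, Real.norm_eq_abs, Real.norm_of_nonneg (by positivity)]
  calc |s| * (Real.sqrt (s ^ 2 + a ^ 2) ^ 3)⁻¹
      ≤ Real.sqrt (s ^ 2 + a ^ 2) * (Real.sqrt (s ^ 2 + a ^ 2) ^ 3)⁻¹ := by gcongr
    _ = (Real.sqrt (s ^ 2 + a ^ 2) ^ 2)⁻¹ := by field_simp
    _ = _ := by rw [h4]

lemma integral_mul_inv_sqrt_cube (a : ℝ) :
    ∫ s : ℝ, s * (Real.sqrt (s ^ 2 + a ^ 2) ^ 3)⁻¹ = 0 :=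
  integral_eq_zero_of_odd fun s => by simp

lemma hasDerivAt_sqrt_sq_add (s : ℝ) {a : ℝ} (ha : a ≠ 0) :
    HasDerivAt (fun s => Real.sqrt (s ^ 2 + a ^ 2)) (s / Real.sqrt (s ^ 2 + a ^ 2)) s := by
  have h : HasDerivAt (fun s : ℝ => s ^ 2 + a ^ 2) (2 * s) s := by
    simpa using (hasDerivAt_pow 2 s).add_const (a ^ 2)
  convert h.sqrt (by positivity) using 1
  field_simp

lemma tendsto_div_sqrt_sq_add_atTop (a : ℝ) :
    Tendsto (fun s : ℝ => s / Real.sqrt (s ^ 2 + a ^ 2)) atTop (𝓝 1) := by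
  have h0 : Tendsto (fun s : ℝ => a ^ 2 / s ^ 2) atTop (𝓝 0) :=
    tendsto_const_nhds.div_atTop (tendsto_pow_atTop two_ne_zero)
  have h : Tendsto (fun s : ℝ => (Real.sqrt (1 + a ^ 2 / s ^ 2))⁻¹) atTop (𝓝 1) := by
    have := ((h0.const_add 1).sqrt).inv₀ (by simp)
    simpa using this
  refine h.congr' ?_
  filter_upwards [eventually_gt_atTop 0] with s hs
  have : s ^ 2 + a ^ 2 = s ^ 2 * (1 + a ^ 2 / s ^ 2) := by field_simp
  rw [this, Real.sqrt_mul (by positivity), Real.sqrt_sq hs.le]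
  have : 0 < Real.sqrt (1 + a ^ 2 / s ^ 2) := Real.sqrt_pos.2 (by positivity)
  field_simp

lemma tendsto_div_sqrt_sq_add_atBot (a : ℝ) :
    Tendsto (fun s : ℝ => s / Real.sqrt (s ^ 2 + a ^ 2)) atBot (𝓝 (-1)) := by
  have h := ((tendsto_div_sqrt_sq_add_atTop a).comp tendsto_neg_atBot_atTop).neg
  refine h.congr fun s => ?_
  simp [neg_div]

lemma integral_inv_sqrt_cube {a : ℝ} (ha : a ≠ 0) :
    ∫ s : ℝ, (Real.sqrt (s ^ 2 + a ^ 2) ^ 3)⁻¹ = 2 / a ^ 2 := by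
  have hd : ∀ s : ℝ, HasDerivAt (fun s => (a ^ 2)⁻¹ * (s / Real.sqrt (s ^ 2 + a ^ 2)))
      ((Real.sqrt (s ^ 2 + a ^ 2) ^ 3)⁻¹) s := by
    intro s
    have hp := sqrt_sq_add_pos s ha
    have h4 : Real.sqrt (s ^ 2 + a ^ 2) ^ 2 = s ^ 2 + a ^ 2 := Real.sq_sqrt (by positivity)
    refine (((hasDerivAt_id' s).div (hasDerivAt_sqrt_sq_add s ha) hp.ne').const_mul
      (a ^ 2)⁻¹).congr_deriv ?_
    field_simp
    rw [h4]; ring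
  rw [integral_of_hasDerivAt_of_tendsto hd (integrable_inv_sqrt_cube ha)
    ((tendsto_div_sqrt_sq_add_atBot a).const_mul _) ((tendsto_div_sqrt_sq_add_atTop a).const_mul _)]
  field_simp; norm_num

/-! ### The velocity of a planar front -/

lemma measurable_frontTheta {f : ℝ → ℝ} (hf : Measurable f) : Measurable (frontTheta f) := by
  unfold frontTheta
  exact Measurable.ite (measurableSet_lt (by fun_prop) (by fun_prop)) measurable_const
    measurable_const

lemma isBddDensity_frontTheta {f : ℝ → ℝ} (hf : Measurable f) :
    IsBddDensity (2 * Real.pi) (frontTheta f) := by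
  refine ⟨measurable_frontTheta hf, fun x => ?_⟩
  unfold frontTheta
  split_ifs
  · rw [abs_of_pos Real.two_pi_pos]
  · simpa using Real.pi_pos.le

lemma norm_regKernel_le_inv_sq {η : ℝ} (hη : 0 < η) (z : Plane) : ‖regKernel η z‖ ≤ (η ^ 2)⁻¹ := by
  have h0 : 0 < Real.sqrt (‖z‖ ^ 2 + η ^ 2) := sqrt_sq_add_pos _ hη.ne'
  have h4 : Real.sqrt (‖z‖ ^ 2 + η ^ 2) ^ 2 = ‖z‖ ^ 2 + η ^ 2 := Real.sq_sqrt (by positivity)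
  rw [regKernel, norm_smul, Real.norm_of_nonneg (by positivity)]
  calc (2 * Real.pi)⁻¹ * (Real.sqrt (‖z‖ ^ 2 + η ^ 2) ^ 3)⁻¹ * ‖z‖
      ≤ 1 * (Real.sqrt (‖z‖ ^ 2 + η ^ 2) ^ 3)⁻¹ * Real.sqrt (‖z‖ ^ 2 + η ^ 2) := by
        gcongr
        · exact inv_two_pi_le_one
        · exact norm_le_sqrt_sq_add_sq z η
    _ = (Real.sqrt (‖z‖ ^ 2 + η ^ 2) ^ 2)⁻¹ := by field_simp
    _ ≤ _ := by rw [h4]; gcongr; linarith [sq_nonneg ‖z‖]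

lemma integrable_regKernel_sub_trunc {η : ℝ} (hη : 0 < η) (r : ℝ) (X : Plane) :
    Integrable (fun x' => regKernel η (X - x') - truncKernel η r (X - x')) := by
  have hm : Measurable (fun x' => regKernel η (X - x')) :=
    (measurable_regKernel η).comp (measurable_const.sub measurable_id)
  refine (integrable_bdd_on_ball hm (fun x => norm_regKernel_le_inv_sq hη _) X r).congr
    (ae_of_all _ fun x' => ?_)
  by_cases hx : x' ∈ Metric.ball X r
  · have : ¬ r ≤ ‖X - x'‖ := by
      rw [← dist_eq_norm, dist_comm]; simpa using hx
    simp [hx, truncKernel, this]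
  · have : r ≤ ‖X - x'‖ := by
      rw [← dist_eq_norm, dist_comm]; simpa using hx
    simp [hx, truncKernel, this]

/-- Oddness again: the difference lives on a ball where `θ` is constant. Truncation at radius `0`
serves as no truncation. -/
lemma integral_regKernel_sub_trunc {θ : Plane → ℝ} {k η r : ℝ} {X : Plane}
    (hk : ∀ x' ∈ Metric.ball X r, θ x' = k) :
    ∫ x', θ x' • (regKernel η (X - x') - truncKernel η r (X - x')) = 0 := by
  have e : ∀ x', θ x' • (regKernel η (X - x') - truncKernel η r (X - x'))
      = k • (truncKernel η 0 (X - x') - truncKernel η r (X - x')) := by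
    intro x'
    have h0 : truncKernel η 0 (X - x') = regKernel η (X - x') := if_pos (norm_nonneg _)
    by_cases hx : x' ∈ Metric.ball X r
    · rw [hk x' hx, h0]
    · have h1 : r ≤ ‖X - x'‖ := by
        rw [← dist_eq_norm, dist_comm]; simpa using hx
      simp [truncKernel, h1]
  simp_rw [e]
  rw [integral_smul, integral_truncKernel_sub_self, smul_zero]

lemma integrable_regKernel_sub {η : ℝ} (hη : 0 < η) (X X' : Plane) :
    Integrable (fun x' => regKernel η (X - x') - regKernel η (X' - x')) := by
  have h := ((integrable_regKernel_sub_trunc hη 1 X).sub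
    (integrable_regKernel_sub_trunc hη 1 X')).add
    (integrable_truncKernel_sub_left η one_pos one_pos X X')
  refine h.congr (ae_of_all _ fun x' => ?_)
  simp only [Pi.add_apply, Pi.sub_apply]
  abel

lemma regKernel_apply (η : ℝ) (z : Plane) (i : Fin 2) :
    regKernel η z i = (2 * Real.pi)⁻¹ * (z i * (Real.sqrt (z 0 ^ 2 + (z 1 ^ 2 + η ^ 2)) ^ 3)⁻¹) := by
  simp only [regKernel, PiLp.smul_apply, smul_eq_mul, plane_norm_sq]
  rw [add_assoc]; ring

lemma integral_plane_apply {F : Plane → Plane} (hF : Integrable F) (i : Fin 2) :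
    (∫ X, F X) i = ∫ X, F X i :=
  ((EuclideanSpace.proj (𝕜 := ℝ) i).integral_comp_comm hF).symm

lemma integrable_plane_apply {F : Plane → Plane} (hF : Integrable F) (i : Fin 2) :
    Integrable (fun X => F X i) :=
  (EuclideanSpace.proj (𝕜 := ℝ) i).integrable_comp hF

lemma tendsto_log_sub_log_atTop (a b η : ℝ) (hη : η ≠ 0) :
    Tendsto (fun y : ℝ => Real.log ((a - y) ^ 2 + η ^ 2) - Real.log ((b - y) ^ 2 + η ^ 2))
      atTop (𝓝 0) := by
  have h : ∀ a : ℝ, Tendsto (fun y : ℝ => (a / y - 1) ^ 2 + η ^ 2 / y ^ 2) atTop (𝓝 1) := by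
    intro a
    have h1 : Tendsto (fun y : ℝ => a / y) atTop (𝓝 0) := tendsto_const_nhds.div_atTop tendsto_id
    have h2 : Tendsto (fun y : ℝ => η ^ 2 / y ^ 2) atTop (𝓝 0) :=
      tendsto_const_nhds.div_atTop (tendsto_pow_atTop two_ne_zero)
    have := ((h1.sub_const 1).pow 2).add h2
    simpa using this
  have h3 := ((h a).log one_ne_zero).sub ((h b).log one_ne_zero)
  simp only [Real.log_one, sub_zero] at h3
  refine h3.congr' ?_
  filter_upwards [eventually_gt_atTop 0] with y hy
  have e : ∀ a : ℝ, Real.log ((a / y - 1) ^ 2 + η ^ 2 / y ^ 2)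
      = Real.log ((a - y) ^ 2 + η ^ 2) - Real.log (y ^ 2) := by
    intro a
    rw [← Real.log_div (by positivity) (by positivity)]
    congr 1; field_simp
  rw [e, e]; ring

/-- Along a horizontal line the first component is odd about the abscissa of the point. The second
has the integral `2 w / (w² + η²)` at vertical distance `w`, a logarithmic derivative. -/
lemma integral_slice_regKernel_sub {η : ℝ} (hη : 0 < η) (X X' : Plane) (y : ℝ) (i : Fin 2) :
    ∫ x, (2 * Real.pi) * (regKernel η (X - ofCoord (x, y)) i - regKernel η (X' - ofCoord (x, y)) i)
      = if i = 0 then 0 else 2 * (X 1 - y) / ((X 1 - y) ^ 2 + η ^ 2)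
          - 2 * (X' 1 - y) / ((X' 1 - y) ^ 2 + η ^ 2) := by
  have hpi := Real.two_pi_pos.ne'
  have ha : ∀ w : ℝ, Real.sqrt (w ^ 2 + η ^ 2) ≠ 0 := fun w => (sqrt_sq_add_pos w hη.ne').ne'
  have hsq : ∀ w : ℝ, w ^ 2 + η ^ 2 = Real.sqrt (w ^ 2 + η ^ 2) ^ 2 := fun w =>
    (Real.sq_sqrt (by positivity)).symm
  have e : ∀ (Z : Plane) (x : ℝ), (2 * Real.pi) * regKernel η (Z - ofCoord (x, y)) i
      = (fun s : ℝ => (if i = 0 then s else Z 1 - y)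
        * (Real.sqrt (s ^ 2 + Real.sqrt ((Z 1 - y) ^ 2 + η ^ 2) ^ 2) ^ 3)⁻¹) (Z 0 - x) := by
    intro Z x
    rw [regKernel_apply, ← hsq, mul_inv_cancel_left₀ hpi]
    fin_cases i <;> simp
  have hint : ∀ Z : Plane, Integrable (fun x => (2 * Real.pi) * regKernel η (Z - ofCoord (x, y)) i) ∧
      ∫ x, (2 * Real.pi) * regKernel η (Z - ofCoord (x, y)) i
        = if i = 0 then 0 else 2 * (Z 1 - y) / ((Z 1 - y) ^ 2 + η ^ 2) := by
    intro Z
    simp_rw [e]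
    rw [integral_sub_left_eq_self (fun s : ℝ => (if i = 0 then s else Z 1 - y)
        * (Real.sqrt (s ^ 2 + Real.sqrt ((Z 1 - y) ^ 2 + η ^ 2) ^ 2) ^ 3)⁻¹) volume (Z 0)]
    fin_cases i
    · simp only [Fin.zero_eta, Fin.isValue, ↓reduceIte]
      exact ⟨(integrable_mul_inv_sqrt_cube (ha _)).comp_sub_left (Z 0),
        integral_mul_inv_sqrt_cube _⟩
    · simp only [Fin.mk_one, Fin.isValue, one_ne_zero, ↓reduceIte]
      refine ⟨((integrable_inv_sqrt_cube (ha _)).const_mul _).comp_sub_left (Z 0), ?_⟩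
      rw [integral_const_mul, integral_inv_sqrt_cube (ha _), ← hsq]
      ring
  have e2 : ∀ x, (2 * Real.pi) * (regKernel η (X - ofCoord (x, y)) i
      - regKernel η (X' - ofCoord (x, y)) i) = 2 * Real.pi * regKernel η (X - ofCoord (x, y)) i
      - 2 * Real.pi * regKernel η (X' - ofCoord (x, y)) i := fun x => mul_sub _ _ _
  simp_rw [e2]
  rw [integral_sub (hint X).1 (hint X').1, (hint X).2, (hint X').2]
  split_ifs
  · simp
  · rfl

/-- With the horizontal integration done first, the vertical one has a logarithm as primitive. Two
base points are needed because a single kernel is not integrable over a half-plane; the difference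
of the logarithms vanishes at infinity. -/
lemma integral_planar_regKernel_sub {η : ℝ} (hη : 0 < η) (h : ℝ) (X X' : Plane) :
    ∫ x', frontTheta (fun _ => -h) x' • (regKernel η (X - x') - regKernel η (X' - x'))
      = !₂[0, Real.log ((X 1 + h) ^ 2 + η ^ 2) - Real.log ((X' 1 + h) ^ 2 + η ^ 2)] := by
  have hI := (isBddDensity_frontTheta (f := fun _ => -h) measurable_const).integrable_smul
    (integrable_regKernel_sub hη X X')
  ext i
  rw [integral_plane_apply hI i]
  have hIi := integrable_plane_apply hI i
  rw [integral_plane hIi.aestronglyMeasurable]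
  have hIp := measurePreserving_ofCoord.integrable_comp_of_integrable hIi
  simp only [Function.comp_def] at hIp
  rw [Measure.volume_eq_prod, integral_prod_symm _ hIp]
  have e : ∀ y : ℝ, ∫ x : ℝ, (frontTheta (fun _ => -h) (ofCoord (x, y))
      • (regKernel η (X - ofCoord (x, y)) - regKernel η (X' - ofCoord (x, y)))).ofLp i
      = (Ioi (-h)).indicator (fun y => if i = 0 then (0 : ℝ)
        else 2 * (X 1 - y) / ((X 1 - y) ^ 2 + η ^ 2)
          - 2 * (X' 1 - y) / ((X' 1 - y) ^ 2 + η ^ 2)) y := by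
    intro y
    by_cases hy : -h < y
    · rw [indicator_of_mem (by exact hy), ← integral_slice_regKernel_sub hη X X' y i]
      simp [frontTheta, hy]
    · rw [indicator_of_notMem (by exact hy)]
      simp [frontTheta, hy]
  have hout := hIp.integral_prod_right
  simp_rw [e] at hout ⊢
  rw [integral_indicator measurableSet_Ioi]
  rw [integrable_indicator_iff measurableSet_Ioi] at hout
  fin_cases i
  · simp
  · simp only [Fin.mk_one, Fin.isValue, one_ne_zero, ↓reduceIte] at hout ⊢
    have hd : ∀ (a y : ℝ), HasDerivAt (fun y => Real.log ((a - y) ^ 2 + η ^ 2))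
        (-(2 * (a - y) / ((a - y) ^ 2 + η ^ 2))) y := by
      intro a y
      have h1 : HasDerivAt (fun y : ℝ => (a - y) ^ 2 + η ^ 2) (-(2 * (a - y))) y := by
        have := ((hasDerivAt_id y).const_sub a).pow 2
        simpa using this.add_const (η ^ 2)
      convert h1.log (by positivity) using 1
      ring
    have key := integral_Ioi_of_hasDerivAt_of_tendsto (a := -h)
      (f := fun y => Real.log ((X' 1 - y) ^ 2 + η ^ 2) - Real.log ((X 1 - y) ^ 2 + η ^ 2))
      (((hd _ _).sub (hd _ _)).continuousAt.continuousWithinAt)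
      (fun y _ => (hd (X' 1) y).sub (hd (X 1) y)) (m := 0)
      (hout.congr_fun (fun y _ => by ring) measurableSet_Ioi)
      (tendsto_log_sub_log_atTop _ _ _ hη.ne')
    rw [show (∫ y in Ioi (-h), (2 * (X 1 - y) / ((X 1 - y) ^ 2 + η ^ 2)
          - 2 * (X' 1 - y) / ((X' 1 - y) ^ 2 + η ^ 2))) = _ from
      (setIntegral_congr_fun measurableSet_Ioi (fun y _ => by ring)).trans key]
    simp

lemma tendsto_truncKernel (r : ℝ) (hr : 0 < r) (z : Plane) :
    Tendsto (fun η => truncKernel η r z) (𝓝[>] 0) (𝓝 (truncKernel 0 r z)) := by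
  unfold truncKernel
  split_ifs with h
  · have hz : 0 < ‖z‖ := hr.trans_le h
    have hc : ContinuousAt (fun η => regKernel η z) 0 := by
      have h0 : ContinuousAt (fun η : ℝ => (Real.sqrt (‖z‖ ^ 2 + η ^ 2) ^ 3)⁻¹) 0 := by
        refine ContinuousAt.inv₀ (by fun_prop) ?_
        have : 0 < Real.sqrt (‖z‖ ^ 2 + 0 ^ 2) := Real.sqrt_pos.2 (by positivity)
        positivity
      exact (continuousAt_const.mul h0).smul continuousAt_const
    exact hc.tendsto.mono_left nhdsWithin_le_nhds
  · exact tendsto_const_nhds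

lemma frontTheta_const_on_ball (h : ℝ) (X : Plane) :
    ∀ x' ∈ Metric.ball X |X 1 + h|, frontTheta (fun _ => -h) x' = frontTheta (fun _ => -h) X := by
  intro x' hx'
  have h1 := (abs_coord_le_norm (x' - X) 1).trans_lt (mem_ball_iff_norm.1 hx')
  simp only [PiLp.sub_apply] at h1
  have : -h < x' 1 ↔ -h < X 1 := by
    obtain ⟨h2, h3⟩ := abs_lt.1 h1
    rcases abs_cases (X 1 + h) with ⟨h4, h5⟩ | ⟨h4, h5⟩ <;> constructor <;> intro h6 <;> linarith
  simp [frontTheta, this]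

lemma rieszNormalized_planar_sub (h : ℝ) {X X' : Plane} (hX : X 1 + h ≠ 0) (hX' : X' 1 + h ≠ 0) :
    rieszNormalized (frontTheta fun _ => -h) |X 1 + h| X
      - rieszNormalized (frontTheta fun _ => -h) |X' 1 + h| X'
      = !₂[0, 2 * Real.log |X 1 + h| - 2 * Real.log |X' 1 + h|] := by
  have hB := isBddDensity_frontTheta (f := fun _ => -h) measurable_const
  set r := |X 1 + h| with hr
  set r' := |X' 1 + h| with hr'
  have hr0 : 0 < r := abs_pos.2 hX
  have hr0' : 0 < r' := abs_pos.2 hX'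
  rw [rieszNormalized_sub hB hr0 hr0']
  have e : ∀ η > 0, ∫ x', frontTheta (fun _ => -h) x'
      • (truncKernel η r (X - x') - truncKernel η r' (X' - x'))
      = !₂[0, Real.log ((X 1 + h) ^ 2 + η ^ 2) - Real.log ((X' 1 + h) ^ 2 + η ^ 2)] := by
    intro η hη
    rw [← integral_planar_regKernel_sub hη]
    have i1 := hB.integrable_smul (integrable_regKernel_sub_trunc hη r X)
    have i2 := hB.integrable_smul (integrable_regKernel_sub_trunc hη r' X')
    have i3 := hB.integrable_smul (integrable_regKernel_sub hη X X')
    have z1 := integral_regKernel_sub_trunc (η := η) (frontTheta_const_on_ball h X)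
    have z2 := integral_regKernel_sub_trunc (η := η) (frontTheta_const_on_ball h X')
    rw [← sub_eq_zero, ← integral_sub
      (hB.integrable_smul (integrable_truncKernel_sub_left η hr0 hr0' X X')) i3]
    have e1 : ∀ x', frontTheta (fun _ => -h) x'
        • (truncKernel η r (X - x') - truncKernel η r' (X' - x'))
        - frontTheta (fun _ => -h) x' • (regKernel η (X - x') - regKernel η (X' - x'))
        = frontTheta (fun _ => -h) x' • (regKernel η (X' - x') - truncKernel η r' (X' - x'))
          - frontTheta (fun _ => -h) x' • (regKernel η (X - x') - truncKernel η r (X - x')) := by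
      intro x'; module
    simp_rw [e1]
    rw [integral_sub i2 i1, z1, z2, sub_zero]
  -- The dominating profile below does not depend on `η`, because the kernel estimates are uniform
  -- in the height.
  set ρ := min r r'
  have hρ : 0 < ρ := lt_min hr0 hr0'
  set A := max 1 (max (max r r') ‖X - X'‖ / ρ)
  have hA : max (max r r') ‖X - X'‖ ≤ A * ρ := by
    rw [← div_le_iff₀ hρ]; exact le_max_right _ _
  have hlim : Tendsto (fun η => ∫ x', frontTheta (fun _ => -h) x'
      • (truncKernel η r (X - x') - truncKernel η r' (X' - x'))) (𝓝[>] 0)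
      (𝓝 (∫ x', frontTheta (fun _ => -h) x'
        • (truncKernel 0 r (X - x') - truncKernel 0 r' (X' - x')))) := by
    refine tendsto_integral_filter_of_dominated_convergence
      (fun x' => 2 * Real.pi * (kernelConst A * decayProfile ρ (X - x')))
      (Eventually.of_forall fun η =>
        (hB.integrable_smul (integrable_truncKernel_sub_left η hr0 hr0' X X')).aestronglyMeasurable)
      (Eventually.of_forall fun η => ae_of_all _ fun x' => ?_)
      ((((integrable_decayProfile hρ).const_mul _).const_mul _).comp_sub_left X)
      (ae_of_all _ fun x' => ((tendsto_truncKernel r hr0 _).sub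
        (tendsto_truncKernel r' hr0' _)).const_smul _)
    rw [norm_smul]
    refine mul_le_mul (hB.bound _) ?_ (norm_nonneg _) hB.nonneg
    have := norm_truncKernel_sub_le η (le_max_left _ _ : 1 ≤ A) hρ (min_le_left _ _)
      (min_le_right _ _) (((le_max_left _ _).trans (le_max_left _ _)).trans hA)
      (((le_max_right _ _).trans (le_max_left _ _)).trans hA)
      ((le_max_right _ _).trans hA) (X - x')
    rwa [show X - x' - (X - X') = X' - x' by abel] at this
  have hlog : ∀ a : ℝ, a ≠ 0 → Tendsto (fun η : ℝ => Real.log (a ^ 2 + η ^ 2)) (𝓝[>] 0)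
      (𝓝 (2 * Real.log |a|)) := by
    intro a ha
    have hc : ContinuousAt (fun η : ℝ => Real.log (a ^ 2 + η ^ 2)) 0 :=
      ContinuousAt.log (by fun_prop) (by positivity)
    have := hc.tendsto.mono_left (nhdsWithin_le_nhds (s := Ioi 0))
    simpa [Real.log_pow, Real.log_abs] using this
  have hc : Continuous (fun t : ℝ => (!₂[0, t] : Plane)) := by
    refine (PiLp.continuous_toLp 2 _).comp (continuous_pi fun i => ?_)
    fin_cases i <;> simp <;> fun_prop
  have hlim2 := (hc.tendsto _).comp ((hlog _ hX).sub (hlog _ hX'))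
  refine tendsto_nhds_unique hlim (hlim2.congr' ?_)
  filter_upwards [self_mem_nhdsWithin] with η hη
  exact (e η hη).symm

/-- The Riesz transform of a planar front. -/
theorem rieszNormalized_planar (h : ℝ) : ∃ b : Plane, ∀ (X : Plane) (ε : ℝ), 0 < ε →
    ε ≤ |X 1 + h| →
      rieszNormalized (frontTheta fun _ => -h) ε X = !₂[0, 2 * Real.log |X 1 + h|] + b := by
  -- The reference point is at height one above the line, where the logarithm vanishes.
  refine ⟨rieszNormalized (frontTheta fun _ => -h) |1 - h + h| !₂[0, 1 - h], fun X ε hε hX => ?_⟩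
  have hB := isBddDensity_frontTheta (f := fun _ => -h) measurable_const
  rw [rieszNormalized_eq_of_const hB hε hX (frontTheta_const_on_ball h X)]
  have h1 := rieszNormalized_planar_sub h (X := X) (X' := !₂[0, 1 - h])
    (abs_pos.1 (hε.trans_le hX)) (by simp)
  rw [sub_eq_iff_eq_add] at h1
  simpa using h1

/-! ### Functions supported in a neighbourhood of a graph -/

/-- Fubini over vertical slices: each slice is supported in an interval of length `2 ℓ s`. Letting
`ℓ` vary admits bounds `k` that are not integrable alone, such as `|s|⁻²` at the cusp of a front. -/
lemma integrable_of_support_slab {E : Type*} [NormedAddCommGroup E] [NormedSpace ℝ E]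
    {F : ℝ × ℝ → E} (hF : AEStronglyMeasurable F) {k m ℓ : ℝ → ℝ}
    (hb : ∀ᵐ s, ∀ w, ‖F (s, w)‖ ≤ k s) (hs : ∀ s w, ℓ s < |w - m s| → F (s, w) = 0)
    (hℓ : ∀ s, 0 ≤ ℓ s) (hk : Integrable (fun s => k s * ℓ s)) :
    Integrable F ∧ ‖∫ p, F p‖ ≤ 2 * ∫ s, k s * ℓ s := by
  rw [Measure.volume_eq_prod] at hF
  have hF' := (integrable_prod_iff hF (E := E))
  have hdom : ∀ s, (∀ w, ‖F (s, w)‖ ≤ k s) → ∀ w, ‖F (s, w)‖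
      ≤ (Icc (m s - ℓ s) (m s + ℓ s)).indicator (fun _ => k s) w := by
    intro s h w
    by_cases hw : w ∈ Icc (m s - ℓ s) (m s + ℓ s)
    · rw [indicator_of_mem hw]; exact h w
    · rw [indicator_of_notMem hw, hs s w, norm_zero]
      by_contra! h'
      rw [abs_le] at h'
      exact hw ⟨by linarith, by linarith⟩
  have hind : ∀ s, Integrable ((Icc (m s - ℓ s) (m s + ℓ s)).indicator (fun _ : ℝ => k s)) :=
    fun s => (integrable_indicator_iff measurableSet_Icc).2 (integrableOn_const (by simp))
  have hval : ∀ s, ∫ w, (Icc (m s - ℓ s) (m s + ℓ s)).indicator (fun _ : ℝ => k s) w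
      = 2 * (k s * ℓ s) := by
    intro s
    rw [integral_indicator measurableSet_Icc]
    simp only [integral_const, MeasurableSet.univ, measureReal_restrict_apply, univ_inter,
      Real.volume_real_Icc, smul_eq_mul]
    rw [max_eq_left (by linarith [hℓ s])]
    ring
  have h1 : ∀ᵐ s, Integrable (fun w => F (s, w)) := by
    filter_upwards [hb, hF.prodMk_left] with s h1 h2
    exact (hind s).mono' h2 (ae_of_all _ (hdom s h1))
  have hle : ∀ᵐ s, ∫ w, ‖F (s, w)‖ ≤ 2 * (k s * ℓ s) := by
    filter_upwards [hb, h1] with s h1 h2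
    rw [← hval s]
    exact integral_mono h2.norm (hind s) (hdom s h1)
  have h2 : Integrable (fun s => ∫ w, ‖F (s, w)‖) := by
    refine (hk.const_mul 2).mono' hF.norm.integral_prod_right' ?_
    filter_upwards [hle] with s h
    rwa [Real.norm_of_nonneg (integral_nonneg fun _ => norm_nonneg _)]
  have hint : Integrable F (volume.prod volume) := hF'.2 ⟨h1, h2⟩
  refine ⟨hint, ?_⟩
  rw [Measure.volume_eq_prod, integral_prod _ hint, ← integral_const_mul]
  refine norm_integral_le_of_norm_le (hk.const_mul 2) ?_
  filter_upwards [hle] with s h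
  exact (norm_integral_le_integral_norm _).trans h

lemma integrable_of_support_strip {F : Plane → Plane} (hF : AEStronglyMeasurable F) {k : ℝ → ℝ}
    {a b : ℝ} (hb : ∀ X, ‖F X‖ ≤ k (X 0)) (hs : ∀ X, F X ≠ 0 → X 1 ∈ Icc a b) (hk : Integrable k)
    (hab : a ≤ b) :
    Integrable F ∧ ‖∫ X, F X‖ ≤ (b - a) * ∫ s, k s := by
  have hF' : AEStronglyMeasurable (fun p => F (ofCoord p)) := by
    have h := measurePreserving_ofCoord
    rw [← h.map_eq] at hF
    exact hF.comp_measurable h.measurable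
  have h := integrable_of_support_slab (k := k) (m := fun _ => (a + b) / 2)
    (ℓ := fun _ => (b - a) / 2) hF' (ae_of_all _ fun s w => by simpa using hb (ofCoord (s, w)))
    (fun s w hw => by
      by_contra hne
      obtain ⟨h1, h2⟩ := hs _ hne
      simp only [ofCoord_one] at h1 h2
      rcases lt_abs.1 hw with h | h <;> linarith)
    (fun _ => by linarith) (hk.mul_const _)
  refine ⟨integrable_plane h.1, ?_⟩
  rw [integral_plane hF]
  refine h.2.trans_eq ?_
  rw [integral_mul_const]; ring

/-! ### The difference between a front and a planar front -/

section Strip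

variable {f : ℝ → ℝ} {h M : ℝ}

lemma thetaStar_eq (hh : ∀ x, -h < f x) (X : Plane) :
    thetaStar h f X = if -h < X 1 ∧ X 1 ≤ f (X 0) then -(2 * Real.pi) else 0 := by
  unfold thetaStar frontTheta
  have := hh (X 0)
  by_cases h1 : f (X 0) < X 1
  · have h2 : -h < X 1 := this.trans h1
    simp [h1, h2]
  · by_cases h2 : -h < X 1 <;> simp [h1, h2, not_lt.1 h1]

lemma isBddDensity_thetaStar (hf : Measurable f) (hh : ∀ x, -h < f x) :
    IsBddDensity (2 * Real.pi) (thetaStar h f) := by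
  refine ⟨(measurable_frontTheta hf).sub (measurable_frontTheta measurable_const), fun X => ?_⟩
  rw [thetaStar_eq hh]
  split_ifs
  · rw [abs_neg, abs_of_pos Real.two_pi_pos]
  · simpa using Real.pi_pos.le

lemma mem_strip_of_thetaStar_ne (hh : ∀ x, -h < f x) (hM : ∀ x, f x ≤ M) {X : Plane}
    (hX : thetaStar h f X ≠ 0) : X 1 ∈ Icc (-h) M := by
  rw [thetaStar_eq hh] at hX
  have : -h < X 1 ∧ X 1 ≤ f (X 0) := by
    by_contra hc; simp [hc] at hX
  exact ⟨this.1.le, this.2.trans (hM _)⟩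

lemma norm_regKernel_le_coord (η : ℝ) (hη : η ≠ 0) (z : Plane) :
    ‖regKernel η z‖ ≤ (z 0 ^ 2 + η ^ 2)⁻¹ := by
  have h0 : 0 < Real.sqrt (‖z‖ ^ 2 + η ^ 2) := sqrt_sq_add_pos _ hη
  have h4 : Real.sqrt (‖z‖ ^ 2 + η ^ 2) ^ 2 = ‖z‖ ^ 2 + η ^ 2 := Real.sq_sqrt (by positivity)
  rw [regKernel, norm_smul, Real.norm_of_nonneg (by positivity)]
  calc (2 * Real.pi)⁻¹ * (Real.sqrt (‖z‖ ^ 2 + η ^ 2) ^ 3)⁻¹ * ‖z‖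
      ≤ 1 * (Real.sqrt (‖z‖ ^ 2 + η ^ 2) ^ 3)⁻¹ * Real.sqrt (‖z‖ ^ 2 + η ^ 2) := by
        gcongr
        · exact inv_two_pi_le_one
        · exact norm_le_sqrt_sq_add_sq z η
    _ = (Real.sqrt (‖z‖ ^ 2 + η ^ 2) ^ 2)⁻¹ := by field_simp
    _ ≤ _ := by
        rw [h4, plane_norm_sq]
        refine inv_anti₀ (by positivity) (by linarith [sq_nonneg (z 1)])

/-- A bound through the abscissa alone, integrable on the line: for densities supported in a
horizontal strip this is all the decay that is needed. -/
lemma norm_truncKernel_le_coord {ε : ℝ} (hε : 0 < ε) (z : Plane) :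
    ‖truncKernel 0 ε z‖ ≤ 2 * (z 0 ^ 2 + ε ^ 2)⁻¹ := by
  unfold truncKernel
  split_ifs with hz
  · refine (norm_regKernel_le 0 z).trans ?_
    have h1 : ε ^ 2 ≤ ‖z‖ ^ 2 := by gcongr
    have h2 := plane_norm_sq z
    have h3 : 0 < ε ^ 2 := by positivity
    rw [← div_eq_mul_inv, inv_eq_one_div, div_le_div_iff₀ (by linarith) (by positivity)]
    nlinarith [sq_nonneg (z 1)]
  · simp; positivity

lemma integrable_thetaStar_smul (hf : Measurable f) (hh : ∀ x, -h < f x) (hM : ∀ x, f x ≤ M)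
    {K : Plane → Plane} (hK : Measurable K) {k : ℝ → ℝ} (hk : Integrable k)
    (hKk : ∀ z, ‖K z‖ ≤ k (z 0)) (X : Plane) :
    Integrable (fun x' => thetaStar h f x' • K (X - x')) := by
  have hB := isBddDensity_thetaStar hf hh
  refine (integrable_of_support_strip (k := fun s => 2 * Real.pi * k (X 0 - s)) (a := -h) (b := M)
    (F := fun x' => thetaStar h f x' • K (X - x')) (hB.measurable.smul (hK.comp (measurable_const.sub measurable_id))).aestronglyMeasurable
    (fun x' => ?_) (fun x' hx' => ?_) ((hk.comp_sub_left (X 0)).const_mul _)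
    ((hh 0).le.trans (hM 0))).1
  · rw [norm_smul]
    exact mul_le_mul (hB.bound _) (hKk (X - x')) (norm_nonneg _) hB.nonneg
  · exact mem_strip_of_thetaStar_ne hh hM (left_ne_zero_of_smul hx')

lemma integrable_thetaStar_truncKernel (hf : Measurable f) (hh : ∀ x, -h < f x)
    (hM : ∀ x, f x ≤ M) {ε : ℝ} (hε : 0 < ε) (X : Plane) :
    Integrable (fun x' => thetaStar h f x' • truncKernel 0 ε (X - x')) :=
  integrable_thetaStar_smul hf hh hM (measurable_truncKernel 0 ε)
    ((integrable_inv_sq_add_sq hε.ne').const_mul 2) (norm_truncKernel_le_coord hε) X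

/-- In a strip each truncated kernel is integrable by itself, so the normalization at infinity only
subtracts a constant. -/
lemma rieszNormalized_thetaStar (hf : Measurable f) (hh : ∀ x, -h < f x) (hM : ∀ x, f x ≤ M)
    {ε : ℝ} (hε : 0 < ε) (X : Plane) :
    rieszNormalized (thetaStar h f) ε X
      = rieszTrunc (thetaStar h f) ε X - rieszTrunc (thetaStar h f) 1 0 := by
  rw [rieszTrunc_eq, rieszTrunc_eq, rieszNormalized,
    ← integral_sub (integrable_thetaStar_truncKernel hf hh hM hε X)
      (integrable_thetaStar_truncKernel hf hh hM one_pos 0)]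
  simp_rw [smul_sub]

lemma rieszNormalized_frontTheta (hf : Measurable f) (hh : ∀ x, -h < f x)
    {ε : ℝ} (hε : 0 < ε) (X : Plane) :
    rieszNormalized (frontTheta f) ε X
      = rieszNormalized (frontTheta fun _ => -h) ε X + rieszNormalized (thetaStar h f) ε X := by
  have hi := integrable_truncKernel_sub_left 0 hε one_pos X 0
  unfold rieszNormalized
  rw [← integral_add ((isBddDensity_frontTheta (f := fun _ => -h) measurable_const).integrable_smul
    hi) ((isBddDensity_thetaStar hf hh).integrable_smul hi)]
  congr 1; ext1 x'
  rw [← add_smul, thetaStar]; congr 1; ring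

lemma perp_add (z w : Plane) : perp (z + w) = perp z + perp w := by
  ext i; fin_cases i <;> simp [perp]; ring

lemma perp_neg (z : Plane) : perp (-z) = -perp z := by
  ext i; fin_cases i <;> simp [perp]

lemma perp_sub (z w : Plane) : perp (z - w) = perp z - perp w := by
  rw [sub_eq_add_neg, perp_add, perp_neg, sub_eq_add_neg]

/-- Up to a constant, the two descriptions of the truncated velocity agree. -/
theorem splitVelocityTrunc_eq (hf : Measurable f) (hh : ∀ x, -h < f x) (hM : ∀ x, f x ≤ M) :
    ∃ e : Plane, ∀ (X : Plane) (ε : ℝ), 0 < ε → ε ≤ |X 1 + h| →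
      splitVelocityTrunc h f ε X = -perp (rieszNormalized (frontTheta f) ε X + e) := by
  obtain ⟨b, hb⟩ := rieszNormalized_planar h
  refine ⟨rieszTrunc (thetaStar h f) 1 0 - b, fun X ε hε hX => ?_⟩
  rw [rieszNormalized_frontTheta hf hh hε, hb X ε hε hX, rieszNormalized_thetaStar hf hh hM hε]
  rw [show !₂[0, 2 * Real.log |X 1 + h|] + b + (rieszTrunc (thetaStar h f) ε X
      - rieszTrunc (thetaStar h f) 1 0) + (rieszTrunc (thetaStar h f) 1 0 - b)
      = !₂[0, 2 * Real.log |X 1 + h|] + rieszTrunc (thetaStar h f) ε X by abel, perp_add]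
  have : perp !₂[0, 2 * Real.log |X 1 + h|] = -planarVelocity h X := by
    ext i; fin_cases i <;> simp [perp, planarVelocity]
  rw [this, splitVelocityTrunc]
  abel

lemma integral_univ_inv_sq_add_sq {Y : ℝ} (hY : 0 < Y) :
    ∫ s : ℝ, (s ^ 2 + Y ^ 2)⁻¹ = Real.pi / Y := by
  have h := Measure.integral_comp_div (fun s : ℝ => (1 + s ^ 2)⁻¹) Y
  rw [integral_univ_inv_one_add_sq, abs_of_pos hY, smul_eq_mul] at h
  have e : ∀ s : ℝ, (s ^ 2 + Y ^ 2)⁻¹ = (Y ^ 2)⁻¹ * (1 + (s / Y) ^ 2)⁻¹ := by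
    intro s
    rw [← mul_inv]; congr 1; field_simp; ring
  simp_rw [e]
  rw [integral_const_mul, h]
  field_simp

/-- At vertical distance `Y` from the strip the kernel is at most `(s² + Y²)⁻¹`, of integral `π / Y`
along each horizontal line. The bound is uniform in the abscissa and in the truncation, hence gives
the far field. -/
lemma norm_rieszTrunc_thetaStar_le (hf : Measurable f) (hh : ∀ x, -h < f x) (hM : ∀ x, f x ≤ M)
    {Y ε : ℝ} (hY : 0 < Y) {X : Plane} (hX : ∀ y ∈ Icc (-h) M, Y ≤ |X 1 - y|) :
    ‖rieszTrunc (thetaStar h f) ε X‖ ≤ (M + h) * (2 * Real.pi * (Real.pi / Y)) := by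
  have hB := isBddDensity_thetaStar hf hh
  have hk := ((integrable_inv_sq_add_sq hY.ne').comp_sub_left (X 0)).const_mul (2 * Real.pi)
  rw [rieszTrunc_eq]
  refine (integrable_of_support_strip (a := -h) (b := M) (F := fun x' => thetaStar h f x' •
    truncKernel 0 ε (X - x')) ?_ (fun x' => ?_) (fun x' hx' => ?_) hk
    ((hh 0).le.trans (hM 0))).2.trans_eq ?_
  · exact (hB.measurable.smul ((measurable_truncKernel 0 ε).comp
      (measurable_const.sub measurable_id))).aestronglyMeasurable
  · by_cases h0 : thetaStar h f x' = 0
    · rw [h0, zero_smul, norm_zero]; positivity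
    · have h1 := hX _ (mem_strip_of_thetaStar_ne hh hM h0)
      rw [norm_smul]
      refine mul_le_mul (hB.bound _) ?_ (norm_nonneg _) hB.nonneg
      have h2 : ‖truncKernel 0 ε (X - x')‖ ≤ (‖X - x'‖ ^ 2)⁻¹ := by
        unfold truncKernel
        split_ifs
        · exact norm_regKernel_le 0 _
        · simp
      refine h2.trans (inv_anti₀ (by positivity) ?_)
      rw [plane_norm_sq]
      simp only [PiLp.sub_apply]
      have : Y ^ 2 ≤ (X 1 - x' 1) ^ 2 := by
        rw [← sq_abs (X 1 - x' 1)]; gcongr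
      linarith
  · exact mem_strip_of_thetaStar_ne hh hM (left_ne_zero_of_smul hx')
  · rw [integral_const_mul, integral_sub_left_eq_self (fun s : ℝ => (s ^ 2 + Y ^ 2)⁻¹) volume (X 0),
      integral_univ_inv_sq_add_sq hY]
    ring

/-! ### The velocity field of a front -/

/-- The height above the graph is `(1 + Λ)`-Lipschitz, so it cannot change sign within this radius.
-/
lemma frontTheta_eq_of_mem_ball {Λ : ℝ} (hΛ : 0 ≤ Λ) (hL : ∀ a b, |f a - f b| ≤ Λ * |a - b|)
    {X x' : Plane} (hx : x' ∈ Metric.ball X (graphGap f X / (1 + Λ))) :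
    frontTheta f x' = frontTheta f X := by
  have h1 := mem_ball_iff_norm.1 hx
  rw [lt_div_iff₀ (by positivity)] at h1
  have h2 := abs_coord_le_norm (x' - X) 1
  have h3 := (hL (x' 0) (X 0)).trans
    (mul_le_mul_of_nonneg_left (abs_coord_le_norm (x' - X) 0) hΛ)
  simp only [PiLp.sub_apply] at h2
  have : f (x' 0) < x' 1 ↔ f (X 0) < X 1 := by
    unfold graphGap at h1
    obtain ⟨h4, h5⟩ := abs_le.1 h2
    obtain ⟨h6, h7⟩ := abs_le.1 h3
    rcases abs_cases (X 1 - f (X 0)) with ⟨h8, h9⟩ | ⟨h8, h9⟩ <;> constructor <;> intro h10 <;>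
      nlinarith
  simp [frontTheta, this]

/-- The value of the Riesz transform off the front. -/
noncomputable def frontRiesz (Λ : ℝ) (f : ℝ → ℝ) (X : Plane) : Plane :=
  rieszNormalized (frontTheta f) (graphGap f X / (1 + Λ)) X

lemma rieszNormalized_eq_frontRiesz {Λ : ℝ} (hf : Measurable f) (hΛ : 0 ≤ Λ)
    (hL : ∀ a b, |f a - f b| ≤ Λ * |a - b|) {X : Plane} {ε : ℝ} (hε : 0 < ε)
    (hX : ε ≤ graphGap f X / (1 + Λ)) :
    rieszNormalized (frontTheta f) ε X = frontRiesz Λ f X :=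
  rieszNormalized_eq_of_const (isBddDensity_frontTheta hf) hε hX
    fun _ hx' => frontTheta_eq_of_mem_ball hΛ hL hx'

lemma eventually_rieszNormalized_eq {Λ : ℝ} (hf : Measurable f) (hΛ : 0 ≤ Λ)
    (hL : ∀ a b, |f a - f b| ≤ Λ * |a - b|) {X : Plane} (hX : X 1 ≠ f (X 0)) :
    ∀ᶠ ε in 𝓝[>] (0 : ℝ), rieszNormalized (frontTheta f) ε X = frontRiesz Λ f X := by
  have hg : 0 < graphGap f X / (1 + Λ) := div_pos (graphGap_pos_iff.2 hX) (by positivity)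
  filter_upwards [Ioc_mem_nhdsGT hg] with ε hε
  exact rieszNormalized_eq_frontRiesz hf hΛ hL hε.1 hε.2

lemma measurable_rieszNormalized {C : ℝ} {θ : Plane → ℝ} (hθ : IsBddDensity C θ) (ε : ℝ) :
    StronglyMeasurable (rieszNormalized θ ε) := by
  unfold rieszNormalized
  have h1 : Measurable (fun p : Plane × Plane => truncKernel 0 ε (p.1 - p.2)) :=
    (measurable_truncKernel 0 ε).comp (measurable_fst.sub measurable_snd)
  have h2 : Measurable (fun p : Plane × Plane => truncKernel 0 1 (0 - p.2)) :=
    (measurable_truncKernel 0 1).comp (measurable_const.sub measurable_snd)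
  have h3 : Measurable (fun p : Plane × Plane => θ p.2 •
      (truncKernel 0 ε (p.1 - p.2) - truncKernel 0 1 (0 - p.2))) :=
    (hθ.measurable.comp measurable_snd).smul (h1.sub h2)
  exact h3.stronglyMeasurable.integral_prod_right

/-- At points with gap at least `(1 + Λ) * r` the value is the transform truncated at this same `r`,
so the scale-invariant estimate feeds the criterion of `memBMO_of_gap`, also across the front.
Measurability is inherited from the truncated transforms, which converge off the graph. -/
lemma memBMO_frontRiesz {Λ : ℝ} (hf : Measurable f) (hΛ : 0 ≤ Λ)
    (hL : ∀ a b, |f a - f b| ≤ Λ * |a - b|) (e : Plane) :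
    MemBMO (fun X => frontRiesz Λ f X + e) := by
  have hB := isBddDensity_frontTheta hf
  refine memBMO_of_gap ?_ hL hf hΛ fun A hA => ⟨2 * Real.pi * (kernelConst A *
    ∫ z, decayProfile 1 z), ?_, fun r hr X X' hX hX' hXX' => ?_⟩
  · refine aestronglyMeasurable_of_tendsto_ae (𝓝[>] (0 : ℝ))
      (f := fun ε X => rieszNormalized (frontTheta f) ε X + e)
      (fun ε => ((measurable_rieszNormalized hB ε).add
        stronglyMeasurable_const).aestronglyMeasurable) ?_
    filter_upwards [ae_off_graph hf] with X hX
    refine tendsto_const_nhds.congr' ?_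
    filter_upwards [eventually_rieszNormalized_eq hf hΛ hL hX] with ε hε
    rw [hε]
  · have := kernelConst_pos hA
    have h2 : 0 ≤ ∫ z, decayProfile 1 z := integral_nonneg fun z => by
      unfold decayProfile; positivity
    positivity
  · rw [add_sub_add_right_eq_sub,
      ← rieszNormalized_eq_frontRiesz hf hΛ hL hr (by rw [le_div_iff₀ (by positivity)]; linarith),
      ← rieszNormalized_eq_frontRiesz hf hΛ hL hr (by rw [le_div_iff₀ (by positivity)]; linarith)]
    exact norm_rieszNormalized_sub_le hB hA hr hXX'

lemma eventually_rieszTruncBdd_eq (hf : Measurable f) {c x₀ X : Plane} {r : ℝ}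
    (hx₀ : x₀ ∈ Metric.ball c r) (hX : X ∈ Metric.ball c r) :
    ∀ᶠ ε in 𝓝[>] (0 : ℝ), rieszTruncBdd (frontTheta f) c r x₀ ε X
      = rieszNormalized (frontTheta f) ε X + rieszShift (frontTheta f) c r x₀ := by
  filter_upwards [Ioc_mem_nhdsGT (sub_pos.2 (Metric.mem_ball.1 hX))] with ε hε
  exact rieszTruncBdd_eq (isBddDensity_frontTheta hf) hx₀ hε.1 hε.2

lemma isRieszTransform_frontRiesz {Λ : ℝ} (hf : Measurable f) (hΛ : 0 ≤ Λ)
    (hL : ∀ a b, |f a - f b| ≤ Λ * |a - b|) (e : Plane) :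
    IsRieszTransform (frontTheta f) (fun X => frontRiesz Λ f X + e) := by
  refine ⟨memBMO_frontRiesz hf hΛ hL e, fun c r x₀ hx₀ =>
    ⟨e - rieszShift (frontTheta f) c r x₀, ?_⟩⟩
  filter_upwards [ae_off_graph hf] with X hX hXb
  refine tendsto_const_nhds.congr' ?_
  filter_upwards [eventually_rieszTruncBdd_eq hf hx₀ hXb,
    eventually_rieszNormalized_eq hf hΛ hL hX] with ε h1 h2
  rw [h1, h2]; abel

/-- Off the front and the line `y = -h`, the split velocity is eventually constant. -/
lemma exists_split_const {Λ : ℝ} (hf : Measurable f) (hΛ : 0 ≤ Λ)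
    (hL : ∀ a b, |f a - f b| ≤ Λ * |a - b|) (hh : ∀ x, -h < f x) (hM : ∀ x, f x ≤ M) :
    ∃ e : Plane, (∀ X : Plane, X 1 ≠ -h → ∀ᶠ ε in 𝓝[>] (0 : ℝ),
        splitVelocityTrunc h f ε X = -perp (rieszNormalized (frontTheta f) ε X + e)) ∧
      ∀ X : Plane, X 1 ≠ -h → X 1 ≠ f (X 0) → ∀ᶠ ε in 𝓝[>] (0 : ℝ),
        splitVelocityTrunc h f ε X = -perp (frontRiesz Λ f X + e) := by
  obtain ⟨e, he⟩ := splitVelocityTrunc_eq hf hh hM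
  have h1 : ∀ X : Plane, X 1 ≠ -h → ∀ᶠ ε in 𝓝[>] (0 : ℝ),
      splitVelocityTrunc h f ε X = -perp (rieszNormalized (frontTheta f) ε X + e) := by
    intro X hX
    have hX' : 0 < |X 1 + h| := abs_pos.2 fun h' => hX (by linarith)
    filter_upwards [Ioc_mem_nhdsGT hX'] with ε hε
    exact he X ε hε.1 hε.2
  refine ⟨e, h1, fun X hX hX' => ?_⟩
  filter_upwards [h1 X hX, eventually_rieszNormalized_eq hf hΛ hL hX'] with ε h2 h3
  rw [h2, h3]

lemma tendsto_log_abs_add_sub (h : ℝ) :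
    Tendsto (fun p : Plane => 2 * Real.log |p 1 + h| - 2 * Real.log |p 1|)
      (comap (fun p : Plane => |p 1|) atTop) (𝓝 0) := by
  have h1 : Tendsto (fun p : Plane => |p 1|) (comap (fun p : Plane => |p 1|) atTop) atTop :=
    tendsto_comap
  have h2 : Tendsto (fun p : Plane => h / p 1) (comap (fun p : Plane => |p 1|) atTop) (𝓝 0) := by
    rw [tendsto_zero_iff_abs_tendsto_zero]
    have := (tendsto_const_nhds (x := |h|)).div_atTop h1
    exact this.congr fun p => by simp [abs_div]
  have h3 : Tendsto (fun p : Plane => 2 * Real.log |1 + h / p 1|)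
      (comap (fun p : Plane => |p 1|) atTop) (𝓝 0) := by
    have := (((h2.const_add 1).abs).log (by simp)).const_mul 2
    simpa using this
  refine h3.congr' ?_
  filter_upwards [h1.eventually_gt_atTop |h|] with p hp
  have hp0 : p 1 ≠ 0 := abs_pos.1 ((abs_nonneg h).trans_lt hp)
  have hph : p 1 + h ≠ 0 := by
    intro h0
    have : p 1 = -h := by linarith
    rw [this, abs_neg] at hp
    exact lt_irrefl _ hp
  rw [← mul_sub, ← Real.log_div (abs_ne_zero.2 hph) (abs_ne_zero.2 hp0), ← abs_div]
  congr 3; field_simp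

/-- The velocity field of a front exists, and it is the limit of the split velocity. -/
theorem exists_isFrontVelocity {Λ : ℝ} (hf : Measurable f) (hΛ : 0 ≤ Λ)
    (hL : ∀ a b, |f a - f b| ≤ Λ * |a - b|) (hh : ∀ x, -h < f x) (hM : ∀ x, f x ≤ M) :
    ∃ e : Plane, IsFrontVelocity f (fun X => -perp (frontRiesz Λ f X + e)) ∧
      (∀ X : Plane, X 1 ≠ -h → ∀ᶠ ε in 𝓝[>] (0 : ℝ),
        splitVelocityTrunc h f ε X = -perp (rieszNormalized (frontTheta f) ε X + e)) ∧
      ∀ X : Plane, X 1 ≠ -h → X 1 ≠ f (X 0) → ∀ᶠ ε in 𝓝[>] (0 : ℝ),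
        splitVelocityTrunc h f ε X = -perp (frontRiesz Λ f X + e) := by
  obtain ⟨e, he, he'⟩ := exists_split_const hf hΛ hL hh hM
  refine ⟨e, ⟨⟨_, isRieszTransform_frontRiesz hf hΛ hL e, fun _ => rfl⟩, ?_⟩, he, he'⟩
  unfold HasShearFarField
  have h1 : Tendsto (fun p : Plane => |p 1|) (comap (fun p : Plane => |p 1|) atTop) atTop :=
    tendsto_comap
  set N := |h| + |M| with hN
  have hMh : 0 < M + h := by linarith [hh 0, hM 0]
  have hbd : Tendsto (fun p : Plane => (M + h) * (2 * Real.pi * (Real.pi / (|p 1| - N)))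
      + abs (2 * Real.log |p 1 + h| - 2 * Real.log |p 1|))
      (comap (fun p : Plane => |p 1|) atTop) (𝓝 0) := by
    have h2 := (((tendsto_const_nhds (x := Real.pi)).div_atTop
      (tendsto_atTop_add_const_right _ (-N) h1)).const_mul (2 * Real.pi)).const_mul (M + h)
    have h3 := h2.add (tendsto_log_abs_add_sub h).abs
    simpa [sub_eq_add_neg] using h3
  refine squeeze_zero_norm' ?_ hbd
  filter_upwards [h1.eventually_gt_atTop N] with X hX
  have hle : ∀ y ∈ Icc (-h) M, |y| ≤ N := fun y hy => by
    rw [hN, abs_le]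
    constructor
    · linarith [hy.1, le_abs_self h, abs_nonneg M]
    · linarith [hy.2, le_abs_self M, abs_nonneg h]
  have hne : ∀ y ∈ Icc (-h) M, X 1 ≠ y := fun y hy h' => by
    have := hle y hy
    rw [← h'] at this
    linarith
  have hhM : -h ≤ M := by linarith
  -- The split velocity already equals the velocity for some positive `ε`, and the strip bound does
  -- not depend on `ε`.
  obtain ⟨ε, hε⟩ := (he' X (hne _ ⟨le_rfl, hhM⟩) (hne _ ⟨(hh _).le, hM _⟩)).exists
  rw [← hε, splitVelocityTrunc]
  have e1 : planarVelocity h X - perp (rieszTrunc (thetaStar h f) ε X) - !₂[2 * Real.log |X 1|, 0]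
      = !₂[2 * Real.log |X 1 + h| - 2 * Real.log |X 1|, 0]
        - perp (rieszTrunc (thetaStar h f) ε X) := by
    ext i; fin_cases i <;> simp [planarVelocity]; ring
  have e2 : ∀ z : Plane, ‖perp z‖ = ‖z‖ := by
    intro z
    rw [← sq_eq_sq₀ (norm_nonneg _) (norm_nonneg _), plane_norm_sq, plane_norm_sq]
    simp [perp]; ring
  rw [e1]
  refine (norm_sub_le _ _).trans ?_
  rw [add_comm, e2]
  refine add_le_add (norm_rieszTrunc_thetaStar_le hf hh hM (by linarith) fun y hy => ?_) ?_
  · have := abs_sub_abs_le_abs_sub (X 1) y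
    linarith [hle y hy]
  · refine (plane_norm_le _).trans ?_
    simp

/-- The velocity field of a front is unique. -/
theorem IsFrontVelocity.ae_eq {u w : Plane → Plane} (hu : IsFrontVelocity f u)
    (hw : IsFrontVelocity f w) : w =ᵐ[volume] u := by
  obtain ⟨⟨g, ⟨-, hg⟩, hug⟩, hu2⟩ := hu
  obtain ⟨⟨g', ⟨-, hg'⟩, hwg⟩, hw2⟩ := hw
  -- On each ball both fields come from the same truncated integrals up to additive constants, so
  -- their difference is constant there.
  have hN : ∀ N : ℕ, ∃ k : Plane, ∀ᵐ X : Plane, X ∈ Metric.ball (0 : Plane) (N + 1) →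
      w X - u X = k := by
    intro N
    have h0 : (0 : Plane) ∈ Metric.ball (0 : Plane) ((N : ℝ) + 1) :=
      Metric.mem_ball_self (by positivity)
    obtain ⟨a, ha⟩ := hg 0 (N + 1) 0 h0
    obtain ⟨a', ha'⟩ := hg' 0 (N + 1) 0 h0
    refine ⟨perp (a - a'), ?_⟩
    filter_upwards [ha, ha'] with X h1 h2 hX
    have h3 := tendsto_nhds_unique ((h1 hX).sub (h2 hX)) (b := a - a')
      (tendsto_const_nhds.congr fun ε => by abel)
    rw [hug, hwg, ← h3, perp_sub]; abel
  choose k hk using hN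
  -- All these balls contain the unit ball, which has positive measure, so the constants agree.
  have hkk : ∀ N, k N = k 0 := by
    intro N
    have hpos : ∃ᵐ X : Plane, X ∈ Metric.ball (0 : Plane) 1 :=
      frequently_ae_mem_iff.2 (Metric.measure_ball_pos volume _ one_pos).ne'
    obtain ⟨X, hX, h1, h2⟩ := (hpos.and_eventually ((hk N).and (hk 0))).exists
    rw [← h1 (Metric.ball_subset_ball (by linarith [(Nat.cast_nonneg N : (0 : ℝ) ≤ N)]) hX),
      h2 (by simpa using hX)]
  have hae : ∀ᵐ X : Plane, w X - u X = k 0 := by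
    have := ae_all_iff.2 hk
    filter_upwards [this] with X hX
    obtain ⟨N, hN⟩ := exists_nat_gt ‖X‖
    rw [← hkk N]
    exact hX N (by rw [mem_ball_zero_iff]; linarith)
  -- The difference tends to zero far from the horizontal axis. A ball placed at large height has
  -- positive measure and so contains a point where the difference equals the constant.
  have hzero : k 0 = 0 := by
    have hlim : Tendsto (fun p => w p - u p) (comap (fun p : Plane => |p 1|) atTop) (𝓝 0) := by
      have := hw2.sub hu2
      simpa using this
    by_contra hne
    have hev := hlim.norm.eventually_lt_const (u := ‖k 0‖) (by simpa using hne)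
    rw [eventually_comap] at hev
    obtain ⟨R, hR⟩ := eventually_atTop.1 hev
    have hpos : ∃ᵐ X : Plane, X ∈ Metric.ball (!₂[0, |R| + 1] : Plane) 1 :=
      frequently_ae_mem_iff.2 (Metric.measure_ball_pos volume _ one_pos).ne'
    obtain ⟨X, hX, h1⟩ := (hpos.and_eventually hae).exists
    have h2 := (abs_coord_le_norm (X - !₂[0, |R| + 1]) 1).trans_lt (mem_ball_iff_norm.1 hX)
    simp only [PiLp.sub_apply, Matrix.cons_val_one, Matrix.cons_val_fin_one] at h2
    have h3 : R ≤ |X 1| := by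
      have := (abs_lt.1 h2).1
      linarith [le_abs_self R, le_abs_self (X 1)]
    have := hR _ h3 X rfl
    rw [h1] at this
    exact lt_irrefl _ this
  filter_upwards [hae] with X hX
  rw [hzero, sub_eq_zero] at hX
  exact hX

/-- The normal velocity is determined by the split velocity. -/
theorem isNormalVelocity_of_split {Λ : ℝ} (hf : Measurable f) (hΛ : 0 ≤ Λ)
    (hL : ∀ a b, |f a - f b| ≤ Λ * |a - b|) (hh : ∀ x, -h < f x) (hM : ∀ x, f x ≤ M)
    {u : Plane → Plane} (hu : IsFrontVelocity f u) {X n : Plane} (hX : X 1 ≠ -h) {V : ℝ}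
    (hV : Tendsto (fun ε => inner ℝ (splitVelocityTrunc h f ε X) n) (𝓝[>] 0) (𝓝 V)) :
    IsNormalVelocity (frontTheta f) u X n V := by
  obtain ⟨e, hv, he, -⟩ := exists_isFrontVelocity hf hΛ hL hh hM
  intro c r x₀ a hx₀ hXb hae
  have hu' := hv.ae_eq hu
  -- The additive constant is read off at a point of the ball off the front, where the limit is
  -- explicit, and is then used at `X`, which may lie on the front.
  have ha : a = perp (rieszShift (frontTheta f) c r x₀ - e) := by
    have hpos : ∃ᵐ X : Plane, X ∈ Metric.ball c r :=
      frequently_ae_mem_iff.2 (Metric.measure_ball_pos volume _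
        (dist_nonneg.trans_lt (Metric.mem_ball.1 hx₀))).ne'
    obtain ⟨Z, hZ, h1, h2, h3⟩ :=
      (hpos.and_eventually (hae.and (hu'.and (ae_off_graph hf)))).exists
    have h4 : Tendsto (fun ε => a - perp (rieszTruncBdd (frontTheta f) c r x₀ ε Z)) (𝓝[>] 0)
        (𝓝 (a - perp (frontRiesz Λ f Z + rieszShift (frontTheta f) c r x₀))) := by
      refine tendsto_const_nhds.congr' ?_
      filter_upwards [eventually_rieszTruncBdd_eq hf hx₀ hZ,
        eventually_rieszNormalized_eq hf hΛ hL h3] with ε h5 h6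
      rw [h5, h6]
    have h5 := tendsto_nhds_unique (h1 hZ) h4
    rw [h2, eq_sub_iff_add_eq] at h5
    rw [← h5]
    simp only [perp_add, perp_sub]
    abel
  refine hV.congr' ?_
  filter_upwards [he X hX, eventually_rieszTruncBdd_eq hf hx₀ hXb] with ε h1 h2
  rw [h1, h2, ha, ← perp_sub, ← perp_neg]
  congr 2; abel

end Strip

/-! ### Hölder continuous functions with algebraic decay -/

/-- Hölder continuity together with algebraic decay at infinity. -/
structure HolderDecay {E : Type*} [NormedAddCommGroup E] (α β C : ℝ) (g : ℝ → E) : Prop where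
  alpha_pos : 0 < α
  beta_pos : 0 < β
  beta_le : β ≤ 1
  const_nonneg : 0 ≤ C
  holder : ∀ x y, ‖g x - g y‖ ≤ C * |x - y| ^ α
  decay : ∀ x, ‖g x‖ ≤ C * (1 + |x|) ^ (-β)

/-- An integrable function that dominates all one-dimensional integrands below. -/
noncomputable def domKernel (α β s : ℝ) : ℝ :=
  (Icc (-1 : ℝ) 1).indicator (fun s => |s| ^ (α - 1)) s + (1 + |s|) ^ (-(1 + β))

lemma integrable_domKernel {α β : ℝ} (hα : 0 < α) (hβ : 0 < β) : Integrable (domKernel α β) := by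
  refine Integrable.add ((integrable_indicator_iff measurableSet_Icc).2
    (integrableOn_abs_rpow (by linarith) 1)) ?_
  exact integrable_one_add_norm (by simpa using hβ)

lemma domKernel_nonneg (α β s : ℝ) : 0 ≤ domKernel α β s :=
  add_nonneg (indicator_nonneg (fun _ _ => by positivity) _) (by positivity)

lemma rpow_le_domKernel {α : ℝ} (β : ℝ) {s : ℝ} (hs : |s| ≤ 1) :
    |s| ^ (α - 1) ≤ domKernel α β s := by
  unfold domKernel
  rw [indicator_of_mem (show s ∈ Icc (-1 : ℝ) 1 from abs_le.1 hs)]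
  have : 0 ≤ (1 + |s|) ^ (-(1 + β)) := by positivity
  linarith

lemma decay_le_domKernel (α β s : ℝ) : (1 + |s|) ^ (-(1 + β)) ≤ domKernel α β s := by
  have : 0 ≤ (Icc (-1 : ℝ) 1).indicator (fun s => |s| ^ (α - 1)) s :=
    indicator_nonneg (fun _ _ => by positivity) _
  unfold domKernel; linarith

lemma one_le_domKernel (α : ℝ) {β s : ℝ} (hβ : 0 < β) (hβ1 : β ≤ 1) (hs : |s| ≤ 1) :
    1 ≤ 4 * domKernel α β s := by
  have h := decay_le_domKernel α β s
  have h1 : (1 + |s|) ^ (1 + β) ≤ 4 := by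
    calc (1 + |s|) ^ (1 + β) ≤ 2 ^ (1 + β) := by
          gcongr; linarith
      _ ≤ 2 ^ (2 : ℝ) := Real.rpow_le_rpow_of_exponent_le (by norm_num) (by linarith)
      _ = 4 := by norm_num
  rw [Real.rpow_neg (by positivity)] at h
  have h2 : (4 : ℝ)⁻¹ ≤ ((1 + |s|) ^ (1 + β))⁻¹ := inv_anti₀ (by positivity) h1
  linarith

lemma inv_cube_le_domKernel (α : ℝ) {β s : ℝ} (hβ1 : β ≤ 1) (hs : 1 ≤ |s|) :
    (|s| ^ 3)⁻¹ ≤ 4 * domKernel α β s := by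
  have h := decay_le_domKernel α β s
  have h1 : (1 + |s|) ^ (1 + β) ≤ 4 * |s| ^ 3 := by
    calc (1 + |s|) ^ (1 + β) ≤ (1 + |s|) ^ (2 : ℝ) :=
          Real.rpow_le_rpow_of_exponent_le (by linarith) (by linarith)
      _ = (1 + |s|) ^ 2 := by norm_num
      _ ≤ (2 * |s|) ^ 2 := by gcongr; linarith
      _ = 4 * (|s| ^ 2 * 1) := by ring
      _ ≤ 4 * (|s| ^ 2 * |s|) := by gcongr
      _ = _ := by ring
  rw [Real.rpow_neg (by positivity)] at h
  have h2 : (4 * |s| ^ 3)⁻¹ ≤ ((1 + |s|) ^ (1 + β))⁻¹ := inv_anti₀ (by positivity) h1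
  rw [mul_inv] at h2
  linarith

/-- Peetre's inequality, from `1 + |s| ≤ (1 + |x|) (1 + |x - s|)`. It turns decay at `x - s` into
decay in `s`, with a factor that is locally bounded in `x`. -/
lemma peetre {β : ℝ} (hβ : 0 ≤ β) (x s : ℝ) :
    (1 + |x - s|) ^ (-β) ≤ (1 + |x|) ^ β * (1 + |s|) ^ (-β) := by
  rw [Real.rpow_neg (by positivity), Real.rpow_neg (by positivity), ← div_eq_mul_inv,
    inv_eq_one_div, div_le_div_iff₀ (by positivity) (by positivity), one_mul,
    ← Real.mul_rpow (by positivity) (by positivity)]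
  have h1 : |s| ≤ |x| + |x - s| := by
    have : s = x - (x - s) := by ring
    calc |s| = |x - (x - s)| := by rw [← this]
      _ ≤ _ := abs_sub _ _
  gcongr
  nlinarith [abs_nonneg x, abs_nonneg (x - s)]

lemma HolderDecay.continuous {E : Type*} [NormedAddCommGroup E] {α β C : ℝ} {g : ℝ → E}
    (hg : HolderDecay α β C g) : Continuous g := by
  rw [continuous_iff_continuousAt]
  intro x
  rw [ContinuousAt, tendsto_iff_norm_sub_tendsto_zero]
  refine squeeze_zero (fun _ => norm_nonneg _) (fun y => hg.holder y x) ?_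
  have h : ContinuousAt (fun y : ℝ => C * |y - x| ^ α) x := by
    refine continuousAt_const.mul (ContinuousAt.rpow_const (by fun_prop) (Or.inr hg.alpha_pos.le))
  have h2 := h.tendsto
  simpa [Real.zero_rpow hg.alpha_pos.ne'] using h2

lemma HolderDecay.bound {E : Type*} [NormedAddCommGroup E] {α β C : ℝ} {g : ℝ → E}
    (hg : HolderDecay α β C g) (x : ℝ) : ‖g x‖ ≤ C := by
  refine (hg.decay x).trans (mul_le_of_le_one_right hg.const_nonneg ?_)
  exact Real.rpow_le_one_of_one_le_of_nonpos (by linarith [abs_nonneg x])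
    (by linarith [hg.beta_pos])

lemma HolderDecay.far_le {E : Type*} [NormedAddCommGroup E] {α β C : ℝ} {g : ℝ → E}
    (hg : HolderDecay α β C g) (x : ℝ) {s : ℝ} (hs : 1 ≤ |s|) :
    ‖g (x - s)‖ / |s| ≤ 2 * C * (1 + |x|) ^ β * domKernel α β s := by
  have hC := hg.const_nonneg
  have hs0 : 0 < |s| := by linarith
  have h1 : (1 + |s|) ^ (-β) / |s| ≤ 2 * domKernel α β s := by
    have h2 : (1 + |s|) ^ (-(1 + β)) = (1 + |s|) ^ (-β) / (1 + |s|) := by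
      rw [show -(1 + β) = -β - 1 by ring, Real.rpow_sub (by positivity), Real.rpow_one]
    have h3 := decay_le_domKernel α β s
    rw [h2] at h3
    calc (1 + |s|) ^ (-β) / |s| ≤ 2 * ((1 + |s|) ^ (-β) / (1 + |s|)) := by
          rw [← mul_div_assoc, div_le_div_iff₀ hs0 (by positivity)]
          have : 0 ≤ (1 + |s|) ^ (-β) := by positivity
          nlinarith
      _ ≤ _ := by gcongr
  calc ‖g (x - s)‖ / |s| ≤ C * (1 + |x - s|) ^ (-β) / |s| := by gcongr; exact hg.decay _
    _ ≤ C * ((1 + |x|) ^ β * (1 + |s|) ^ (-β)) / |s| := by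
        gcongr; exact peetre hg.beta_pos.le x s
    _ = C * (1 + |x|) ^ β * ((1 + |s|) ^ (-β) / |s|) := by ring
    _ ≤ C * (1 + |x|) ^ β * (2 * domKernel α β s) := by gcongr
    _ = _ := by ring

/-! ### The principal value on the front -/

/-- A bounded `C¹` profile whose slope is Hölder continuous and decays. -/
structure IsProfile (f : ℝ → ℝ) (M α β C : ℝ) : Prop where
  bound : ∀ x, |f x| ≤ M
  contDiff : ContDiff ℝ 1 f
  slope : HolderDecay α β C (deriv f)

section Profile

variable {f : ℝ → ℝ} {M α β C : ℝ}

lemma IsProfile.hasDerivAt (hf : IsProfile f M α β C) (x : ℝ) : HasDerivAt f (deriv f x) x :=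
  (hf.contDiff.differentiable (by norm_num) x).hasDerivAt

lemma IsProfile.lipschitz (hf : IsProfile f M α β C) (a b : ℝ) : |f a - f b| ≤ C * |a - b| := by
  have := Convex.norm_image_sub_le_of_norm_deriv_le (s := univ) (f := f) (C := C)
    (fun x _ => (hf.hasDerivAt x).differentiableAt) (fun x _ => hf.slope.bound x) convex_univ
    (mem_univ b) (mem_univ a)
  simpa using this

lemma IsProfile.continuous (hf : IsProfile f M α β C) : Continuous f := hf.contDiff.continuous

/-- The mean value inequality for `f` minus its tangent line, whose slope is controlled by the
Hölder condition. -/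
lemma IsProfile.flat (hf : IsProfile f M α β C) (x₀ x : ℝ) :
    |f x - f x₀ - deriv f x₀ * (x - x₀)| ≤ C * |x - x₀| ^ α * |x - x₀| := by
  have hd : ∀ y, HasDerivAt (fun y => f y - deriv f x₀ * y) (deriv f y - deriv f x₀) y := by
    intro y
    have := (hf.hasDerivAt y).sub ((hasDerivAt_id' y).const_mul (deriv f x₀))
    rw [mul_one] at this
    exact this
  have := Convex.norm_image_sub_le_of_norm_hasDerivWithin_le (s := uIcc x₀ x)
    (C := C * |x - x₀| ^ α) (fun y _ => (hd y).hasDerivWithinAt) (fun y hy => ?_)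
    (convex_uIcc _ _) left_mem_uIcc right_mem_uIcc
  · rw [Real.norm_eq_abs, Real.norm_eq_abs] at this
    convert this using 2
    ring
  · refine (hf.slope.holder y x₀).trans ?_
    have h1 : |y - x₀| ≤ |x - x₀| := abs_sub_left_of_mem_uIcc hy
    have := hf.slope.const_nonneg
    have := hf.slope.alpha_pos
    gcongr

/-- The half-disc below the tangent line, with the density of the front. -/
noncomputable def halfDisc (X : Plane) (m ρ : ℝ) (x' : Plane) : ℝ :=
  if ‖X - x'‖ < ρ ∧ m * (X - x') 0 < (X - x') 1 then -(2 * Real.pi) else 0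

lemma abs_halfDisc_le (X : Plane) (m ρ : ℝ) (x' : Plane) : |halfDisc X m ρ x'| ≤ 2 * Real.pi := by
  unfold halfDisc
  split_ifs
  · rw [abs_neg, abs_of_pos Real.two_pi_pos]
  · simpa using Real.pi_pos.le

lemma measurable_halfDisc (X : Plane) (m ρ : ℝ) : Measurable (halfDisc X m ρ) := by
  unfold halfDisc
  have h : MeasurableSet ({x' : Plane | ‖X - x'‖ < ρ} ∩ {x' | m * (X - x') 0 < (X - x') 1}) := by
    refine (measurableSet_lt (by fun_prop) measurable_const).inter (measurableSet_lt ?_ ?_)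
    · simp only [PiLp.sub_apply]; fun_prop
    · simp only [PiLp.sub_apply]; fun_prop
  exact Measurable.ite h measurable_const measurable_const

/-- The tangential component of a radial vector field integrates to zero over a half-disc. -/
lemma integral_halfDisc_tangential (X : Plane) (m ρ : ℝ) (c : ℝ → ℝ) :
    ∫ x', halfDisc X m ρ x' * (c ‖X - x'‖ * ((X - x') 0 + m * (X - x') 1)) = 0 := by
  set G : Plane → ℝ := fun z => (if ‖z‖ < ρ ∧ m * z 0 < z 1 then -(2 * Real.pi) else 0)
    * (c ‖z‖ * (z 0 + m * z 1)) with hG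
  have e1 : ∫ x', halfDisc X m ρ x' * (c ‖X - x'‖ * ((X - x') 0 + m * (X - x') 1)) = ∫ z, G z :=
    integral_sub_left_eq_self G volume X
  rw [e1]
  set τ : Plane := !₂[1, m] with hτ
  set N : Plane := !₂[-m, 1] with hN
  -- The reflection that reverses the tangent `τ` and fixes the normal `N`. It preserves the norm
  -- and the side of the tangent line, hence the half-disc, and changes the sign of the tangential
  -- component.
  set σ := (ℝ ∙ τ)ᗮ.reflection with hσ
  have hστ : σ τ = -τ := Submodule.reflection_orthogonalComplement_singleton_eq_neg τ
  have hNτ : inner ℝ τ N = 0 := by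
    simp [hτ, hN, PiLp.inner_apply, Fin.sum_univ_two]
  have hσN : σ N = N := Submodule.reflection_mem_subspace_eq_self
    (Submodule.mem_orthogonal_singleton_iff_inner_right.2 hNτ)
  have i1 : ∀ z : Plane, z 0 + m * z 1 = inner ℝ τ z := by
    intro z
    simp [hτ, PiLp.inner_apply, Fin.sum_univ_two]; ring
  have i2 : ∀ z : Plane, m * z 0 < z 1 ↔ 0 < inner ℝ N z := by
    intro z
    simp [hN, PiLp.inner_apply, Fin.sum_univ_two]
    constructor <;> intro h <;> linarith
  have j1 : ∀ z : Plane, inner ℝ τ (σ z) = -inner ℝ τ z := by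
    intro z
    rw [← σ.inner_map_map τ z, hστ, inner_neg_left, neg_neg]
  have j2 : ∀ z : Plane, inner ℝ N (σ z) = inner ℝ N z := by
    intro z
    conv_rhs => rw [← σ.inner_map_map N z, hσN]
  have hodd : ∀ z, G (σ z) = -G z := by
    intro z
    simp only [hG, i1, i2, j1, j2, LinearIsometryEquiv.norm_map]
    ring
  have h2 := (σ.measurePreserving).integral_comp' (f := σ.toMeasurableEquiv) G
  simp only [LinearIsometryEquiv.coe_toMeasurableEquiv, hodd] at h2
  rw [integral_neg] at h2
  linarith

lemma abs_tangential_le (m : ℝ) (z : Plane) : |z 0 + m * z 1| ≤ (1 + |m|) * ‖z‖ := by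
  refine (abs_add_le _ _).trans ?_
  rw [abs_mul, add_mul, one_mul]
  gcongr
  · exact abs_coord_le_norm z 0
  · exact abs_coord_le_norm z 1

/-- Near a point of the front, the front and its tangent differ by a cusp. -/
lemma IsProfile.cusp (hf : IsProfile f M α β C) {h : ℝ} (hh : ∀ x, -h < f x) (x₀ : ℝ) {x' : Plane}
    (hx : ‖frontPoint f x₀ - x'‖ < f x₀ + h)
    (hne : thetaStar h f x' - halfDisc (frontPoint f x₀) (deriv f x₀) (f x₀ + h) x' ≠ 0) :
    |x' 1 - (f x₀ + deriv f x₀ * (x' 0 - x₀))| ≤ C * |x' 0 - x₀| ^ α * |x' 0 - x₀| := by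
  refine le_trans ?_ (hf.flat x₀ (x' 0))
  have h1 := (abs_coord_le_norm (frontPoint f x₀ - x') 1).trans_lt hx
  simp only [frontPoint, PiLp.sub_apply, Matrix.cons_val_one,
    Matrix.cons_val_fin_one] at h1
  -- The disc of radius `f x₀ + h` does not reach the line `y = -h`, so inside it only the graph and
  -- the tangent line matter.
  have h2 : -h < x' 1 := by linarith [(abs_lt.1 h1).2]
  rw [thetaStar_eq hh, halfDisc] at hne
  simp only [h2, hx, true_and] at hne
  simp only [frontPoint, PiLp.sub_apply, Matrix.cons_val_zero, Matrix.cons_val_one,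
    Matrix.cons_val_fin_one] at hne
  by_cases h3 : x' 1 ≤ f (x' 0)
  · by_cases h4 : deriv f x₀ * (x₀ - x' 0) < f x₀ - x' 1
    · simp [h3, h4] at hne
    · rw [abs_of_nonneg (by linarith), abs_of_nonneg (by linarith)]; linarith
  · by_cases h4 : deriv f x₀ * (x₀ - x' 0) < f x₀ - x' 1
    · rw [abs_of_nonpos (by linarith), abs_of_nonpos (by linarith)]; linarith
    · simp [h3, h4] at hne

/-- Inside the disc the densities differ on a cusp of thickness `|s|^(1+α)`, which against `|s|⁻²`
leaves the integrable `|s|^(α-1)`. Outside only the strip is left, where the kernel decays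
horizontally. -/
lemma IsProfile.integrable_cusp (hf : IsProfile f M α β C) {h : ℝ} (hh : ∀ x, -h < f x) (x₀ : ℝ) :
    Integrable (fun x' => |thetaStar h f x' - halfDisc (frontPoint f x₀) (deriv f x₀) (f x₀ + h) x'|
      * (‖frontPoint f x₀ - x'‖ ^ 2)⁻¹) := by
  set X := frontPoint f x₀ with hX
  set H := f x₀ + h with hH
  have hH0 : 0 < H := by have := hh x₀; linarith
  set θ := fun x' => |thetaStar h f x' - halfDisc X (deriv f x₀) H x'| with hθ
  have hfm := hf.continuous.measurable
  have hB := isBddDensity_thetaStar hfm hh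
  have hθm : Measurable θ := (hB.measurable.sub (measurable_halfDisc _ _ _)).abs
  have hθb : ∀ x', θ x' ≤ 4 * Real.pi := fun x' =>
    (abs_sub _ _).trans (by linarith [hB.bound x', abs_halfDisc_le X (deriv f x₀) H x'])
  have hkm : Measurable (fun x' : Plane => (‖X - x'‖ ^ 2)⁻¹) := by fun_prop
  have hC := hf.slope.const_nonneg
  have hα := hf.slope.alpha_pos
  -- inside the disc
  have h1 : Integrable ((Metric.ball X H).indicator (fun x' => θ x' * (‖X - x'‖ ^ 2)⁻¹)) := by
    refine integrable_plane (integrable_of_support_slab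
      (k := fun s => 4 * Real.pi * (|s - x₀| ^ 2)⁻¹)
      (m := fun s => f x₀ + deriv f x₀ * (s - x₀))
      (ℓ := (Icc (x₀ - H) (x₀ + H)).indicator fun s => C * |s - x₀| ^ α * |s - x₀|)
      ?_ ?_ ?_ ?_ ?_).1
    · exact (((hθm.mul hkm).indicator measurableSet_ball).comp
        measurePreserving_ofCoord.measurable).aestronglyMeasurable
    · filter_upwards [Measure.ae_ne volume x₀] with s hs w
      have hs' : 0 < |s - x₀| := abs_pos.2 (sub_ne_zero.2 hs)
      refine (norm_indicator_le_norm_self _ _).trans ?_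
      rw [norm_mul, Real.norm_of_nonneg (abs_nonneg _), Real.norm_of_nonneg (by positivity)]
      refine mul_le_mul (hθb _) (inv_anti₀ (by positivity) ?_) (by positivity) (by positivity)
      gcongr
      have := abs_coord_le_norm (X - ofCoord (s, w)) 0
      simp only [hX, frontPoint, PiLp.sub_apply, ofCoord_zero, Matrix.cons_val_zero] at this
      rwa [abs_sub_comm] at this
    · intro s w hw
      by_contra hne
      have hmem : ofCoord (s, w) ∈ Metric.ball X H := mem_of_indicator_ne_zero hne
      rw [indicator_of_mem hmem] at hne
      have hd : ‖X - ofCoord (s, w)‖ < H := by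
        rw [norm_sub_rev]; exact mem_ball_iff_norm.1 hmem
      have h3 := hf.cusp hh x₀ hd (abs_ne_zero.1 (left_ne_zero_of_mul hne))
      simp only [ofCoord_zero, ofCoord_one] at h3
      have h4 := (abs_coord_le_norm (X - ofCoord (s, w)) 0).trans hd.le
      simp only [hX, frontPoint, PiLp.sub_apply, ofCoord_zero, Matrix.cons_val_zero, abs_le] at h4
      rw [indicator_of_mem (by exact ⟨by linarith, by linarith⟩)] at hw
      linarith
    · exact fun s => indicator_nonneg (fun _ _ => by positivity) _
    · have h5 := (((integrable_indicator_iff measurableSet_Icc).2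
        (integrableOn_abs_rpow (a := α - 1) (by linarith) H)).comp_sub_right x₀).const_mul
        (4 * Real.pi * C)
      refine h5.congr ?_
      filter_upwards [Measure.ae_ne volume x₀] with s hs
      have hs' : 0 < |s - x₀| := abs_pos.2 (sub_ne_zero.2 hs)
      by_cases hmem : s ∈ Icc (x₀ - H) (x₀ + H)
      · have hmem' : s - x₀ ∈ Icc (-H) H := ⟨by linarith [hmem.1], by linarith [hmem.2]⟩
        rw [indicator_of_mem hmem, indicator_of_mem hmem', Real.rpow_sub_one hs'.ne']
        field_simp
      · have hmem' : s - x₀ ∉ Icc (-H) H := fun h' =>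
          hmem ⟨by linarith [h'.1], by linarith [h'.2]⟩
        rw [indicator_of_notMem hmem, indicator_of_notMem hmem']
        simp
  -- outside the disc
  have h2 : Integrable ((Metric.ball X H)ᶜ.indicator (fun x' => θ x' * (‖X - x'‖ ^ 2)⁻¹)) := by
    -- The scalar weight is stored in the first component of a vector kernel, to which the strip
    -- estimate applies.
    have h3 := integrable_thetaStar_smul hfm hh (fun x => (abs_le.1 (hf.bound x)).2)
      (K := fun z => if H ≤ ‖z‖ then !₂[(‖z‖ ^ 2)⁻¹, 0] else 0) ?_
      ((integrable_inv_sq_add_sq hH0.ne').const_mul 2) ?_ X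
    · have h4 := (integrable_plane_apply h3 0).abs
      refine h4.congr (ae_of_all _ fun x' => ?_)
      have hmem : x' ∈ (Metric.ball X H)ᶜ ↔ H ≤ ‖X - x'‖ := by
        rw [← dist_eq_norm, dist_comm]; simp
      by_cases hx : H ≤ ‖X - x'‖
      · rw [indicator_of_mem (hmem.2 hx)]
        have : halfDisc X (deriv f x₀) H x' = 0 := if_neg fun h' => not_le.2 h'.1 hx
        simp [hx, hθ, this, abs_mul]
      · rw [indicator_of_notMem fun h' => hx (hmem.1 h')]
        simp [hx]
    · refine Measurable.ite (measurableSet_le measurable_const measurable_norm) ?_ measurable_const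
      refine (PiLp.continuous_toLp 2 _).measurable.comp (measurable_pi_iff.2 fun i => ?_)
      fin_cases i
      · simp; fun_prop
      · simp
    · intro z
      split_ifs with hz
      · refine (plane_norm_le _).trans ?_
        simp only [Matrix.cons_val_zero, Matrix.cons_val_one, Matrix.cons_val_fin_one, abs_zero,
          add_zero]
        rw [abs_of_nonneg (by positivity)]
        have h1 : H ^ 2 ≤ ‖z‖ ^ 2 := by gcongr
        have h2 := plane_norm_sq z
        have h3 : 0 < H ^ 2 := by positivity
        rw [← div_eq_mul_inv, inv_eq_one_div, div_le_div_iff₀ (by linarith) (by positivity)]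
        nlinarith [sq_nonneg (z 1)]
      · simp; positivity
  refine (h1.add h2).congr (ae_of_all _ fun x' => ?_)
  simp only [Pi.add_apply]
  rw [← Pi.add_apply, indicator_self_add_compl]

/-- Principal values on the front do not depend on the radial regularization. -/
theorem IsProfile.tendsto_tangential (hf : IsProfile f M α β C) {h : ℝ} (hh : ∀ x, -h < f x)
    (x₀ : ℝ) {l : Filter ℝ} [l.IsCountablyGenerated] {c : ℝ → ℝ → ℝ}
    (hcm : ∀ i, Measurable (c i)) (hcb : ∀ i r, 0 < r → |c i r| ≤ (r ^ 3)⁻¹)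
    (hcB : ∀ᶠ i in l, ∃ B, ∀ r, 0 ≤ r → |c i r * r| ≤ B)
    (hct : ∀ r, 0 < r → Tendsto (fun i => c i r) l (𝓝 ((2 * Real.pi)⁻¹ * (r ^ 3)⁻¹))) :
    Tendsto (fun i => ∫ x', thetaStar h f x' * (c i ‖frontPoint f x₀ - x'‖
        * ((frontPoint f x₀ - x') 0 + deriv f x₀ * (frontPoint f x₀ - x') 1))) l
      (𝓝 (∫ x', (thetaStar h f x' - halfDisc (frontPoint f x₀) (deriv f x₀) (f x₀ + h) x')
        * ((2 * Real.pi)⁻¹ * (‖frontPoint f x₀ - x'‖ ^ 3)⁻¹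
          * ((frontPoint f x₀ - x') 0 + deriv f x₀ * (frontPoint f x₀ - x') 1)))) := by
  set X := frontPoint f x₀ with hX
  set m := deriv f x₀ with hm
  set H := f x₀ + h with hH
  have hB := isBddDensity_thetaStar hf.continuous.measurable hh
  have hDm := measurable_halfDisc X m H
  have hνm : Measurable (fun x' : Plane => (X - x') 0 + m * (X - x') 1) := by
    simp only [PiLp.sub_apply]; fun_prop
  have hkm : ∀ i, Measurable (fun x' => c i ‖X - x'‖ * ((X - x') 0 + m * (X - x') 1)) := fun i =>
    ((hcm i).comp (by fun_prop)).mul hνm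
  have hΦ := (hf.integrable_cusp hh x₀).const_mul (1 + |m|)
  -- The tangential coordinate cancels one power of the kernel, which leaves `‖z‖⁻²` on the cusp,
  -- uniformly in `i`.
  have hdom : ∀ i x', ‖(thetaStar h f x' - halfDisc X m H x')
      * (c i ‖X - x'‖ * ((X - x') 0 + m * (X - x') 1))‖
      ≤ (1 + |m|) * (|thetaStar h f x' - halfDisc X m H x'| * (‖X - x'‖ ^ 2)⁻¹) := by
    intro i x'
    rcases eq_or_ne (X - x') 0 with h0 | h0
    · simp [h0]
    have h1 := norm_pos_iff.2 h0
    rw [norm_mul, norm_mul, Real.norm_eq_abs, Real.norm_eq_abs, Real.norm_eq_abs]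
    calc _ ≤ |thetaStar h f x' - halfDisc X m H x'|
          * ((‖X - x'‖ ^ 3)⁻¹ * ((1 + |m|) * ‖X - x'‖)) := by
          gcongr
          · exact hcb i _ h1
          · exact abs_tangential_le m _
      _ = _ := by field_simp
  have hmeas : ∀ i, AEStronglyMeasurable (fun x' => (thetaStar h f x' - halfDisc X m H x')
      * (c i ‖X - x'‖ * ((X - x') 0 + m * (X - x') 1))) := fun i =>
    ((hB.measurable.sub hDm).mul (hkm i)).aestronglyMeasurable
  have hlim := tendsto_integral_filter_of_dominated_convergence (l := l)
    (F := fun i x' => (thetaStar h f x' - halfDisc X m H x')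
      * (c i ‖X - x'‖ * ((X - x') 0 + m * (X - x') 1)))
    (f := fun x' => (thetaStar h f x' - halfDisc X m H x')
        * ((2 * Real.pi)⁻¹ * (‖X - x'‖ ^ 3)⁻¹ * ((X - x') 0 + m * (X - x') 1)))
    _ (Eventually.of_forall hmeas) (Eventually.of_forall fun i => ae_of_all _ (hdom i)) hΦ
    (by
      filter_upwards [Measure.ae_ne volume X] with x' hx'
      exact ((hct _ (norm_pos_iff.2 (sub_ne_zero.2 hx'.symm))).mul_const _).const_mul _)
  refine hlim.congr' ?_
  filter_upwards [hcB] with i hi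
  obtain ⟨B, hB'⟩ := hi
  have i1 : Integrable (fun x' => (thetaStar h f x' - halfDisc X m H x')
      * (c i ‖X - x'‖ * ((X - x') 0 + m * (X - x') 1))) :=
    hΦ.mono' (hmeas i) (ae_of_all _ (hdom i))
  -- The boundedness in `hcB` serves to make the half-disc term integrable for fixed `i`, so that
  -- the integral can be split.
  have i2 : Integrable (fun x' => halfDisc X m H x'
      * (c i ‖X - x'‖ * ((X - x') 0 + m * (X - x') 1))) := by
    have hb : IntegrableOn (fun x' => halfDisc X m H x'
        * (c i ‖X - x'‖ * ((X - x') 0 + m * (X - x') 1))) (Metric.ball X H) := by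
      refine Measure.integrableOn_of_bounded (M := 2 * Real.pi * (B * (1 + |m|)))
        measure_ball_lt_top.ne (hDm.mul (hkm i)).aestronglyMeasurable (ae_of_all _ fun x' => ?_)
      rw [norm_mul, Real.norm_eq_abs]
      refine mul_le_mul (abs_halfDisc_le X m H x') ?_ (norm_nonneg _) Real.two_pi_pos.le
      have h1 := hB' _ (norm_nonneg (X - x'))
      rw [abs_mul, abs_of_nonneg (norm_nonneg _)] at h1
      rw [norm_mul, Real.norm_eq_abs, Real.norm_eq_abs]
      calc _ ≤ |c i ‖X - x'‖| * ((1 + |m|) * ‖X - x'‖) := by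
            gcongr; exact abs_tangential_le m _
        _ = |c i ‖X - x'‖| * ‖X - x'‖ * (1 + |m|) := by ring
        _ ≤ _ := by gcongr
    rw [← integrable_indicator_iff measurableSet_ball] at hb
    refine hb.congr (ae_of_all _ fun x' => ?_)
    by_cases hx : x' ∈ Metric.ball X H
    · rw [indicator_of_mem hx]
    · have h0 : halfDisc X m H x' = 0 := by
        refine if_neg fun h' => hx ?_
        rw [mem_ball_iff_norm, norm_sub_rev]
        exact h'.1
      rw [indicator_of_notMem hx]
      simp [h0]
  -- The half-disc contributes zero for every radial regularization, so it may be added back.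
  have e := integral_halfDisc_tangential X m H (c i)
  rw [← add_zero (∫ x', (thetaStar h f x' - halfDisc X m H x')
      * (c i ‖X - x'‖ * ((X - x') 0 + m * (X - x') 1))), ← e, ← integral_add i1 i2]
  congr 1; ext1 x'; ring

end Profile

/-! ### Evaluation of the normal velocity -/

lemma abs_inv_sqrt_sub_le {q : ℝ} (hq : 0 < q) (a b : ℝ) :
    |(Real.sqrt (q ^ 2 + a ^ 2))⁻¹ - (Real.sqrt (q ^ 2 + b ^ 2))⁻¹| ≤ (a ^ 2 + b ^ 2) * (q ^ 3)⁻¹ := by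
  set A := Real.sqrt (q ^ 2 + a ^ 2) with hA
  set B := Real.sqrt (q ^ 2 + b ^ 2) with hB
  have hA2 : A ^ 2 = q ^ 2 + a ^ 2 := Real.sq_sqrt (by positivity)
  have hB2 : B ^ 2 = q ^ 2 + b ^ 2 := Real.sq_sqrt (by positivity)
  have hqA : q ≤ A := Real.le_sqrt_of_sq_le (by linarith [sq_nonneg a])
  have hqB : q ≤ B := Real.le_sqrt_of_sq_le (by linarith [sq_nonneg b])
  have hA0 : 0 < A := hq.trans_le hqA
  have hB0 : 0 < B := hq.trans_le hqB
  have e : A⁻¹ - B⁻¹ = (b ^ 2 - a ^ 2) * (A * B * (A + B))⁻¹ := by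
    have : b ^ 2 - a ^ 2 = (B - A) * (A + B) := by linarith
    rw [this]; field_simp
  rw [e, abs_mul, abs_of_pos (by positivity : 0 < (A * B * (A + B))⁻¹)]
  have h1 : q ^ 3 ≤ A * B * (A + B) := by
    calc q ^ 3 = q * q * q := by ring
      _ ≤ A * B * (A + B) := by gcongr; linarith
  gcongr
  rw [abs_le]; constructor <;> linarith [sq_nonneg a, sq_nonneg b]

section Profile

variable {f : ℝ → ℝ} {M α β C : ℝ}

/-- The increment of the profile. -/
noncomputable def increment (f : ℝ → ℝ) (x₀ s : ℝ) : ℝ := f (x₀ - s) - f x₀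

lemma IsProfile.abs_increment_le (hf : IsProfile f M α β C) (x₀ s : ℝ) :
    |increment f x₀ s| ≤ 2 * M := by
  refine (abs_sub _ _).trans ?_
  linarith [hf.bound (x₀ - s), hf.bound x₀]

lemma IsProfile.hasDerivAt_increment (hf : IsProfile f M α β C) (x₀ s : ℝ) :
    HasDerivAt (increment f x₀) (-deriv f (x₀ - s)) s := by
  have h1 : HasDerivAt (fun s => x₀ - s) (-1) s := by
    simpa using (hasDerivAt_id s).const_sub x₀
  have := ((hf.hasDerivAt (x₀ - s)).comp s h1).sub_const (f x₀)
  rw [mul_neg_one] at this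
  exact this

lemma IsProfile.continuous_increment (hf : IsProfile f M α β C) (x₀ : ℝ) :
    Continuous (increment f x₀) :=
  (hf.continuous.comp (continuous_const.sub continuous_id)).sub continuous_const

/-- The one-dimensional integrand for the tangential component at height `η`. -/
noncomputable def tangentialIntegrand (f : ℝ → ℝ) (x₀ H η s : ℝ) : ℝ :=
  (deriv f x₀ - deriv f (x₀ - s)) * (Real.sqrt (s ^ 2 + η ^ 2 + increment f x₀ s ^ 2))⁻¹
    - deriv f x₀ * (Real.sqrt (s ^ 2 + η ^ 2 + H ^ 2))⁻¹

lemma IsProfile.measurable_tangentialIntegrand (hf : IsProfile f M α β C) (x₀ H η : ℝ) :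
    Measurable (tangentialIntegrand f x₀ H η) := by
  unfold tangentialIntegrand
  have h1 := hf.slope.continuous.measurable
  have h2 := (hf.continuous_increment x₀).measurable
  fun_prop

/-- Near zero the Hölder condition leaves `|s|^(α-1)`. At infinity the two terms with the slope at
`x₀` cancel to order `|s|⁻³`, and the slope at `x₀ - s` decays. The bound is independent of `η`, so
it also gives the limit. -/
lemma IsProfile.abs_tangentialIntegrand_le (hf : IsProfile f M α β C) (x₀ : ℝ) {H : ℝ}
    (hH : 0 < H) : ∃ K, ∀ η s : ℝ, s ≠ 0 →
      |tangentialIntegrand f x₀ H η s| ≤ K * domKernel α β s := by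
  have hC := hf.slope.const_nonneg
  have hM : 0 ≤ M := (abs_nonneg _).trans (hf.bound 0)
  set m := deriv f x₀ with hm
  refine ⟨C + |m| * H⁻¹ * 4 + 2 * C * (1 + |x₀|) ^ β + |m| * (((2 * M) ^ 2 + H ^ 2) * 4),
    fun η s hs => ?_⟩
  have hs0 : 0 < |s| := abs_pos.2 hs
  have hD := domKernel_nonneg α β s
  set F := increment f x₀ s with hF
  have hq0 : 0 < Real.sqrt (s ^ 2 + η ^ 2) := Real.sqrt_pos.2 (by positivity)
  have hq2 : Real.sqrt (s ^ 2 + η ^ 2) ^ 2 = s ^ 2 + η ^ 2 := Real.sq_sqrt (by positivity)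
  have hsF : |s| ≤ Real.sqrt (s ^ 2 + η ^ 2 + F ^ 2) :=
    Real.abs_le_sqrt (by linarith [sq_nonneg η, sq_nonneg F])
  have hsF' : (Real.sqrt (s ^ 2 + η ^ 2 + F ^ 2))⁻¹ ≤ |s|⁻¹ := inv_anti₀ hs0 hsF
  have hHH : (Real.sqrt (s ^ 2 + η ^ 2 + H ^ 2))⁻¹ ≤ H⁻¹ :=
    inv_anti₀ hH (Real.le_sqrt_of_sq_le (by linarith [sq_nonneg η, sq_nonneg s]))
  rcases le_total |s| 1 with h1 | h1
  · have e1 : |(m - deriv f (x₀ - s)) * (Real.sqrt (s ^ 2 + η ^ 2 + F ^ 2))⁻¹|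
        ≤ C * domKernel α β s := by
      rw [abs_mul, abs_of_nonneg (by positivity : 0 ≤ (Real.sqrt (s ^ 2 + η ^ 2 + F ^ 2))⁻¹)]
      have h2 := hf.slope.holder x₀ (x₀ - s)
      rw [sub_sub_cancel, Real.norm_eq_abs] at h2
      calc _ ≤ C * |s| ^ α * |s|⁻¹ := by gcongr
        _ = C * |s| ^ (α - 1) := by rw [Real.rpow_sub_one hs0.ne']; field_simp
        _ ≤ _ := by gcongr; exact rpow_le_domKernel β h1
    have e2 : |m * (Real.sqrt (s ^ 2 + η ^ 2 + H ^ 2))⁻¹| ≤ |m| * H⁻¹ * (4 * domKernel α β s) := by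
      rw [abs_mul, abs_of_nonneg (by positivity : 0 ≤ (Real.sqrt (s ^ 2 + η ^ 2 + H ^ 2))⁻¹)]
      calc _ ≤ |m| * H⁻¹ * 1 := by rw [mul_one]; gcongr
        _ ≤ _ := by gcongr; exact one_le_domKernel α hf.slope.beta_pos hf.slope.beta_le h1
    refine (abs_sub _ _).trans ((add_le_add e1 e2).trans ?_)
    have : 0 ≤ 2 * C * (1 + |x₀|) ^ β + |m| * (((2 * M) ^ 2 + H ^ 2) * 4) := by positivity
    nlinarith
  · have e0 : tangentialIntegrand f x₀ H η s
        = m * ((Real.sqrt (s ^ 2 + η ^ 2 + F ^ 2))⁻¹ - (Real.sqrt (s ^ 2 + η ^ 2 + H ^ 2))⁻¹)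
          - deriv f (x₀ - s) * (Real.sqrt (s ^ 2 + η ^ 2 + F ^ 2))⁻¹ := by
      unfold tangentialIntegrand; ring
    have e1 : |m * ((Real.sqrt (s ^ 2 + η ^ 2 + F ^ 2))⁻¹
        - (Real.sqrt (s ^ 2 + η ^ 2 + H ^ 2))⁻¹)|
        ≤ |m| * (((2 * M) ^ 2 + H ^ 2) * (4 * domKernel α β s)) := by
      rw [abs_mul]
      gcongr
      have h2 := abs_inv_sqrt_sub_le hq0 F H
      rw [hq2] at h2
      refine h2.trans ?_
      have h3 : F ^ 2 ≤ (2 * M) ^ 2 := by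
        rw [← sq_abs F]; gcongr; exact hf.abs_increment_le x₀ s
      have h4 : (Real.sqrt (s ^ 2 + η ^ 2) ^ 3)⁻¹ ≤ (|s| ^ 3)⁻¹ := by
        gcongr; exact abs_le_sqrt_sq_add s η
      have h5 := inv_cube_le_domKernel α hf.slope.beta_le h1
      gcongr
      exact h4.trans h5
    have e2 : |deriv f (x₀ - s) * (Real.sqrt (s ^ 2 + η ^ 2 + F ^ 2))⁻¹|
        ≤ 2 * C * (1 + |x₀|) ^ β * domKernel α β s := by
      rw [abs_mul, abs_of_nonneg (by positivity : 0 ≤ (Real.sqrt (s ^ 2 + η ^ 2 + F ^ 2))⁻¹)]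
      refine le_trans ?_ (hf.slope.far_le x₀ h1)
      rw [div_eq_mul_inv, Real.norm_eq_abs]
      gcongr
    rw [e0]
    refine (abs_sub _ _).trans ((add_le_add e1 e2).trans ?_)
    have : 0 ≤ C + |m| * H⁻¹ * 4 := by positivity
    nlinarith

lemma IsProfile.integrable_tangentialIntegrand (hf : IsProfile f M α β C) (x₀ : ℝ) {H : ℝ}
    (hH : 0 < H) (η : ℝ) : Integrable (tangentialIntegrand f x₀ H η) := by
  obtain ⟨K, hK⟩ := hf.abs_tangentialIntegrand_le x₀ hH
  refine ((integrable_domKernel hf.slope.alpha_pos hf.slope.beta_pos).const_mul K).mono'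
    (hf.measurable_tangentialIntegrand x₀ H η).aestronglyMeasurable ?_
  filter_upwards [Measure.ae_ne volume (0 : ℝ)] with s hs
  exact hK η s hs

lemma IsProfile.tendsto_tangentialIntegrand (hf : IsProfile f M α β C) (x₀ : ℝ) {H : ℝ}
    (hH : 0 < H) : Tendsto (fun η => ∫ s, tangentialIntegrand f x₀ H η s) (𝓝[>] 0)
      (𝓝 (∫ s, tangentialIntegrand f x₀ H 0 s)) := by
  obtain ⟨K, hK⟩ := hf.abs_tangentialIntegrand_le x₀ hH
  refine tendsto_integral_filter_of_dominated_convergence _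
    (Eventually.of_forall fun η => (hf.measurable_tangentialIntegrand x₀ H η).aestronglyMeasurable)
    (Eventually.of_forall fun η => ?_)
    ((integrable_domKernel hf.slope.alpha_pos hf.slope.beta_pos).const_mul K) ?_
  · filter_upwards [Measure.ae_ne volume (0 : ℝ)] with s hs
    exact hK η s hs
  · filter_upwards [Measure.ae_ne volume (0 : ℝ)] with s hs
    have hs2 : 0 < s ^ 2 := by positivity
    have h : ∀ a : ℝ, ContinuousAt (fun η : ℝ => (Real.sqrt (s ^ 2 + η ^ 2 + a ^ 2))⁻¹) 0 := by
      intro a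
      refine ContinuousAt.inv₀ (by fun_prop) (Real.sqrt_pos.2 ?_).ne'
      positivity
    exact ((continuousAt_const.mul (h _)).sub (continuousAt_const.mul (h _))).tendsto.mono_left
      nhdsWithin_le_nhds

/-- Integration by parts along the front. -/
lemma IsProfile.integral_increment_by_parts (hf : IsProfile f M α β C) (x₀ : ℝ) {η : ℝ}
    (hη : 0 < η) :
    Integrable (fun s => deriv f (x₀ - s)
      * (Real.sqrt (s ^ 2 + η ^ 2 + increment f x₀ s ^ 2))⁻¹) ∧
    Integrable (fun s => s * increment f x₀ s * ((s ^ 2 + η ^ 2)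
      * Real.sqrt (s ^ 2 + η ^ 2 + increment f x₀ s ^ 2))⁻¹) ∧
    ∫ s, s * increment f x₀ s * ((s ^ 2 + η ^ 2)
      * Real.sqrt (s ^ 2 + η ^ 2 + increment f x₀ s ^ 2))⁻¹
      = -∫ s, deriv f (x₀ - s) * (Real.sqrt (s ^ 2 + η ^ 2 + increment f x₀ s ^ 2))⁻¹ := by
  have hC := hf.slope.const_nonneg
  have hM : 0 ≤ M := (abs_nonneg _).trans (hf.bound 0)
  have hm1 := hf.slope.continuous.measurable
  have hm2 := (hf.continuous_increment x₀).measurable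
  have i1 : Integrable (fun s => deriv f (x₀ - s)
      * (Real.sqrt (s ^ 2 + η ^ 2 + increment f x₀ s ^ 2))⁻¹) := by
    refine ((integrable_domKernel hf.slope.alpha_pos hf.slope.beta_pos).const_mul
      (C * η⁻¹ * 4 + 2 * C * (1 + |x₀|) ^ β)).mono' (by fun_prop) ?_
    refine ae_of_all _ fun s => ?_
    have hD := domKernel_nonneg α β s
    have h0 : (Real.sqrt (s ^ 2 + η ^ 2 + increment f x₀ s ^ 2))⁻¹ ≤ η⁻¹ :=
      inv_anti₀ hη (Real.le_sqrt_of_sq_le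
        (by linarith [sq_nonneg s, sq_nonneg (increment f x₀ s)]))
    rw [norm_mul, Real.norm_of_nonneg
      (by positivity : 0 ≤ (Real.sqrt (s ^ 2 + η ^ 2 + increment f x₀ s ^ 2))⁻¹)]
    rcases le_total |s| 1 with h1 | h1
    · calc _ ≤ C * η⁻¹ * 1 := by
            rw [mul_one]; gcongr; exact hf.slope.bound _
        _ ≤ C * η⁻¹ * (4 * domKernel α β s) := by
            gcongr; exact one_le_domKernel α hf.slope.beta_pos hf.slope.beta_le h1
        _ ≤ _ := by
            have : 0 ≤ 2 * C * (1 + |x₀|) ^ β := by positivity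
            nlinarith
    · have hs0 : 0 < |s| := by linarith
      have h2 : (Real.sqrt (s ^ 2 + η ^ 2 + increment f x₀ s ^ 2))⁻¹ ≤ |s|⁻¹ :=
        inv_anti₀ hs0 (Real.abs_le_sqrt
          (by linarith [sq_nonneg η, sq_nonneg (increment f x₀ s)]))
      calc _ ≤ ‖deriv f (x₀ - s)‖ / |s| := by rw [div_eq_mul_inv]; gcongr
        _ ≤ 2 * C * (1 + |x₀|) ^ β * domKernel α β s := hf.slope.far_le x₀ h1
        _ ≤ _ := by
            have : 0 ≤ C * η⁻¹ * 4 := by positivity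
            nlinarith
  have i2 : Integrable (fun s => s * increment f x₀ s * ((s ^ 2 + η ^ 2)
      * Real.sqrt (s ^ 2 + η ^ 2 + increment f x₀ s ^ 2))⁻¹) := by
    refine ((integrable_inv_sq_add_sq hη.ne').const_mul (2 * M)).mono' (by fun_prop)
      (ae_of_all _ fun s => ?_)
    have hp : 0 < s ^ 2 + η ^ 2 := by positivity
    have hp2 : 0 < Real.sqrt (s ^ 2 + η ^ 2 + increment f x₀ s ^ 2) :=
      Real.sqrt_pos.2 (by positivity)
    have h2 : |s| ≤ Real.sqrt (s ^ 2 + η ^ 2 + increment f x₀ s ^ 2) :=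
      Real.abs_le_sqrt (by linarith [sq_nonneg η, sq_nonneg (increment f x₀ s)])
    rw [norm_mul, norm_mul, Real.norm_eq_abs, Real.norm_eq_abs, Real.norm_of_nonneg
      (by positivity), mul_inv]
    calc _ ≤ Real.sqrt (s ^ 2 + η ^ 2 + increment f x₀ s ^ 2) * (2 * M) * ((s ^ 2 + η ^ 2)⁻¹
          * (Real.sqrt (s ^ 2 + η ^ 2 + increment f x₀ s ^ 2))⁻¹) := by
          gcongr; exact hf.abs_increment_le x₀ s
      _ = _ := by field_simp
  refine ⟨i1, i2, ?_⟩
  -- With `F` the increment and `q = √(s² + η²)`, the derivative of `arsinh (F / q)` consists of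
  -- exactly the two integrands, and `arsinh (F / q)` vanishes at infinity because `F` is bounded.
  have hd : ∀ s, HasDerivAt (fun s => Real.arsinh (increment f x₀ s * (Real.sqrt (s ^ 2 + η ^ 2))⁻¹))
      (-(deriv f (x₀ - s) * (Real.sqrt (s ^ 2 + η ^ 2 + increment f x₀ s ^ 2))⁻¹)
        - s * increment f x₀ s * ((s ^ 2 + η ^ 2)
          * Real.sqrt (s ^ 2 + η ^ 2 + increment f x₀ s ^ 2))⁻¹) s := by
    intro s
    have hp := sqrt_sq_add_pos s hη.ne'
    have hq2 : Real.sqrt (s ^ 2 + η ^ 2) ^ 2 = s ^ 2 + η ^ 2 := Real.sq_sqrt (by positivity)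
    have h1 := ((hf.hasDerivAt_increment x₀ s).mul
      ((hasDerivAt_sqrt_sq_add s hη.ne').inv hp.ne')).arsinh
    refine h1.congr_deriv ?_
    simp only [Pi.mul_apply, Pi.inv_apply]
    set q := Real.sqrt (s ^ 2 + η ^ 2) with hq
    rw [← hq2]
    set F := increment f x₀ s
    have hE : Real.sqrt (1 + (F * q⁻¹) ^ 2) = Real.sqrt (q ^ 2 + F ^ 2) * q⁻¹ := by
      rw [show (1 + (F * q⁻¹) ^ 2) = (q ^ 2 + F ^ 2) * (q⁻¹) ^ 2 by field_simp,
        Real.sqrt_mul (by positivity), Real.sqrt_sq (by positivity)]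
    have hp2 : 0 < Real.sqrt (q ^ 2 + F ^ 2) := Real.sqrt_pos.2 (by positivity)
    rw [hE, smul_eq_mul]
    field_simp
    ring
  have hlim : ∀ l : Filter ℝ, Tendsto (fun s : ℝ => |s|) l atTop →
      Tendsto (fun s => Real.arsinh (increment f x₀ s * (Real.sqrt (s ^ 2 + η ^ 2))⁻¹)) l (𝓝 0) := by
    intro l hl
    have h1 : Tendsto (fun s => increment f x₀ s * (Real.sqrt (s ^ 2 + η ^ 2))⁻¹) l (𝓝 0) := by
      refine squeeze_zero_norm' (a := fun s => 2 * M / |s|) ?_ (tendsto_const_nhds.div_atTop hl)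
      filter_upwards [hl.eventually_gt_atTop 0] with s hs
      rw [norm_mul, Real.norm_eq_abs, Real.norm_of_nonneg (by positivity), div_eq_mul_inv]
      gcongr
      · exact hf.abs_increment_le x₀ s
      · exact abs_le_sqrt_sq_add s η
    have := (Real.continuous_arsinh.tendsto 0).comp h1
    simpa [Function.comp_def] using this
  have i1' : Integrable (fun s => -(deriv f (x₀ - s)
      * (Real.sqrt (s ^ 2 + η ^ 2 + increment f x₀ s ^ 2))⁻¹)) := i1.neg
  have key := integral_of_hasDerivAt_of_tendsto hd (i1'.sub i2)
    (hlim _ tendsto_abs_atBot_atTop) (hlim _ tendsto_abs_atTop_atTop)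
  rw [integral_sub i1' i2, integral_neg] at key
  linarith

/-- The vertical slices of the tangential component at height `η`. -/
lemma integral_slice_tangential (m s a b : ℝ) {η : ℝ} (hη : 0 < η) :
    ∫ w in a..b, (s - m * w) * (Real.sqrt (s ^ 2 + (w ^ 2 + η ^ 2)) ^ 3)⁻¹
      = (s * b * ((s ^ 2 + η ^ 2) * Real.sqrt (s ^ 2 + η ^ 2 + b ^ 2))⁻¹
          + m * (Real.sqrt (s ^ 2 + η ^ 2 + b ^ 2))⁻¹)
        - (s * a * ((s ^ 2 + η ^ 2) * Real.sqrt (s ^ 2 + η ^ 2 + a ^ 2))⁻¹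
          + m * (Real.sqrt (s ^ 2 + η ^ 2 + a ^ 2))⁻¹) := by
  have hq : 0 < s ^ 2 + η ^ 2 := by positivity
  have e : ∀ w : ℝ, s ^ 2 + (w ^ 2 + η ^ 2) = w ^ 2 + Real.sqrt (s ^ 2 + η ^ 2) ^ 2 := by
    intro w; rw [Real.sq_sqrt hq.le]; ring
  have e' : ∀ w : ℝ, s ^ 2 + η ^ 2 + w ^ 2 = w ^ 2 + Real.sqrt (s ^ 2 + η ^ 2) ^ 2 := by
    intro w; rw [Real.sq_sqrt hq.le]; ring
  simp_rw [e, e']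
  set q := Real.sqrt (s ^ 2 + η ^ 2) with hqd
  have hq0 : 0 < q := Real.sqrt_pos.2 hq
  have hq2 : s ^ 2 + η ^ 2 = q ^ 2 := (Real.sq_sqrt hq.le).symm
  rw [hq2]
  have hpos : ∀ w : ℝ, 0 < Real.sqrt (w ^ 2 + q ^ 2) := fun w => sqrt_sq_add_pos w hq0.ne'
  refine intervalIntegral.integral_eq_sub_of_hasDerivAt
    (f := fun w => s * w * (q ^ 2 * Real.sqrt (w ^ 2 + q ^ 2))⁻¹
      + m * (Real.sqrt (w ^ 2 + q ^ 2))⁻¹) (fun w _ => ?_) ?_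
  · have hd := hasDerivAt_sqrt_sq_add w hq0.ne'
    have hw := hpos w
    have h4 : Real.sqrt (w ^ 2 + q ^ 2) ^ 2 = w ^ 2 + q ^ 2 := Real.sq_sqrt (by positivity)
    have h1 := (((hasDerivAt_id' w).const_mul s).mul
      ((hd.const_mul (q ^ 2)).inv (by positivity))).add ((hd.inv hw.ne').const_mul m)
    refine h1.congr_deriv ?_
    simp only [Pi.inv_apply, mul_one]
    generalize Real.sqrt (w ^ 2 + q ^ 2) = E at h4 hw ⊢
    field_simp
    linear_combination s * h4
  · refine Continuous.intervalIntegrable ?_ _ _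
    refine Continuous.mul (by fun_prop) (Continuous.inv₀ (by fun_prop) fun w => ?_)
    have := hpos w
    positivity

/-- Each vertical slice runs from the line to the graph and has the primitive of
`integral_slice_tangential`. At the line the term without the slope is odd in `s` and drops out; at
the graph the corresponding term is integrated by parts, which produces the slope at `x₀ - s`. -/
lemma IsProfile.integral_thetaStar_regKernel (hf : IsProfile f M α β C) {h : ℝ}
    (hh : ∀ x, -h < f x) (x₀ : ℝ) {η : ℝ} (hη : 0 < η) :
    ∫ x', thetaStar h f x' * (((2 * Real.pi)⁻¹
      * (Real.sqrt (‖frontPoint f x₀ - x'‖ ^ 2 + η ^ 2) ^ 3)⁻¹)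
      * ((frontPoint f x₀ - x') 0 + deriv f x₀ * (frontPoint f x₀ - x') 1))
      = -∫ s, tangentialIntegrand f x₀ (f x₀ + h) η s := by
  set X := frontPoint f x₀ with hX
  set m := deriv f x₀ with hm
  set H := f x₀ + h with hH
  have hH0 : 0 < H := by have := hh x₀; linarith
  have hI := integrable_thetaStar_smul hf.continuous.measurable hh
    (fun x => (abs_le.1 (hf.bound x)).2) (measurable_regKernel η)
    (integrable_inv_sq_add_sq hη.ne') (norm_regKernel_le_coord η hη.ne') X
  have hI2 := (integrable_plane_apply hI 0).add ((integrable_plane_apply hI 1).const_mul m)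
  have hI3 : Integrable (fun x' => thetaStar h f x' * (((2 * Real.pi)⁻¹
      * (Real.sqrt (‖X - x'‖ ^ 2 + η ^ 2) ^ 3)⁻¹)
      * ((X - x') 0 + m * (X - x') 1))) := by
    refine hI2.congr (ae_of_all _ fun x' => ?_)
    simp [regKernel]; ring
  rw [integral_plane hI3.aestronglyMeasurable]
  have hIp := measurePreserving_ofCoord.integrable_comp_of_integrable hI3
  simp only [Function.comp_def] at hIp
  rw [Measure.volume_eq_prod, integral_prod _ hIp]
  set Q : ℝ → ℝ := fun s => -((s * increment f x₀ s * ((s ^ 2 + η ^ 2)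
            * Real.sqrt (s ^ 2 + η ^ 2 + increment f x₀ s ^ 2))⁻¹
          + m * (Real.sqrt (s ^ 2 + η ^ 2 + increment f x₀ s ^ 2))⁻¹)
        - (s * (-H) * ((s ^ 2 + η ^ 2) * Real.sqrt (s ^ 2 + η ^ 2 + (-H) ^ 2))⁻¹
          + m * (Real.sqrt (s ^ 2 + η ^ 2 + (-H) ^ 2))⁻¹)) with hQ
  have e : ∀ x : ℝ, ∫ y : ℝ, thetaStar h f (ofCoord (x, y)) * (((2 * Real.pi)⁻¹
      * (Real.sqrt (‖X - ofCoord (x, y)‖ ^ 2 + η ^ 2) ^ 3)⁻¹)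
      * ((X - ofCoord (x, y)) 0 + m * (X - ofCoord (x, y)) 1)) = Q (x₀ - x) := by
    intro x
    have e1 : ∀ y : ℝ, thetaStar h f (ofCoord (x, y)) * (((2 * Real.pi)⁻¹
        * (Real.sqrt (‖X - ofCoord (x, y)‖ ^ 2 + η ^ 2) ^ 3)⁻¹)
        * ((X - ofCoord (x, y)) 0 + m * (X - ofCoord (x, y)) 1))
        = (Ioc (-h) (f x)).indicator (fun y => -(((x₀ - x) - m * (y - f x₀))
          * (Real.sqrt ((x₀ - x) ^ 2 + ((y - f x₀) ^ 2 + η ^ 2)) ^ 3)⁻¹)) y := by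
      intro y
      have ht := thetaStar_eq hh (ofCoord (x, y))
      simp only [ofCoord_one, ofCoord_zero] at ht
      rw [plane_norm_sq]
      simp only [ofCoord_one, ofCoord_zero, PiLp.sub_apply]
      simp only [hX, frontPoint, Matrix.cons_val_zero, Matrix.cons_val_one,
        Matrix.cons_val_fin_one]
      by_cases hy : -h < y ∧ y ≤ f x
      · rw [ht.trans (if_pos hy), indicator_of_mem (by exact hy),
          show (x₀ - x) ^ 2 + (f x₀ - y) ^ 2 + η ^ 2 = (x₀ - x) ^ 2 + ((y - f x₀) ^ 2 + η ^ 2) by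
            ring]
        have := Real.pi_ne_zero
        field_simp; ring
      · rw [ht.trans (if_neg hy), indicator_of_notMem (by exact hy), zero_mul]
    simp_rw [e1]
    rw [integral_indicator measurableSet_Ioc, ← intervalIntegral.integral_of_le (hh x).le,
      intervalIntegral.integral_neg,
      intervalIntegral.integral_comp_sub_right (fun w => ((x₀ - x) - m * w)
          * (Real.sqrt ((x₀ - x) ^ 2 + (w ^ 2 + η ^ 2)) ^ 3)⁻¹),
      integral_slice_tangential m (x₀ - x) _ _ hη]
    have h1 : f x - f x₀ = increment f x₀ (x₀ - x) := by simp [increment]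
    have h2 : -h - f x₀ = -H := by rw [hH]; ring
    rw [h1, h2]
  simp_rw [e]
  rw [integral_sub_left_eq_self Q volume x₀]
  simp only [hQ]
  obtain ⟨i1, i2, e2⟩ := hf.integral_increment_by_parts x₀ hη
  have i3 := hf.integrable_tangentialIntegrand x₀ hH0 η
  have i4 : Integrable (fun s : ℝ => s * H * ((s ^ 2 + η ^ 2)
      * Real.sqrt (s ^ 2 + η ^ 2 + H ^ 2))⁻¹) := by
    refine ((integrable_inv_sq_add_sq hη.ne').const_mul H).mono' (by fun_prop)
      (ae_of_all _ fun s => ?_)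
    have hp : 0 < s ^ 2 + η ^ 2 := by positivity
    have hp2 : 0 < Real.sqrt (s ^ 2 + η ^ 2 + H ^ 2) := Real.sqrt_pos.2 (by positivity)
    have h2 : |s| ≤ Real.sqrt (s ^ 2 + η ^ 2 + H ^ 2) :=
      Real.abs_le_sqrt (by linarith [sq_nonneg η, sq_nonneg H])
    rw [norm_mul, norm_mul, Real.norm_eq_abs, Real.norm_of_nonneg hH0.le, Real.norm_of_nonneg
      (by positivity), mul_inv]
    calc _ ≤ Real.sqrt (s ^ 2 + η ^ 2 + H ^ 2) * H * ((s ^ 2 + η ^ 2)⁻¹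
          * (Real.sqrt (s ^ 2 + η ^ 2 + H ^ 2))⁻¹) := by gcongr
      _ = _ := by field_simp
  have e4 : ∫ s : ℝ, s * H * ((s ^ 2 + η ^ 2) * Real.sqrt (s ^ 2 + η ^ 2 + H ^ 2))⁻¹ = 0 :=
    integral_eq_zero_of_odd fun s => by simp
  have e5 : ∀ s : ℝ, -((s * increment f x₀ s * ((s ^ 2 + η ^ 2)
            * Real.sqrt (s ^ 2 + η ^ 2 + increment f x₀ s ^ 2))⁻¹
          + m * (Real.sqrt (s ^ 2 + η ^ 2 + increment f x₀ s ^ 2))⁻¹)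
        - (s * (-H) * ((s ^ 2 + η ^ 2) * Real.sqrt (s ^ 2 + η ^ 2 + (-H) ^ 2))⁻¹
          + m * (Real.sqrt (s ^ 2 + η ^ 2 + (-H) ^ 2))⁻¹))
      = -(tangentialIntegrand f x₀ H η s)
        - (deriv f (x₀ - s) * (Real.sqrt (s ^ 2 + η ^ 2 + increment f x₀ s ^ 2))⁻¹
          + s * increment f x₀ s * ((s ^ 2 + η ^ 2)
            * Real.sqrt (s ^ 2 + η ^ 2 + increment f x₀ s ^ 2))⁻¹)
        - s * H * ((s ^ 2 + η ^ 2) * Real.sqrt (s ^ 2 + η ^ 2 + H ^ 2))⁻¹ := by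
    intro s
    rw [neg_sq, tangentialIntegrand]; ring
  have i3' : Integrable (fun s => -(tangentialIntegrand f x₀ H η s)) := i3.neg
  simp_rw [e5]
  rw [integral_sub _ i4, integral_sub i3', integral_add i1 i2, e2, e4, integral_neg]
  · ring
  · exact i1.add i2
  · exact i3'.sub (i1.add i2)

/-- The normal velocity on the front, as a limit of truncated integrals. -/
theorem IsProfile.tendsto_split_inner (hf : IsProfile f M α β C) {h : ℝ}
    (hh : ∀ x, -h < f x) (x₀ : ℝ) :
    Tendsto (fun ε => inner ℝ (splitVelocityTrunc h f ε (frontPoint f x₀)) (frontNormal f x₀))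
      (𝓝[>] 0) (𝓝 ((Real.sqrt (1 + deriv f x₀ ^ 2))⁻¹
        * (-2 * deriv f x₀ * Real.log (f x₀ + h)
          + ∫ s, tangentialIntegrand f x₀ (f x₀ + h) 0 s))) := by
  set X := frontPoint f x₀ with hX
  set m := deriv f x₀ with hm
  set H := f x₀ + h with hH
  have hH0 : 0 < H := by have := hh x₀; linarith
  -- Two radial regularizations have the same limit: the sharp truncation `l1` defines the principal
  -- value, and the height `η` in `l2` makes it computable.
  have l1 := hf.tendsto_tangential hh x₀ (l := 𝓝[>] (0 : ℝ))
    (c := fun ε r => if ε ≤ r then (2 * Real.pi)⁻¹ * (r ^ 3)⁻¹ else 0)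
    (fun ε => Measurable.ite measurableSet_Ici (by fun_prop) measurable_const)
    (fun ε r hr => by
      split_ifs
      · rw [abs_of_nonneg (by positivity)]
        exact mul_le_of_le_one_left (by positivity) inv_two_pi_le_one
      · simp; positivity)
    (by
      filter_upwards [self_mem_nhdsWithin] with ε (hε : 0 < ε)
      refine ⟨(ε ^ 2)⁻¹, fun r hr => ?_⟩
      split_ifs with h1
      · have hr0 : 0 < r := hε.trans_le h1
        rw [abs_of_nonneg (by positivity)]
        calc (2 * Real.pi)⁻¹ * (r ^ 3)⁻¹ * r ≤ 1 * (r ^ 3)⁻¹ * r := by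
              gcongr; exact inv_two_pi_le_one
          _ = (r ^ 2)⁻¹ := by field_simp
          _ ≤ _ := by gcongr
      · simp; positivity)
    (fun r hr => by
      refine tendsto_const_nhds.congr' ?_
      filter_upwards [Ioc_mem_nhdsGT hr] with ε hε
      rw [if_pos hε.2])
  have l2 := hf.tendsto_tangential hh x₀ (l := 𝓝[>] (0 : ℝ))
    (c := fun η r => (2 * Real.pi)⁻¹ * (Real.sqrt (r ^ 2 + η ^ 2) ^ 3)⁻¹)
    (fun η => by fun_prop)
    (fun η r hr => by
      rw [abs_of_nonneg (by positivity)]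
      calc _ ≤ 1 * (r ^ 3)⁻¹ := by
            gcongr
            · exact inv_two_pi_le_one
            · exact (le_abs_self r).trans (abs_le_sqrt_sq_add r η)
        _ = _ := one_mul _)
    (by
      filter_upwards [self_mem_nhdsWithin] with η (hη : 0 < η)
      refine ⟨(η ^ 2)⁻¹, fun r hr => ?_⟩
      have h0 := sqrt_sq_add_pos r hη.ne'
      have h1 : Real.sqrt (r ^ 2 + η ^ 2) ^ 2 = r ^ 2 + η ^ 2 := Real.sq_sqrt (by positivity)
      rw [abs_of_nonneg (by positivity)]
      calc _ ≤ 1 * (Real.sqrt (r ^ 2 + η ^ 2) ^ 3)⁻¹ * Real.sqrt (r ^ 2 + η ^ 2) := by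
            gcongr
            · exact inv_two_pi_le_one
            · exact (le_abs_self r).trans (abs_le_sqrt_sq_add r η)
        _ = (Real.sqrt (r ^ 2 + η ^ 2) ^ 2)⁻¹ := by field_simp
        _ ≤ _ := by rw [h1]; gcongr; linarith [sq_nonneg r])
    (fun r hr => by
      have hc : ContinuousAt (fun η : ℝ => (2 * Real.pi)⁻¹
          * (Real.sqrt (r ^ 2 + η ^ 2) ^ 3)⁻¹) 0 := by
        refine continuousAt_const.mul (ContinuousAt.inv₀ (by fun_prop) ?_)
        have : 0 < Real.sqrt (r ^ 2 + 0 ^ 2) := Real.sqrt_pos.2 (by positivity)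
        positivity
      have := hc.tendsto.mono_left (nhdsWithin_le_nhds (s := Ioi 0))
      simpa [Real.sqrt_sq hr.le] using this)
  have l3 := (hf.tendsto_tangentialIntegrand x₀ hH0).neg
  have l4 := tendsto_nhds_unique l2 (l3.congr' (by
    filter_upwards [self_mem_nhdsWithin] with η hη
    exact (hf.integral_thetaStar_regKernel hh x₀ hη).symm))
  rw [l4] at l1
  have l5 := ((l1.neg).const_add (-2 * m * Real.log H)).const_mul (Real.sqrt (1 + m ^ 2))⁻¹
  rw [neg_neg] at l5
  refine l5.congr' ?_
  filter_upwards [self_mem_nhdsWithin] with ε (hε : 0 < ε)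
  have hI := integrable_thetaStar_truncKernel hf.continuous.measurable hh
    (fun x => (abs_le.1 (hf.bound x)).2) hε X
  have e1 : ∫ x', thetaStar h f x' * ((if ε ≤ ‖X - x'‖
      then (2 * Real.pi)⁻¹ * (‖X - x'‖ ^ 3)⁻¹ else 0) * ((X - x') 0 + m * (X - x') 1))
      = (rieszTrunc (thetaStar h f) ε X) 0 + m * (rieszTrunc (thetaStar h f) ε X) 1 := by
    rw [rieszTrunc_eq, integral_plane_apply hI, integral_plane_apply hI, ← integral_const_mul,
      ← integral_add (integrable_plane_apply hI 0) ((integrable_plane_apply hI 1).const_mul m)]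
    congr 1; ext1 x'
    simp only [truncKernel]
    split_ifs
    · rw [regKernel_zero, rieszKernel]
      simp; ring
    · simp
  rw [e1]
  have hX1 : X 1 + h = H := by simp [hX, frontPoint, hH]
  have hlog : Real.log |X 1 + h| = Real.log H := by rw [hX1, Real.log_abs]
  -- `perp` is a rotation that takes the tangent `(1, m)` to `(-m, 1)`, so the normal component of
  -- `-perp` is minus the tangential component of the Riesz transform.
  simp only [splitVelocityTrunc, planarVelocity, frontNormal, perp, PiLp.inner_apply,
    Fin.sum_univ_two, hlog]
  simp [← hm]
  ring

end Profile

/-! ### The multiplier `log |∂ₓ|` as a singular integral -/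

lemma one_sub_cos_le_abs (y : ℝ) : 1 - Real.cos y ≤ |y| := by
  rcases le_total |y| 2 with h | h
  · have h1 := Real.one_sub_sq_div_two_le_cos (x := y)
    have h2 : y ^ 2 = |y| * |y| := by rw [← sq_abs]; ring
    nlinarith [abs_nonneg y]
  · linarith [Real.neg_one_le_cos y]

lemma one_sub_cos_nonneg (y : ℝ) : 0 ≤ 1 - Real.cos y := by linarith [Real.cos_le_one y]

lemma abs_one_sub_cos_div_le (a s : ℝ) : |(1 - Real.cos (a * s)) / s| ≤ |a| := by
  rcases eq_or_ne s 0 with rfl | hs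
  · simp
  · rw [abs_div, abs_of_nonneg (one_sub_cos_nonneg _), div_le_iff₀ (abs_pos.2 hs), ← abs_mul]
    exact one_sub_cos_le_abs _

/-- The entire part of the cosine integral. -/
noncomputable def cosIntegral (A : ℝ) : ℝ := ∫ u in (0 : ℝ)..A, (1 - Real.cos u) / u

lemma intervalIntegrable_one_sub_cos_div (a b c : ℝ) :
    IntervalIntegrable (fun s => (1 - Real.cos (a * s)) / s) volume b c := by
  refine (intervalIntegrable_const (c := |a|)).mono_fun' ?_ (ae_of_all _ fun s => ?_)
  · exact Measurable.aestronglyMeasurable (by fun_prop)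
  · exact abs_one_sub_cos_div_le a s

lemma intervalIntegral_one_sub_cos_div (a R : ℝ) :
    ∫ s in (0 : ℝ)..R, (1 - Real.cos (a * s)) / s = cosIntegral (|a| * R) := by
  rcases eq_or_ne a 0 with rfl | ha
  · simp [cosIntegral]
  have ha' : |a| ≠ 0 := abs_ne_zero.2 ha
  have h := intervalIntegral.integral_comp_mul_left
    (fun u => (1 - Real.cos u) / u) ha' (a := 0) (b := R)
  rw [mul_zero, smul_eq_mul] at h
  rw [cosIntegral, ← mul_inv_cancel_left₀ ha' (∫ u in (0 : ℝ)..|a| * R, (1 - Real.cos u) / u),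
    ← h, ← intervalIntegral.integral_const_mul]
  refine intervalIntegral.integral_congr fun s _ => ?_
  have hc : Real.cos (|a| * s) = Real.cos (a * s) := by
    rcases abs_choice a with h | h <;> rw [h]
    rw [neg_mul, Real.cos_neg]
  simp only [hc]
  field_simp

lemma abs_cosIntegral_le (A : ℝ) : |cosIntegral A| ≤ |A| := by
  have := intervalIntegral.norm_integral_le_of_norm_le_const (a := 0) (b := A) (C := 1)
    (f := fun u => (1 - Real.cos u) / u) fun u _ => by
      have := abs_one_sub_cos_div_le 1 u
      rwa [one_mul, abs_one] at this
  simpa [cosIntegral] using this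

lemma hasDerivAt_cosIntegral {A : ℝ} (hA : 0 < A) :
    HasDerivAt cosIntegral ((1 - Real.cos A) / A) A := by
  refine intervalIntegral.integral_hasDerivAt_right ?_ ?_ ?_
  · simpa using intervalIntegrable_one_sub_cos_div 1 0 A
  · exact (Measurable.stronglyMeasurable (by fun_prop)).stronglyMeasurableAtFilter
  · exact ContinuousAt.div (by fun_prop) (by fun_prop) hA.ne'

lemma continuous_cosIntegral : Continuous cosIntegral :=
  intervalIntegral.continuous_primitive
    (fun b c => by simpa using intervalIntegrable_one_sub_cos_div 1 b c) 0

/-- The derivative is `-cos A / A`, not absolutely integrable; adding `sin A / A`, which tends to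
zero, leaves the integrable `-sin A / A²`. -/
lemma exists_tendsto_cosIntegral_sub_log :
    ∃ c, Tendsto (fun A => cosIntegral A - Real.log A) atTop (𝓝 c) := by
  have hint : IntegrableOn (fun A : ℝ => -(Real.sin A / A ^ 2)) (Ioi 1) := by
    refine ((integrableOn_Ioi_rpow_of_lt (by norm_num : (-2 : ℝ) < -1) one_pos)).mono' ?_ ?_
    · exact Measurable.aestronglyMeasurable (by fun_prop)
    · filter_upwards [ae_restrict_mem measurableSet_Ioi] with A (hA : 1 < A)
      have hA0 : 0 < A := by linarith
      rw [norm_neg, norm_div, Real.norm_eq_abs, Real.norm_of_nonneg (by positivity),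
        Real.rpow_neg hA0.le]
      norm_num
      rw [div_eq_mul_inv]
      exact mul_le_of_le_one_left (by positivity) (Real.abs_sin_le_one A)
  have hd : ∀ A ∈ Ioi (1 : ℝ), HasDerivAt
      (fun A => cosIntegral A - Real.log A + Real.sin A / A) (-(Real.sin A / A ^ 2)) A := by
    intro A hA
    have hA0 : (0 : ℝ) < A := by linarith [mem_Ioi.1 hA]
    refine (((hasDerivAt_cosIntegral hA0).sub (Real.hasDerivAt_log hA0.ne')).add
      ((Real.hasDerivAt_sin A).div (hasDerivAt_id' A) hA0.ne')).congr_deriv ?_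
    field_simp
    ring
  refine ⟨_, ((tendsto_limUnder_of_hasDerivAt_of_integrableOn_Ioi hd hint).sub
    (?_ : Tendsto (fun A => Real.sin A / A) atTop (𝓝 0))).congr fun A => by ring⟩
  refine squeeze_zero_norm' (a := fun A : ℝ => 1 / A) ?_ (tendsto_const_nhds.div_atTop tendsto_id)
  filter_upwards [eventually_gt_atTop 0] with A hA
  rw [norm_div, Real.norm_eq_abs, Real.norm_of_nonneg hA.le]
  gcongr
  exact Real.abs_sin_le_one A

/-- A bound independent of `R`, for dominated convergence. If `a R ≥ 1` it follows from the limit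
and continuity; if `a R ≤ 1` then `a ≤ a R ≤ 1`, so `log (a R)` is no larger in absolute value than
`log a`. -/
lemma exists_abs_cosIntegral_sub_log_le :
    ∃ C, ∀ R a : ℝ, 1 ≤ R → 0 < a → |cosIntegral (a * R) - Real.log (a * R)| ≤ C + |Real.log a| := by
  obtain ⟨c, hc⟩ := exists_tendsto_cosIntegral_sub_log
  obtain ⟨N, hN⟩ := eventually_atTop.1 (hc.norm.eventually_lt_const (lt_add_one ‖c‖))
  obtain ⟨B, hB⟩ := (isCompact_Icc (a := (1 : ℝ)) (b := N)).exists_bound_of_continuousOn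
    (f := fun A => cosIntegral A - Real.log A)
    (continuous_cosIntegral.continuousOn.sub (Real.continuousOn_log.mono fun x hx => by
      have : (1 : ℝ) ≤ x := hx.1
      simp; linarith))
  refine ⟨max (max (‖c‖ + 1) B) 1, fun R a hR ha => ?_⟩
  rcases le_total 1 (a * R) with h1 | h1
  · have : |cosIntegral (a * R) - Real.log (a * R)| ≤ max (‖c‖ + 1) B := by
      rcases le_total N (a * R) with h2 | h2
      · exact (hN _ h2).le.trans (le_max_left _ _)
      · exact (hB _ ⟨h1, h2⟩).trans (le_max_right _ _)
    linarith [le_max_left (max (‖c‖ + 1) B) 1, abs_nonneg (Real.log a)]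
  · have h2 : 0 < a * R := by positivity
    have h3 : a ≤ a * R := le_mul_of_one_le_right ha.le hR
    have h4 : |Real.log (a * R)| ≤ |Real.log a| := by
      rw [abs_of_nonpos (Real.log_nonpos h2.le h1), abs_of_nonpos
        (Real.log_nonpos ha.le (h3.trans h1))]
      linarith [Real.log_le_log ha h3]
    have h5 := abs_cosIntegral_le (a * R)
    rw [abs_of_pos h2] at h5
    linarith [abs_sub (cosIntegral (a * R)) (Real.log (a * R)),
      le_max_right (max (‖c‖ + 1) B) 1]

/-- Truncated cosine averages converge to a logarithmic average. -/
lemma tendsto_truncated_cosine {c k : ℝ} (hk : 0 < k)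
    (hc : Tendsto (fun A => cosIntegral A - Real.log A) atTop (𝓝 c)) {W : ℝ → ℂ}
    (hW : Integrable W) (hW1 : Integrable (fun ξ : ℝ => (ξ : ℂ) * W ξ))
    (hlog : Integrable (fun ξ => (Real.log |k * ξ| : ℂ) * W ξ)) :
    Tendsto (fun R : ℝ => (∫ s in (0 : ℝ)..R, ∫ ξ, (((1 - Real.cos (k * ξ * s)) / s : ℝ) : ℂ) * W ξ)
        - Real.log R * ∫ ξ, W ξ) atTop
      (𝓝 (c * (∫ ξ, W ξ) + ∫ ξ, (Real.log |k * ξ| : ℂ) * W ξ)) := by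
  obtain ⟨C, hC⟩ := exists_abs_cosIntegral_sub_log_le
  have hlim : Tendsto (fun R : ℝ => ∫ ξ, ((cosIntegral (|k * ξ| * R) - Real.log R : ℝ) : ℂ) * W ξ)
      atTop (𝓝 (∫ ξ, ((c + Real.log |k * ξ| : ℝ) : ℂ) * W ξ)) := by
    refine tendsto_integral_filter_of_dominated_convergence
      (fun ξ => C * ‖W ξ‖ + 2 * ‖(Real.log |k * ξ| : ℂ) * W ξ‖) ?_ ?_ ?_ ?_
    · refine Eventually.of_forall fun R => AEStronglyMeasurable.mul ?_ hW.aestronglyMeasurable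
      have := continuous_cosIntegral
      exact Continuous.aestronglyMeasurable (by fun_prop)
    · filter_upwards [eventually_ge_atTop 1] with R hR
      filter_upwards [Measure.ae_ne volume 0] with ξ hξ
      have ha : 0 < |k * ξ| := abs_pos.2 (mul_ne_zero hk.ne' hξ)
      have h1 := hC R _ hR ha
      rw [Real.log_mul ha.ne' (by linarith)] at h1
      rw [norm_mul, norm_mul, Complex.norm_real, Complex.norm_real, Real.norm_eq_abs,
        Real.norm_eq_abs, ← mul_assoc, ← add_mul]
      gcongr
      have h2 := abs_add_le (cosIntegral (|k * ξ| * R) - (Real.log |k * ξ| + Real.log R))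
        (Real.log |k * ξ|)
      rw [show cosIntegral (|k * ξ| * R) - (Real.log |k * ξ| + Real.log R) + Real.log |k * ξ|
        = cosIntegral (|k * ξ| * R) - Real.log R by ring] at h2
      linarith
    · exact (hW.norm.const_mul C).add (hlog.norm.const_mul 2)
    · filter_upwards [Measure.ae_ne volume 0] with ξ hξ
      have ha : 0 < |k * ξ| := abs_pos.2 (mul_ne_zero hk.ne' hξ)
      refine Tendsto.mul_const _ ((Complex.continuous_ofReal.tendsto _).comp ?_)
      have h1 := (hc.comp (tendsto_id.const_mul_atTop ha)).add_const (Real.log |k * ξ|)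
      refine h1.congr' ?_
      filter_upwards [eventually_gt_atTop 0] with R hR
      simp only [Function.comp_apply, id]
      rw [Real.log_mul ha.ne' hR.ne']; ring
  have e : ∫ ξ, ((c + Real.log |k * ξ| : ℝ) : ℂ) * W ξ
      = c * (∫ ξ, W ξ) + ∫ ξ, (Real.log |k * ξ| : ℂ) * W ξ := by
    rw [← integral_const_mul, ← integral_add (hW.const_mul _) hlog]
    congr 1; ext1 ξ; push_cast; ring
  rw [← e]
  refine hlim.congr' ?_
  filter_upwards [eventually_gt_atTop 0] with R hR
  -- Fubini on `(0, R]`: the quotient is at most `k |ξ|` even at `s = 0`, because `1 - cos y ≤ |y|`.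
  have hP : Integrable (fun p : ℝ × ℝ => (((1 - Real.cos (k * p.2 * p.1)) / p.1 : ℝ) : ℂ) * W p.2)
      ((volume.restrict (Ioc 0 R)).prod volume) := by
    have h1 : Integrable (fun p : ℝ × ℝ => (k : ℂ) * ((p.2 : ℂ) * W p.2))
        ((volume.restrict (Ioc 0 R)).prod volume) :=
      (integrable_const (k : ℂ) : Integrable (fun _ : ℝ => (k : ℂ))
        (volume.restrict (Ioc 0 R))).mul_prod hW1
    refine h1.norm.mono' ?_ (ae_of_all _ fun p => ?_)
    · refine AEStronglyMeasurable.mul ?_ hW.aestronglyMeasurable.comp_snd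
      exact Measurable.aestronglyMeasurable (by fun_prop)
    · rw [norm_mul, norm_mul, norm_mul, Complex.norm_real, Complex.norm_real, Complex.norm_real,
        ← mul_assoc, ← norm_mul]
      gcongr
      exact abs_one_sub_cos_div_le _ _
  rw [intervalIntegral.integral_of_le hR.le, integral_integral_swap hP, ← integral_const_mul,
    ← integral_sub]
  · congr 1; ext1 ξ
    rw [integral_mul_const, integral_complex_ofReal, ← intervalIntegral.integral_of_le hR.le,
      intervalIntegral_one_sub_cos_div]
    push_cast; ring
  · exact hP.integral_prod_right
  · exact hW.const_mul _

/-- This is `Γ'(1) = -γ`, with the Gamma integral differentiated under the integral sign. -/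
lemma integral_log_mul_exp_neg :
    ∫ t : ℝ in Ioi 0, (Real.log t : ℂ) * (Real.exp (-t) : ℂ) = -Real.eulerMascheroniConstant := by
  have h1 := Complex.hasDerivAt_GammaIntegral (s := 1) (by simp)
  have h2 : HasDerivAt Complex.GammaIntegral (-Real.eulerMascheroniConstant : ℂ) 1 := by
    refine Complex.hasDerivAt_Gamma_one.congr_of_eventuallyEq ?_
    have : {z : ℂ | 0 < z.re} ∈ 𝓝 (1 : ℂ) :=
      (isOpen_lt continuous_const Complex.continuous_re).mem_nhds (by simp)
    filter_upwards [this] with z hz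
    exact (Complex.Gamma_eq_integral hz).symm
  rw [← h1.unique h2]
  simp

lemma integrableOn_log_mul_exp_neg :
    IntegrableOn (fun t : ℝ => (Real.log t : ℂ) * (Real.exp (-t) : ℂ)) (Ioi 0) := by
  -- The integral of a non-integrable function is `0` by convention, whereas this one is `-γ`, and
  -- `γ > 1/2`.
  refine Integrable.of_integral_ne_zero ?_
  rw [integral_log_mul_exp_neg]
  have := Real.one_half_lt_eulerMascheroniConstant
  exact neg_ne_zero.2 (Complex.ofReal_ne_zero.2 (by linarith))

lemma integral_exp_neg_mul_cos (s : ℝ) :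
    ∫ t in Ioi (0 : ℝ), Real.cos (t * s) * Real.exp (-t) = (1 + s ^ 2)⁻¹ := by
  have hre : (-1 + s * Complex.I : ℂ).re < 0 := by simp
  have h := integral_exp_mul_complex_Ioi hre 0
  have hi := integrableOn_exp_mul_complex_Ioi hre 0
  have h2 := congrArg Complex.re h
  rw [← RCLike.re_eq_complex_re, ← integral_re hi] at h2
  simp only [RCLike.re_eq_complex_re] at h2
  have e1 : ∀ t : ℝ, (Complex.exp ((-1 + s * Complex.I) * t)).re
      = Real.cos (t * s) * Real.exp (-t) := by
    intro t
    rw [Complex.exp_re]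
    simp [mul_comm]
  simp_rw [e1] at h2
  rw [h2]
  simp [Complex.div_re, Complex.normSq_apply]
  ring

lemma intervalIntegral_id_div_one_add_sq (R : ℝ) :
    ∫ s in (0 : ℝ)..R, s / (1 + s ^ 2) = Real.log (1 + R ^ 2) / 2 := by
  have h0 : ∀ s : ℝ, 1 + s ^ 2 ≠ 0 := fun s => by positivity
  have := intervalIntegral.integral_eq_sub_of_hasDerivAt (a := 0) (b := R)
    (f := fun s => Real.log (1 + s ^ 2) / 2) (f' := fun s => s / (1 + s ^ 2)) (fun s _ => ?_) ?_
  · rw [this]; simp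
  · refine ((((hasDerivAt_pow 2 s).const_add 1).log (h0 s)).div_const 2).congr_deriv ?_
    have := h0 s
    field_simp
    norm_num
    ring
  · exact (Continuous.div (by fun_prop) (by fun_prop) h0).intervalIntegrable _ _

/-- The constant in the asymptotics of the cosine integral is Euler's constant. -/
theorem tendsto_cosIntegral_sub_log :
    Tendsto (fun A => cosIntegral A - Real.log A) atTop (𝓝 Real.eulerMascheroniConstant) := by
  obtain ⟨c, hc⟩ := exists_tendsto_cosIntegral_sub_log
  suffices c = Real.eulerMascheroniConstant by rwa [← this]
  -- The constant is found from one explicit weight. For `exp (-t)` the cosine average is `s / (1 +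
  -- s²)`, of integral `log (1 + R²) / 2`, which is `log R + o(1)`; the logarithmic average is `-γ`.
  -- Hence `c - γ = 0`.
  set W : ℝ → ℂ := (Ioi 0).indicator fun t => (Real.exp (-t) : ℂ) with hWd
  have hmul : ∀ G : ℝ → ℂ, (fun ξ => G ξ * W ξ)
      = (Ioi 0).indicator fun t => G t * (Real.exp (-t) : ℂ) := by
    intro G; ext1 ξ
    simp only [hWd, indicator]; split_ifs <;> simp
  have hexp : IntegrableOn (fun t : ℝ => Real.exp (-t)) (Ioi 0) := integrableOn_exp_neg_Ioi 0
  have hW : Integrable W := (integrable_indicator_iff measurableSet_Ioi).2 hexp.ofReal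
  have hW1 : Integrable (fun ξ : ℝ => (ξ : ℂ) * W ξ) := by
    rw [hmul, integrable_indicator_iff measurableSet_Ioi]
    have h := (Real.GammaIntegral_convergent (s := 2) (by norm_num)).ofReal (𝕜 := ℂ)
    refine IntegrableOn.congr_fun h (fun t _ => ?_) measurableSet_Ioi
    norm_num
    ring
  have hlogW : (fun ξ : ℝ => (Real.log |1 * ξ| : ℂ) * W ξ)
      = (Ioi 0).indicator fun t => (Real.log t : ℂ) * (Real.exp (-t) : ℂ) := by
    rw [hmul]
    simp [Real.log_abs]
  have hlog : Integrable (fun ξ : ℝ => (Real.log |1 * ξ| : ℂ) * W ξ) := by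
    rw [hlogW, integrable_indicator_iff measurableSet_Ioi]
    exact integrableOn_log_mul_exp_neg
  have hW0 : ∫ ξ, W ξ = 1 := by
    rw [integral_indicator measurableSet_Ioi, integral_complex_ofReal, integral_exp_neg_Ioi_zero]
    simp
  have key := tendsto_truncated_cosine one_pos hc hW hW1 hlog
  have hr : ∫ ξ, (Real.log |1 * ξ| : ℂ) * W ξ = -Real.eulerMascheroniConstant := by
    rw [hlogW, integral_indicator measurableSet_Ioi, integral_log_mul_exp_neg]
  rw [hW0, hr] at key
  have hs : ∀ s : ℝ, ∫ ξ, (((1 - Real.cos (1 * ξ * s)) / s : ℝ) : ℂ) * W ξ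
      = ((s / (1 + s ^ 2) : ℝ) : ℂ) := by
    intro s
    have hcos : IntegrableOn (fun t => Real.cos (t * s) * Real.exp (-t)) (Ioi 0) := by
      refine hexp.mono' (Continuous.aestronglyMeasurable (by fun_prop)) (ae_of_all _ fun t => ?_)
      rw [norm_mul, Real.norm_of_nonneg (Real.exp_pos _).le]
      exact mul_le_of_le_one_left (Real.exp_pos _).le (Real.abs_cos_le_one _)
    rw [hmul, integral_indicator measurableSet_Ioi]
    simp_rw [← Complex.ofReal_mul]
    rw [integral_complex_ofReal]
    congr 1
    have e : ∀ t : ℝ, (1 - Real.cos (1 * t * s)) / s * Real.exp (-t)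
        = s⁻¹ * (Real.exp (-t) - Real.cos (t * s) * Real.exp (-t)) := by
      intro t; rw [one_mul]; ring
    simp_rw [e]
    rw [integral_const_mul, integral_sub hexp hcos, integral_exp_neg_Ioi_zero,
      integral_exp_neg_mul_cos]
    rcases eq_or_ne s 0 with rfl | h0
    · simp
    · have : 1 + s ^ 2 ≠ 0 := by positivity
      field_simp
      ring
  simp_rw [hs] at key
  have key2 : Tendsto (fun R : ℝ => ((Real.log (1 + R⁻¹ ^ 2) / 2 : ℝ) : ℂ)) atTop
      (𝓝 (c * 1 + -Real.eulerMascheroniConstant)) := by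
    refine key.congr' ?_
    filter_upwards [eventually_gt_atTop 0] with R hR
    rw [intervalIntegral.integral_ofReal, intervalIntegral_id_div_one_add_sq, mul_one,
      ← Complex.ofReal_sub]
    congr 1
    have : (1 + R ^ 2) = (1 + R⁻¹ ^ 2) * R ^ 2 := by field_simp; ring
    rw [this, Real.log_mul (by positivity) (by positivity), Real.log_pow]
    push_cast; ring
  have key3 : Tendsto (fun R : ℝ => ((Real.log (1 + R⁻¹ ^ 2) / 2 : ℝ) : ℂ)) atTop (𝓝 0) := by
    have h1 : ContinuousAt (fun y : ℝ => ((Real.log (1 + y ^ 2) / 2 : ℝ) : ℂ)) 0 := by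
      refine Complex.continuous_ofReal.continuousAt.comp
        (ContinuousAt.div_const (ContinuousAt.log (by fun_prop) (by norm_num)) _)
    have := h1.tendsto.comp tendsto_inv_atTop_zero
    simpa [Function.comp_def] using this
  have h := tendsto_nhds_unique key2 key3
  rw [mul_one, add_neg_eq_zero] at h
  exact_mod_cast h

/-! ### The singular integral formula on Schwartz functions -/

/-- The integrand of the singular integral that represents `log |∂ₓ|`. -/
noncomputable def logKernelIntegrand {E : Type*} [NormedAddCommGroup E] [NormedSpace ℝ E]
    (g : ℝ → E) (x s : ℝ) : E :=
  s⁻¹ • ((if s < 1 then g x else 0) - (2 : ℝ)⁻¹ • (g (x + s) + g (x - s)))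

lemma integrable_log_mul_schwartz (χ : 𝓢(ℝ, ℂ)) {k : ℝ} (hk : 0 < k) :
    Integrable (fun ξ : ℝ => (Real.log |k * ξ| : ℂ) * χ ξ) := by
  have h1 : Integrable ((Icc (-1 : ℝ) 1).indicator fun ξ : ℝ => (Real.log ξ : ℂ) * χ ξ) := by
    rw [integrable_indicator_iff measurableSet_Icc]
    have h2 : IntegrableOn (fun ξ : ℝ => (Real.log ξ : ℂ)) (Icc (-1) 1) := by
      have := (intervalIntegral.intervalIntegrable_log' (a := -1) (b := 1)).1
      rw [← integrableOn_Icc_iff_integrableOn_Ioc] at this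
      exact this.ofReal
    exact h2.mul_continuousOn χ.continuous.continuousOn isCompact_Icc
  have h3 := χ.integrable_pow_mul volume 1
  refine ((h1.norm.add h3).add (χ.integrable.norm.const_mul |Real.log k|)).mono' ?_ ?_
  · exact (Measurable.aestronglyMeasurable (by fun_prop)).mul χ.continuous.aestronglyMeasurable
  · filter_upwards [Measure.ae_ne volume 0] with ξ hξ
    rw [Real.log_abs, Real.log_mul hk.ne' hξ, norm_mul, Complex.norm_real, Real.norm_eq_abs]
    have h4 : |Real.log ξ| * ‖χ ξ‖ ≤ ‖(Icc (-1 : ℝ) 1).indicator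
        (fun ξ : ℝ => (Real.log ξ : ℂ) * χ ξ) ξ‖ + ‖ξ‖ ^ 1 * ‖χ ξ‖ := by
      by_cases hm : ξ ∈ Icc (-1 : ℝ) 1
      · rw [indicator_of_mem hm, norm_mul, Complex.norm_real, Real.norm_eq_abs]
        have : 0 ≤ ‖ξ‖ ^ 1 * ‖χ ξ‖ := by positivity
        linarith
      · have h5 : 1 ≤ |ξ| := by
          by_contra h
          exact hm (abs_le.1 (not_le.1 h).le)
        rw [indicator_of_notMem hm, norm_zero, zero_add, pow_one, Real.norm_eq_abs]
        have h6 : |Real.log ξ| ≤ |ξ| := by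
          rw [← Real.log_abs ξ, abs_of_nonneg (Real.log_nonneg h5)]
          exact Real.log_le_self (abs_nonneg _)
        gcongr
    calc _ ≤ (|Real.log k| + |Real.log ξ|) * ‖χ ξ‖ := by gcongr; exact abs_add_le _ _
      _ = |Real.log ξ| * ‖χ ξ‖ + |Real.log k| * ‖χ ξ‖ := by ring
      _ ≤ _ := by
        simp only [Pi.add_apply]
        gcongr

lemma intervalIntegral_indicator_inv {R : ℝ} (hR : 1 ≤ R) :
    IntervalIntegrable ((Ici (1 : ℝ)).indicator fun s => s⁻¹) volume 0 R ∧
      ∫ s in (0 : ℝ)..R, (Ici (1 : ℝ)).indicator (fun s => s⁻¹) s = Real.log R := by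
  have h0 : (0 : ℝ) ≤ R := by linarith
  have hset : Ioc 0 R ∩ Ici (1 : ℝ) = Icc 1 R := by
    ext s
    simp only [mem_inter_iff, mem_Ioc, mem_Ici, mem_Icc]
    constructor
    · rintro ⟨⟨_, h2⟩, h3⟩; exact ⟨h3, h2⟩
    · rintro ⟨h1, h2⟩; exact ⟨⟨by linarith, h2⟩, h1⟩
  have h1 : IntervalIntegrable (fun s : ℝ => s⁻¹) volume 1 R :=
    intervalIntegral.intervalIntegrable_inv (fun s hs => by
      rw [uIcc_of_le hR] at hs
      linarith [hs.1] |> fun h : 0 < s => h.ne') continuousOn_id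
  constructor
  · rw [intervalIntegrable_iff_integrableOn_Ioc_of_le h0, IntegrableOn,
      integrable_indicator_iff measurableSet_Ici, IntegrableOn,
      Measure.restrict_restrict measurableSet_Ici, inter_comm, hset]
    exact (integrableOn_Icc_iff_integrableOn_Ioc).2
      ((intervalIntegrable_iff_integrableOn_Ioc_of_le hR).1 h1)
  · rw [intervalIntegral.integral_of_le h0, setIntegral_indicator measurableSet_Ici, hset,
      integral_Icc_eq_integral_Ioc, ← intervalIntegral.integral_of_le hR,
      integral_inv_of_pos one_pos (by linarith), div_one]

/-- By Fourier inversion, the symmetric difference quotient at distance `s` has the symbol `(1 - cos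
(2π ξ s)) / s`. Its integral over `(0, R)` is `log R + γ + log |2π ξ| + o(1)`, and the indicator in
`logKernelIntegrand` removes exactly `log R`. -/
theorem logAbsDerivSchwartz_eq (ψ : 𝓢(ℝ, ℂ)) (x : ℝ)
    (hJ : IntegrableOn (logKernelIntegrand ψ x) (Ioi 0)) :
    logAbsDerivSchwartz ψ x
      = -Real.eulerMascheroniConstant * ψ x + ∫ s in Ioi 0, logKernelIntegrand ψ x s := by
  set χ : 𝓢(ℝ, ℂ) := 𝓕 ψ with hχ
  have hχ' : ∀ ξ, 𝓕 (ψ : ℝ → ℂ) ξ = χ ξ := fun ξ => by rw [hχ, SchwartzMap.fourier_coe]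
  set e : ℝ → ℝ → ℂ := fun y ξ => Complex.exp (((2 * Real.pi * ξ * y : ℝ) : ℂ) * Complex.I) with he
  have hen : ∀ y ξ, ‖e y ξ‖ = 1 := fun y ξ => Complex.norm_exp_ofReal_mul_I _
  have hec : ∀ y, Continuous (e y) := fun y => by fun_prop
  have hmul : ∀ y {G : ℝ → ℂ}, Integrable G → Integrable (fun ξ => e y ξ * G ξ) := by
    intro y G hG
    refine hG.norm.mono' ((hec y).aestronglyMeasurable.mul hG.aestronglyMeasurable)
      (ae_of_all _ fun ξ => ?_)
    rw [norm_mul, hen, one_mul]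
  have hinv : ∀ y, ∫ ξ, e y ξ * χ ξ = ψ y := by
    intro y
    have h1 : 𝓕⁻ (𝓕 ψ) = ψ := FourierTransform.fourierInv_fourier_eq ψ
    conv_rhs => rw [← h1, SchwartzMap.fourierInv_coe, Real.fourierInv_eq']
    congr 1; ext1 ξ
    simp [he, hχ, mul_assoc, mul_comm]
  have hlog := integrable_log_mul_schwartz χ Real.two_pi_pos
  have hξ : Integrable (fun ξ : ℝ => (ξ : ℂ) * χ ξ) := by
    refine (χ.integrable_pow_mul volume 1).mono' (Continuous.aestronglyMeasurable
      (by have := χ.continuous; fun_prop)) (ae_of_all _ fun ξ => ?_)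
    simp
  have key := tendsto_truncated_cosine Real.two_pi_pos tendsto_cosIntegral_sub_log
    (W := fun ξ => e x ξ * χ ξ) (hmul x χ.integrable)
    ((hmul x hξ).congr (ae_of_all _ fun ξ => by ring))
    ((hmul x hlog).congr (ae_of_all _ fun ξ => by ring))
  have hval : ∫ ξ, (Real.log |2 * Real.pi * ξ| : ℂ) * (e x ξ * χ ξ) = logAbsDerivSchwartz ψ x := by
    rw [logAbsDerivSchwartz, Real.fourierInv_eq']
    congr 1; ext1 ξ
    simp [he, hχ', mul_assoc, mul_comm, mul_left_comm]
  rw [hinv, hval] at key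
  have hs : ∀ s : ℝ, ∫ ξ, (((1 - Real.cos (2 * Real.pi * ξ * s)) / s : ℝ) : ℂ) * (e x ξ * χ ξ)
      = (s⁻¹ : ℝ) • (ψ x - (2 : ℝ)⁻¹ • (ψ (x + s) + ψ (x - s))) := by
    intro s
    have e1 : ∀ ξ : ℝ, (((1 - Real.cos (2 * Real.pi * ξ * s)) / s : ℝ) : ℂ) * (e x ξ * χ ξ)
        = (s⁻¹ : ℂ) * (e x ξ * χ ξ - 2⁻¹ * (e (x + s) ξ * χ ξ + e (x - s) ξ * χ ξ)) := by
      intro ξ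
      have e2 : e (x + s) ξ = e x ξ * Complex.exp (((2 * Real.pi * ξ * s : ℝ) : ℂ) * Complex.I) := by
        rw [he, ← Complex.exp_add]; push_cast; ring_nf
      have e3 : e (x - s) ξ
          = e x ξ * Complex.exp (-((2 * Real.pi * ξ * s : ℝ) : ℂ) * Complex.I) := by
        rw [he, ← Complex.exp_add]; push_cast; ring_nf
      rw [e2, e3]
      push_cast
      rw [Complex.cos]
      ring
    simp_rw [e1]
    have i1 : Integrable (fun ξ => e (x + s) ξ * χ ξ + e (x - s) ξ * χ ξ) :=
      (hmul (x + s) χ.integrable).add (hmul (x - s) χ.integrable)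
    rw [integral_const_mul, integral_sub (hmul x χ.integrable) (i1.const_mul _),
      integral_const_mul, integral_add (hmul (x + s) χ.integrable) (hmul (x - s) χ.integrable),
      hinv, hinv, hinv]
    simp only [Complex.real_smul]
    push_cast; ring
  simp_rw [hs] at key
  have lim := intervalIntegral_tendsto_integral_Ioi 0 hJ tendsto_id
  have heq := tendsto_nhds_unique (key.congr' ?_) lim
  · rw [← heq]; ring
  · filter_upwards [eventually_ge_atTop 1] with R hR
    have hJR : IntervalIntegrable (logKernelIntegrand ψ x) volume 0 R := by
      rw [intervalIntegrable_iff_integrableOn_Ioc_of_le (by linarith)]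
      exact hJ.mono_set Ioc_subset_Ioi_self
    obtain ⟨k1, k2⟩ := intervalIntegral_indicator_inv hR
    have k3 : IntervalIntegrable (fun s => (((Ici (1 : ℝ)).indicator (fun s => s⁻¹) s : ℝ) : ℂ) * ψ x)
        volume 0 R := (IntervalIntegrable.mul_const ⟨k1.1.ofReal, k1.2.ofReal⟩ _)
    have e4 : ∀ s : ℝ, (s⁻¹ : ℝ) • (ψ x - (2 : ℝ)⁻¹ • (ψ (x + s) + ψ (x - s)))
        = logKernelIntegrand ψ x s
          + (((Ici (1 : ℝ)).indicator (fun s => s⁻¹) s : ℝ) : ℂ) * ψ x := by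
      intro s
      rcases lt_or_ge s 1 with h | h
      · rw [indicator_of_notMem (by simpa using h), logKernelIntegrand, if_pos h]; simp
      · rw [indicator_of_mem (by exact h), logKernelIntegrand, if_neg (not_lt.2 h)]
        simp only [Complex.real_smul]
        push_cast; ring
    simp_rw [e4]
    rw [intervalIntegral.integral_add hJR k3, intervalIntegral.integral_mul_const,
      intervalIntegral.integral_ofReal, k2]
    simp

lemma domKernel_neg (α β s : ℝ) : domKernel α β (-s) = domKernel α β s := by
  unfold domKernel
  have : -s ∈ Icc (-1 : ℝ) 1 ↔ s ∈ Icc (-1 : ℝ) 1 := by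
    simp only [mem_Icc]; constructor <;> rintro ⟨h1, h2⟩ <;> constructor <;> linarith
  simp only [indicator, this, abs_neg]

section LogKernel

variable {E : Type*} [NormedAddCommGroup E] [NormedSpace ℝ E] {α β C : ℝ} {g : ℝ → E}

/-- For `s < 1` the differences are Hölder small; for `s ≥ 1` nothing is subtracted and the decay of
`g` takes over. -/
lemma HolderDecay.norm_logKernelIntegrand_le (hg : HolderDecay α β C g) (x : ℝ) {s : ℝ}
    (hs : 0 < s) :
    ‖logKernelIntegrand g x s‖ ≤ 2 * C * (1 + |x|) ^ β * domKernel α β s := by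
  have hC := hg.const_nonneg
  have hD := domKernel_nonneg α β s
  have hs' : |s| = s := abs_of_pos hs
  have hx : 1 ≤ (1 + |x|) ^ β :=
    Real.one_le_rpow (by linarith [abs_nonneg x]) hg.beta_pos.le
  rw [logKernelIntegrand, norm_smul, norm_inv, Real.norm_of_nonneg hs.le]
  rcases lt_or_ge s 1 with h | h
  · rw [if_pos h]
    have h1 := hg.holder x (x + s)
    have h2 := hg.holder x (x - s)
    rw [sub_add_cancel_left, abs_neg, hs'] at h1
    rw [sub_sub_cancel, hs'] at h2
    have h3 : g x - (2 : ℝ)⁻¹ • (g (x + s) + g (x - s))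
        = (2 : ℝ)⁻¹ • ((g x - g (x + s)) + (g x - g (x - s))) := by
      rw [show (g x - g (x + s)) + (g x - g (x - s)) = (2 : ℝ) • g x - (g (x + s) + g (x - s)) by
        rw [two_smul]; abel, smul_sub, smul_smul]
      norm_num
    have h4 : ‖g x - (2 : ℝ)⁻¹ • (g (x + s) + g (x - s))‖ ≤ C * s ^ α := by
      rw [h3, norm_smul]
      have := norm_add_le (g x - g (x + s)) (g x - g (x - s))
      norm_num
      linarith
    have h5 := rpow_le_domKernel (α := α) β (s := s) (by rw [hs']; exact h.le)
    rw [hs', Real.rpow_sub_one hs.ne'] at h5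
    calc _ ≤ s⁻¹ * (C * s ^ α) := by gcongr
      _ = C * (s ^ α / s) := by ring
      _ ≤ C * domKernel α β s := by gcongr
      _ = C * 1 * domKernel α β s := by ring
      _ ≤ (2 * C) * (1 + |x|) ^ β * domKernel α β s := by gcongr; linarith
  · rw [if_neg (not_lt.2 h), zero_sub, norm_neg, norm_smul]
    have h1 := hg.far_le x (s := s) (by rwa [hs'])
    have h2 := hg.far_le x (s := -s) (by rwa [abs_neg, hs'])
    rw [sub_neg_eq_add, abs_neg, hs', domKernel_neg] at h2
    rw [hs'] at h1
    have h3 := norm_add_le (g (x + s)) (g (x - s))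
    have h4 : ‖(2 : ℝ)⁻¹‖ = 2⁻¹ := by norm_num
    rw [h4]
    calc _ ≤ s⁻¹ * (2⁻¹ * (‖g (x + s)‖ + ‖g (x - s)‖)) := by gcongr
      _ = 2⁻¹ * (‖g (x + s)‖ / s + ‖g (x - s)‖ / s) := by ring
      _ ≤ _ := by linarith

lemma measurable_logKernelIntegrand {g : ℝ → ℂ} (hg : Continuous g) :
    Measurable (fun p : ℝ × ℝ => logKernelIntegrand g p.2 p.1) := by
  simp only [logKernelIntegrand, Complex.real_smul]
  refine Measurable.mul (by fun_prop) (Measurable.sub ?_ (by fun_prop))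
  exact Measurable.ite (measurableSet_lt (by fun_prop) measurable_const) (by fun_prop)
    measurable_const

end LogKernel

/-- The singular integral that represents `log |∂ₓ| g`. -/
noncomputable def logAbsDerivIntegral {E : Type*} [NormedAddCommGroup E] [NormedSpace ℝ E]
    (g : ℝ → E) (x : ℝ) : E :=
  -Real.eulerMascheroniConstant • g x + ∫ s in Ioi 0, logKernelIntegrand g x s

/-! ### Duality of the singular integral with Schwartz functions -/

section Duality

variable {α β C : ℝ} {g : ℝ → ℂ}

lemma HolderDecay.integrableOn_logKernelIntegrand (hg : HolderDecay α β C g) (x : ℝ) :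
    IntegrableOn (logKernelIntegrand g x) (Ioi 0) := by
  refine ((integrable_domKernel hg.alpha_pos hg.beta_pos).integrableOn.const_mul
    (2 * C * (1 + |x|) ^ β)).mono' ?_ ?_
  · exact ((measurable_logKernelIntegrand hg.continuous).comp
      (measurable_id.prodMk measurable_const)).aestronglyMeasurable
  · filter_upwards [ae_restrict_mem measurableSet_Ioi] with s hs
    exact hg.norm_logKernelIntegrand_le x hs

lemma HolderDecay.continuous_logAbsDerivIntegral (hg : HolderDecay α β C g) :
    Continuous (logAbsDerivIntegral g) := by
  have hgc := hg.continuous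
  refine (hgc.const_smul _).add (continuous_iff_continuousAt.2 fun x₀ => ?_)
  have hC := hg.const_nonneg
  have hβ := hg.beta_pos
  refine continuousAt_of_dominated (bound := fun s => 2 * C * (2 + |x₀|) ^ β * domKernel α β s)
    (Eventually.of_forall fun x => (hg.integrableOn_logKernelIntegrand x).aestronglyMeasurable)
    ?_ ((integrable_domKernel hg.alpha_pos hg.beta_pos).integrableOn.const_mul _) ?_
  · filter_upwards [Metric.ball_mem_nhds x₀ one_pos] with x hx
    filter_upwards [ae_restrict_mem measurableSet_Ioi] with s hs
    refine (hg.norm_logKernelIntegrand_le x hs).trans ?_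
    have hD := domKernel_nonneg α β s
    have h1 : |x| ≤ 1 + |x₀| := by
      rw [Metric.mem_ball, Real.dist_eq] at hx
      linarith [abs_sub_abs_le_abs_sub x x₀]
    have h2 : 1 + |x| ≤ 2 + |x₀| := by linarith
    gcongr
  · refine ae_of_all _ fun s => ?_
    unfold logKernelIntegrand
    refine ContinuousAt.const_smul (ContinuousAt.sub ?_ (by fun_prop)) _
    split_ifs <;> fun_prop

lemma exists_schwartz_decay (ψ : 𝓢(ℝ, ℂ)) (k : ℕ) :
    ∃ C, 0 ≤ C ∧ ∀ x, ‖ψ x‖ ≤ C * ((1 + |x|) ^ k)⁻¹ := by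
  refine ⟨2 ^ (k, 0).1 * (Finset.Iic (k, 0)).sup (fun m => SchwartzMap.seminorm ℂ m.1 m.2) ψ,
    by positivity, fun x => ?_⟩
  have h := SchwartzMap.one_add_le_sup_seminorm_apply (𝕜 := ℂ) (m := (k, 0)) le_rfl le_rfl ψ x
  rw [norm_iteratedFDeriv_zero, Real.norm_eq_abs, mul_comm] at h
  rw [← div_eq_mul_inv, le_div_iff₀ (by positivity)]
  exact h

lemma norm_schwartz_sub_le (ψ : 𝓢(ℝ, ℂ)) (k : ℕ) :
    ∃ C, 0 ≤ C ∧ ∀ x y, |x - y| ≤ 1 → ‖ψ x - ψ y‖ ≤ C * ((1 + |x|) ^ k)⁻¹ * |x - y| := by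
  obtain ⟨C, hC, h⟩ := exists_schwartz_decay (SchwartzMap.derivCLM ℂ ℂ ψ) k
  refine ⟨C * 2 ^ k, by positivity, fun x y hxy => ?_⟩
  refine Convex.norm_image_sub_le_of_norm_deriv_le (s := Metric.closedBall x 1) (f := ψ)
    (fun z _ => ψ.differentiableAt) (fun z hz => ?_) (convex_closedBall x 1) ?_ ?_
  · have h1 := h z
    rw [SchwartzMap.derivCLM_apply] at h1
    refine h1.trans ?_
    rw [mul_assoc]
    gcongr
    rw [← div_eq_mul_inv, inv_eq_one_div, div_le_div_iff₀ (by positivity) (by positivity), one_mul,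
      ← mul_pow]
    gcongr
    rw [Metric.mem_closedBall, Real.dist_eq] at hz
    linarith [abs_sub_abs_le_abs_sub x z, abs_sub_comm x z, abs_nonneg z]
  · rw [Metric.mem_closedBall, Real.dist_eq, abs_sub_comm]; exact hxy
  · exact Metric.mem_closedBall_self zero_le_one

lemma exists_holderDecay_schwartz (ψ : 𝓢(ℝ, ℂ)) : ∃ C, HolderDecay 1 1 C ψ := by
  obtain ⟨C₁, hC₁, h₁⟩ := exists_schwartz_decay ψ 1
  obtain ⟨C₂, hC₂, h₂⟩ := exists_schwartz_decay (SchwartzMap.derivCLM ℂ ℂ ψ) 0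
  refine ⟨C₁ + C₂, one_pos, one_pos, le_rfl, by positivity, fun x y => ?_, fun x => ?_⟩
  · have := Convex.norm_image_sub_le_of_norm_deriv_le (s := univ) (f := ψ) (C := C₂)
      (fun z _ => ψ.differentiableAt) (fun z _ => by simpa using h₂ z) convex_univ
      (mem_univ y) (mem_univ x)
    rw [Real.rpow_one]
    refine this.trans ?_
    rw [Real.norm_eq_abs]
    gcongr
    linarith
  · rw [Real.rpow_neg (by positivity), Real.rpow_one]
    have := h₁ x
    rw [pow_one] at this
    refine this.trans ?_
    gcongr
    linarith

lemma integrable_inv_one_add_abs_sq : Integrable (fun x : ℝ => ((1 + |x|) ^ 2)⁻¹) := by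
  have := integrable_one_add_norm (E := ℝ) (μ := volume) (r := 2) (by simp)
  refine this.congr (ae_of_all _ fun x => ?_)
  simp only [Real.norm_eq_abs]
  rw [Real.rpow_neg (by positivity)]
  norm_num

lemma integrable_rpow_mul_schwartz (ψ : 𝓢(ℝ, ℂ)) (hβ : β ≤ 1) :
    Integrable (fun x => (1 + |x|) ^ β * ‖ψ x‖) := by
  obtain ⟨C, hC, h⟩ := exists_schwartz_decay ψ 3
  refine (integrable_inv_one_add_abs_sq.const_mul C).mono' ?_ (ae_of_all _ fun x => ?_)
  · exact (Measurable.aestronglyMeasurable (by fun_prop)).mul ψ.continuous.norm.aestronglyMeasurable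
  · rw [Real.norm_of_nonneg (by positivity)]
    calc _ ≤ (1 + |x|) ^ (1 : ℝ) * (C * ((1 + |x|) ^ 3)⁻¹) := by
          gcongr
          · linarith [abs_nonneg x]
          · exact h x
      _ = _ := by rw [Real.rpow_one]; field_simp

/-- For fixed `s` the operator combines the identity and the translations by `s` and `-s`, which are
adjoint to each other. -/
lemma integral_logKernelIntegrand_mul {s : ℝ} (hg : HolderDecay α β C g) (ψ : 𝓢(ℝ, ℂ)) :
    ∫ x, logKernelIntegrand g x s * ψ x = ∫ x, g x * logKernelIntegrand ψ x s := by
  have hgc := hg.continuous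
  have hi : ∀ a b : ℝ, Integrable (fun x => g (x + a) * ψ (x + b)) := fun a b => by
    refine ((ψ.integrable.comp_add_right b).norm.const_mul C).mono'
      (Continuous.aestronglyMeasurable (by have := ψ.continuous; fun_prop))
      (ae_of_all _ fun x => ?_)
    rw [norm_mul]
    gcongr
    exact hg.bound _
  have hi2 : ∀ a b c d : ℝ, Integrable (fun x => g (x + a) * ψ (x + b) + g (x + c) * ψ (x + d)) :=
    fun a b c d => (hi a b).add (hi c d)
  have hi' : ∀ a b : ℝ, ∫ x, g (x + a) * ψ (x + b) = ∫ x, g (x + (a - b)) * ψ (x + 0) := by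
    intro a b
    rw [← integral_add_right_eq_self (fun x => g (x + (a - b)) * ψ (x + 0)) b]
    congr 1; ext1 x
    rw [add_zero, show x + b + (a - b) = x + a by ring]
  have e1 : ∀ x, logKernelIntegrand g x s * ψ x = (s⁻¹ : ℝ) * ((if s < 1 then 1 else 0)
      * (g (x + 0) * ψ (x + 0)) - 2⁻¹ * (g (x + s) * ψ (x + 0) + g (x + (-s)) * ψ (x + 0))) := by
    intro x
    rw [logKernelIntegrand]
    simp only [Complex.real_smul, add_zero, ← sub_eq_add_neg]
    split_ifs <;> push_cast <;> ring
  have e2 : ∀ x, g x * logKernelIntegrand ψ x s = (s⁻¹ : ℝ) * ((if s < 1 then 1 else 0)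
      * (g (x + 0) * ψ (x + 0)) - 2⁻¹ * (g (x + 0) * ψ (x + s) + g (x + 0) * ψ (x + (-s)))) := by
    intro x
    rw [logKernelIntegrand]
    simp only [Complex.real_smul, add_zero, ← sub_eq_add_neg]
    split_ifs <;> push_cast <;> ring
  simp_rw [e1, e2]
  rw [integral_const_mul, integral_const_mul,
    integral_sub ((hi 0 0).const_mul _) ((hi2 s 0 (-s) 0).const_mul _),
    integral_sub ((hi 0 0).const_mul _) ((hi2 0 s 0 (-s)).const_mul _),
    integral_const_mul, integral_const_mul, integral_const_mul, integral_add (hi s 0) (hi (-s) 0),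
    integral_add (hi 0 s) (hi 0 (-s)), hi' 0 s, hi' 0 (-s), zero_sub, zero_sub, neg_neg,
    add_comm (∫ x, g (x + s) * ψ (x + 0))]

lemma HolderDecay.integrable_logKernelIntegrand_mul (hg : HolderDecay α β C g) (ψ : 𝓢(ℝ, ℂ)) :
    Integrable (fun p : ℝ × ℝ => logKernelIntegrand g p.2 p.1 * ψ p.2)
      ((volume.restrict (Ioi 0)).prod volume) := by
  have h1 : Integrable (fun p : ℝ × ℝ => domKernel α β p.1 * (2 * C * ((1 + |p.2|) ^ β * ‖ψ p.2‖)))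
      ((volume.restrict (Ioi 0)).prod volume) :=
    (integrable_domKernel hg.alpha_pos hg.beta_pos).integrableOn.mul_prod
      ((integrable_rpow_mul_schwartz ψ hg.beta_le).const_mul (2 * C))
  refine h1.mono' ?_ ?_
  · exact (measurable_logKernelIntegrand hg.continuous).aestronglyMeasurable.mul
      ψ.continuous.aestronglyMeasurable.comp_snd
  · have : ∀ᵐ p : ℝ × ℝ ∂((volume.restrict (Ioi 0)).prod volume), p.1 ∈ Ioi (0 : ℝ) :=
      Measure.quasiMeasurePreserving_fst.ae (ae_restrict_mem measurableSet_Ioi)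
    filter_upwards [this] with p hp
    rw [norm_mul]
    calc _ ≤ 2 * C * (1 + |p.2|) ^ β * domKernel α β p.1 * ‖ψ p.2‖ := by
          gcongr; exact hg.norm_logKernelIntegrand_le _ hp
      _ = _ := by ring

/-- The integrability at large `s` is taken from the decay of `g`, but here the shift sits on `ψ`.
It is moved to `g` by a translation inside the integral over `x`, so Tonelli is verified slice by
slice instead of by a pointwise bound. -/
lemma HolderDecay.integrable_mul_logKernelIntegrand (hg : HolderDecay α β C g) (ψ : 𝓢(ℝ, ℂ)) :
    Integrable (fun p : ℝ × ℝ => g p.2 * logKernelIntegrand ψ p.2 p.1)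
      ((volume.restrict (Ioi 0)).prod volume) := by
  have hC := hg.const_nonneg
  have hgc := hg.continuous
  obtain ⟨C₂, hC₂, h₂⟩ := norm_schwartz_sub_le ψ 2
  have hmeas : AEStronglyMeasurable (fun p : ℝ × ℝ => g p.2 * logKernelIntegrand ψ p.2 p.1)
      ((volume.restrict (Ioi 0)).prod volume) :=
    ((hgc.comp continuous_snd).measurable.mul
      (measurable_logKernelIntegrand ψ.continuous)).aestronglyMeasurable
  have hgi : ∀ a b : ℝ, Integrable (fun x => ‖g (x + a)‖ * ‖ψ (x + b)‖) := fun a b => by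
    refine ((ψ.integrable.comp_add_right b).norm.const_mul C).mono'
      (Continuous.aestronglyMeasurable (by have := ψ.continuous; fun_prop))
      (ae_of_all _ fun x => ?_)
    rw [norm_mul, norm_norm, norm_norm]
    gcongr
    exact hg.bound _
  have hnear : ∀ s : ℝ, 0 < s → s < 1 → ∀ x, ‖g x * logKernelIntegrand ψ x s‖
      ≤ C * C₂ * ((1 + |x|) ^ 2)⁻¹ := by
    intro s hs hs1 x
    have h1 := h₂ x (x + s) (by rw [sub_add_cancel_left, abs_neg, abs_of_pos hs]; exact hs1.le)
    have h2 := h₂ x (x - s) (by rw [sub_sub_cancel, abs_of_pos hs]; exact hs1.le)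
    rw [sub_add_cancel_left, abs_neg, abs_of_pos hs] at h1
    rw [sub_sub_cancel, abs_of_pos hs] at h2
    have h3 : logKernelIntegrand ψ x s
        = (s⁻¹ : ℝ) * 2⁻¹ * ((ψ x - ψ (x + s)) + (ψ x - ψ (x - s))) := by
      rw [logKernelIntegrand, if_pos hs1]
      simp only [Complex.real_smul]; push_cast; ring
    have h4 := norm_add_le (ψ x - ψ (x + s)) (ψ x - ψ (x - s))
    rw [norm_mul, h3, norm_mul, norm_mul, Complex.norm_real, Real.norm_of_nonneg (by positivity)]
    have h5 : ‖(2 : ℂ)⁻¹‖ = 2⁻¹ := by norm_num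
    rw [h5, mul_assoc C]
    refine mul_le_mul (hg.bound x) ?_ (by positivity) hC
    calc _ ≤ s⁻¹ * 2⁻¹ * (C₂ * ((1 + |x|) ^ 2)⁻¹ * s + C₂ * ((1 + |x|) ^ 2)⁻¹ * s) := by
          gcongr; linarith
      _ = s⁻¹ * s * (C₂ * ((1 + |x|) ^ 2)⁻¹) := by ring
      _ = _ := by rw [inv_mul_cancel₀ hs.ne', one_mul]
  have hfar : ∀ s : ℝ, 1 ≤ s → ∀ x, ‖g x * logKernelIntegrand ψ x s‖
      ≤ s⁻¹ * 2⁻¹ * (‖g (x + 0)‖ * ‖ψ (x + s)‖ + ‖g (x + 0)‖ * ‖ψ (x + (-s))‖) := by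
    intro s hs x
    have hs0 : 0 < s := by linarith
    have h3 : logKernelIntegrand ψ x s = -((s⁻¹ : ℝ) * 2⁻¹ * (ψ (x + s) + ψ (x + (-s)))) := by
      rw [logKernelIntegrand, if_neg (not_lt.2 hs)]
      simp only [Complex.real_smul, ← sub_eq_add_neg]; push_cast; ring
    have h5 : ‖(2 : ℂ)⁻¹‖ = 2⁻¹ := by norm_num
    rw [norm_mul, h3, norm_neg, norm_mul, norm_mul, Complex.norm_real,
      Real.norm_of_nonneg (by positivity), h5, add_zero, ← mul_add]
    calc _ ≤ ‖g x‖ * (s⁻¹ * 2⁻¹ * (‖ψ (x + s)‖ + ‖ψ (x + (-s))‖)) := by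
          gcongr; exact norm_add_le _ _
      _ = _ := by ring
  have hint : ∀ s : ℝ, 0 < s → Integrable (fun x => g x * logKernelIntegrand ψ x s) := by
    intro s hs
    have hm : AEStronglyMeasurable (fun x => g x * logKernelIntegrand ψ x s) :=
      (hgc.measurable.mul ((measurable_logKernelIntegrand ψ.continuous).comp
        (measurable_const.prodMk measurable_id))).aestronglyMeasurable
    rcases lt_or_ge s 1 with h | h
    · exact (integrable_inv_one_add_abs_sq.const_mul _).mono' hm (ae_of_all _ (hnear s hs h))
    · exact (((hgi 0 s).add (hgi 0 (-s))).const_mul _).mono' hm (ae_of_all _ (hfar s h))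
  rw [integrable_prod_iff hmeas]
  refine ⟨?_, ?_⟩
  · filter_upwards [ae_restrict_mem measurableSet_Ioi] with s hs
    exact hint s hs
  · set A := ∫ x : ℝ, ((1 + |x|) ^ 2)⁻¹ with hA
    set B := ∫ x, (1 + |x|) ^ β * ‖ψ x‖ with hB
    have hA0 : 0 ≤ A := integral_nonneg fun x => by positivity
    have hB0 : 0 ≤ B := integral_nonneg fun x => by positivity
    refine ((integrable_domKernel hg.alpha_pos hg.beta_pos).integrableOn.const_mul
      (C * C₂ * A * 4 + 2 * C * B)).mono' hmeas.norm.integral_prod_right' ?_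
    filter_upwards [ae_restrict_mem measurableSet_Ioi] with s (hs : 0 < s)
    have hD := domKernel_nonneg α β s
    rw [Real.norm_of_nonneg (integral_nonneg fun x => norm_nonneg _)]
    rcases lt_or_ge s 1 with h | h
    · have h1 := integral_mono (hint s hs).norm (integrable_inv_one_add_abs_sq.const_mul _)
        (hnear s hs h)
      rw [integral_const_mul, ← hA] at h1
      have h2 := one_le_domKernel α hg.beta_pos hg.beta_le (s := s)
        (by rw [abs_of_pos hs]; exact h.le)
      have h3 : 0 ≤ C * C₂ * A := by positivity
      have h4 : 0 ≤ 2 * C * B * domKernel α β s := by positivity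
      refine h1.trans ?_
      nlinarith
    · have hs' : |s| = s := abs_of_pos hs
      have h1 := integral_mono (hint s hs).norm (((hgi 0 s).add (hgi 0 (-s))).const_mul _)
        (hfar s h)
      have e : ∀ a : ℝ, ∫ x, ‖g (x + 0)‖ * ‖ψ (x + a)‖ = ∫ x, ‖g (x + (-a))‖ * ‖ψ (x + 0)‖ := by
        intro a
        rw [← integral_add_right_eq_self (fun x => ‖g (x + (-a))‖ * ‖ψ (x + 0)‖) a]
        congr 1; ext1 x
        rw [add_zero, add_zero, add_neg_cancel_right]
      have hb : ∀ a : ℝ, |a| = s → s⁻¹ * ∫ x, ‖g (x + (-a))‖ * ‖ψ (x + 0)‖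
          ≤ 2 * C * domKernel α β s * B := by
        intro a ha
        have hda : domKernel α β a = domKernel α β s := by
          rcases (abs_eq hs.le).1 ha with rfl | rfl
          · rfl
          · exact domKernel_neg α β s
        rw [← integral_const_mul, hB, ← integral_const_mul]
        refine integral_mono ((hgi (-a) 0).const_mul _)
          ((integrable_rpow_mul_schwartz ψ hg.beta_le).const_mul _) fun x => ?_
        have h2 := hg.far_le x (s := a) (by rwa [ha])
        rw [ha, hda] at h2
        simp only [add_zero, ← sub_eq_add_neg]
        calc _ = ‖g (x - a)‖ / s * ‖ψ x‖ := by ring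
          _ ≤ 2 * C * (1 + |x|) ^ β * domKernel α β s * ‖ψ x‖ := by gcongr
          _ = _ := by ring
      rw [integral_const_mul] at h1
      have h1' : ∫ x, ((fun x => ‖g (x + 0)‖ * ‖ψ (x + s)‖)
          + fun x => ‖g (x + 0)‖ * ‖ψ (x + (-s))‖) x
          = (∫ x, ‖g (x + (-s))‖ * ‖ψ (x + 0)‖) + ∫ x, ‖g (x + (- -s))‖ * ‖ψ (x + 0)‖ := by
        rw [integral_add' (hgi 0 s) (hgi 0 (-s)), e, e]
      have h5 := hb s hs'
      have h6 := hb (-s) (by rw [abs_neg, hs'])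
      have h7 : 0 ≤ C * C₂ * A * 4 * domKernel α β s := by positivity
      refine h1.trans ?_
      rw [h1']
      nlinarith

/-- The singular integral represents `log |∂ₓ|` in the sense of distributions. -/
theorem HolderDecay.logAbsDerivIntegral_duality (hg : HolderDecay α β C g) (ψ : 𝓢(ℝ, ℂ)) :
    Integrable (fun x => g x * logAbsDerivSchwartz ψ x) ∧
    Integrable (fun x => logAbsDerivIntegral g x * ψ x) ∧
    ∫ x, logAbsDerivIntegral g x * ψ x = ∫ x, g x * logAbsDerivSchwartz ψ x := by
  obtain ⟨C', hψ⟩ := exists_holderDecay_schwartz ψ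
  have hgψ : Integrable (fun x => g x * ψ x) := by
    refine (ψ.integrable.norm.const_mul C).mono'
      (hg.continuous.mul ψ.continuous).aestronglyMeasurable (ae_of_all _ fun x => ?_)
    rw [norm_mul]
    gcongr
    exact hg.bound x
  have hP := hg.integrable_logKernelIntegrand_mul ψ
  have hQ := hg.integrable_mul_logKernelIntegrand ψ
  have eP : ∀ x, logAbsDerivIntegral g x * ψ x = -Real.eulerMascheroniConstant * (g x * ψ x)
      + ∫ s in Ioi 0, logKernelIntegrand g x s * ψ x := by
    intro x
    rw [logAbsDerivIntegral, integral_mul_const, Complex.real_smul]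
    push_cast; ring
  have eQ : ∀ x, g x * logAbsDerivSchwartz ψ x = -Real.eulerMascheroniConstant * (g x * ψ x)
      + ∫ s in Ioi 0, g x * logKernelIntegrand ψ x s := by
    intro x
    rw [logAbsDerivSchwartz_eq ψ x (hψ.integrableOn_logKernelIntegrand x), integral_const_mul]
    ring
  have hγ := hgψ.const_mul (-Real.eulerMascheroniConstant : ℂ)
  refine ⟨?_, ?_, ?_⟩
  · simp_rw [eQ]
    exact hγ.add hQ.integral_prod_right
  · simp_rw [eP]
    exact hγ.add hP.integral_prod_right
  · simp_rw [eP, eQ]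
    have sP : ∫ x, ∫ s in Ioi 0, logKernelIntegrand g x s * ψ x
        = ∫ s in Ioi 0, ∫ x, logKernelIntegrand g x s * ψ x := (integral_integral_swap hP).symm
    have sQ : ∫ x, ∫ s in Ioi 0, g x * logKernelIntegrand ψ x s
        = ∫ s in Ioi 0, ∫ x, g x * logKernelIntegrand ψ x s := (integral_integral_swap hQ).symm
    rw [integral_add hγ hP.integral_prod_right, integral_add hγ hQ.integral_prod_right, sP, sQ]
    simp_rw [integral_logKernelIntegrand_mul hg ψ]

end Duality

/-! ### Real-valued functions and uniqueness -/

section RealValued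

variable {α β C : ℝ} {g : ℝ → ℝ}

lemma HolderDecay.ofReal (hg : HolderDecay α β C g) : HolderDecay α β C (fun x => (g x : ℂ)) where
  alpha_pos := hg.alpha_pos
  beta_pos := hg.beta_pos
  beta_le := hg.beta_le
  const_nonneg := hg.const_nonneg
  holder x y := by
    rw [← Complex.ofReal_sub, Complex.norm_real]
    exact hg.holder x y
  decay x := by
    rw [Complex.norm_real]
    exact hg.decay x

lemma logKernelIntegrand_ofReal (g : ℝ → ℝ) (x s : ℝ) :
    logKernelIntegrand (fun x => (g x : ℂ)) x s = ((logKernelIntegrand g x s : ℝ) : ℂ) := by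
  simp only [logKernelIntegrand, Complex.real_smul, smul_eq_mul]
  split_ifs <;> push_cast <;> rfl

lemma logAbsDerivIntegral_ofReal (g : ℝ → ℝ) (x : ℝ) :
    logAbsDerivIntegral (fun x => (g x : ℂ)) x = ((logAbsDerivIntegral g x : ℝ) : ℂ) := by
  simp only [logAbsDerivIntegral, logKernelIntegrand_ofReal]
  rw [integral_complex_ofReal]
  simp

theorem HolderDecay.isLogAbsDeriv (hg : HolderDecay α β C g) :
    IsLogAbsDeriv g (logAbsDerivIntegral g) := by
  refine ⟨?_, fun ψ => ?_⟩
  · have := Complex.continuous_re.comp hg.ofReal.continuous_logAbsDerivIntegral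
    refine this.congr fun x => ?_
    simp [logAbsDerivIntegral_ofReal]
  · have := hg.ofReal.logAbsDerivIntegral_duality ψ
    simp only [logAbsDerivIntegral_ofReal] at this
    exact this

/-- Smooth functions of compact support are Schwartz functions, so the pairing determines `L` almost
everywhere, and continuity does the rest. -/
theorem IsLogAbsDeriv.unique {L L' : ℝ → ℝ} (h : IsLogAbsDeriv g L) (h' : IsLogAbsDeriv g L') :
    L = L' := by
  rw [← Continuous.ae_eq_iff_eq (μ := volume) h.1 h'.1]
  refine ae_eq_of_integral_contDiff_smul_eq h.1.locallyIntegrable h'.1.locallyIntegrable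
    fun χ hχ hs => ?_
  have hs' : HasCompactSupport (fun x => (χ x : ℂ)) := hs.comp_left (g := ((↑) : ℝ → ℂ)) rfl
  have hχ' : ContDiff ℝ (⊤ : ℕ∞) (fun x => (χ x : ℂ)) := Complex.ofRealCLM.contDiff.comp hχ
  set ψ := hs'.toSchwartzMap hχ' with hψ
  have hψx : ∀ x, ψ x = (χ x : ℂ) := fun x => rfl
  have e := (h.2 ψ).2.2.trans (h'.2 ψ).2.2.symm
  simp only [hψx, ← Complex.ofReal_mul] at e
  rw [integral_complex_ofReal, integral_complex_ofReal, Complex.ofReal_inj] at e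
  simpa only [smul_eq_mul, mul_comm] using e

end RealValued

/-! ### The normal velocity and the front equation -/

/-- The tail of the planar kernel, compared with `1 / |s|`. -/
noncomputable def tailIntegrand (H s : ℝ) : ℝ :=
  (Ici (1 : ℝ)).indicator (fun s => s⁻¹) |s| - (Real.sqrt (s ^ 2 + H ^ 2))⁻¹

lemma measurable_tailIntegrand (H : ℝ) : Measurable (tailIntegrand H) := by
  unfold tailIntegrand
  have h1 : Measurable ((Ici (1 : ℝ)).indicator fun s : ℝ => s⁻¹) :=
    measurable_inv.indicator measurableSet_Ici
  have h2 : Measurable fun s : ℝ => (Ici (1 : ℝ)).indicator (fun s => s⁻¹) |s| :=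
    h1.comp measurable_norm
  exact h2.sub (by fun_prop)

lemma integrable_tailIntegrand {H : ℝ} (hH : 0 < H) : Integrable (tailIntegrand H) := by
  refine ((integrable_domKernel (α := 1) (β := 1) one_pos one_pos).const_mul
    (H⁻¹ * 4 + H ^ 2 * 4)).mono' (measurable_tailIntegrand H).aestronglyMeasurable
    (ae_of_all _ fun s => ?_)
  have hD := domKernel_nonneg 1 1 s
  rw [Real.norm_eq_abs, tailIntegrand]
  rcases lt_or_ge |s| 1 with h | h
  · rw [indicator_of_notMem (by simpa using h), zero_sub, abs_neg, abs_of_nonneg (by positivity)]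
    have h1 : (Real.sqrt (s ^ 2 + H ^ 2))⁻¹ ≤ H⁻¹ :=
      inv_anti₀ hH (Real.le_sqrt_of_sq_le (by linarith [sq_nonneg s]))
    have h2 := one_le_domKernel 1 one_pos le_rfl h.le
    calc _ ≤ H⁻¹ * 1 := by linarith
      _ ≤ H⁻¹ * (4 * domKernel 1 1 s) := by gcongr
      _ ≤ _ := by
          have : 0 ≤ H ^ 2 * domKernel 1 1 s := by positivity
          linarith
  · rw [indicator_of_mem (by exact h)]
    have hs0 : 0 < |s| := by linarith
    have h1 := abs_inv_sqrt_sub_le hs0 0 H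
    rw [sq_abs, zero_pow two_ne_zero, add_zero, Real.sqrt_sq_eq_abs, zero_add] at h1
    have h2 := inv_cube_le_domKernel 1 le_rfl h
    calc _ ≤ H ^ 2 * (|s| ^ 3)⁻¹ := h1
      _ ≤ H ^ 2 * (4 * domKernel 1 1 s) := by gcongr
      _ ≤ _ := by
          have : 0 ≤ H⁻¹ * domKernel 1 1 s := by positivity
          linarith

lemma intervalIntegral_inv_sqrt {H : ℝ} (hH : 0 < H) (R : ℝ) :
    IntervalIntegrable (fun s => (Real.sqrt (s ^ 2 + H ^ 2))⁻¹) volume 0 R ∧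
      ∫ s in (0 : ℝ)..R, (Real.sqrt (s ^ 2 + H ^ 2))⁻¹ = Real.arsinh (R / H) := by
  have hc : IntervalIntegrable (fun s => (Real.sqrt (s ^ 2 + H ^ 2))⁻¹) volume 0 R :=
    (Continuous.inv₀ (by fun_prop) fun s =>
      (sqrt_sq_add_pos s hH.ne').ne').intervalIntegrable _ _
  refine ⟨hc, ?_⟩
  have := intervalIntegral.integral_eq_sub_of_hasDerivAt (a := 0) (b := R)
    (f := fun s => Real.arsinh (s / H)) (fun s _ => ?_) hc
  · rw [this]; simp
  · refine ((hasDerivAt_id' s).div_const H).arsinh.congr_deriv ?_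
    have h1 : 1 + (s / H) ^ 2 = (s ^ 2 + H ^ 2) / H ^ 2 := by field_simp; ring
    rw [h1, Real.sqrt_div (by positivity), Real.sqrt_sq hH.le, smul_eq_mul]
    have := sqrt_sq_add_pos s hH.ne'
    field_simp

/-- On each half-line `log R - arsinh (R / H)` tends to `log H - log 2`, since `arsinh (R / H) = log
(2 R / H) + o(1)`. This is the origin of `log 2` in the drift. -/
lemma integral_tailIntegrand {H : ℝ} (hH : 0 < H) :
    ∫ s, tailIntegrand H s = 2 * Real.log H - 2 * Real.log 2 := by
  have e1 : ∀ s, tailIntegrand H s = (fun t => (Ici (1 : ℝ)).indicator (fun s => s⁻¹) t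
      - (Real.sqrt (t ^ 2 + H ^ 2))⁻¹) |s| := fun s => by
    simp only [tailIntegrand, sq_abs]
  have hI : IntegrableOn (fun t => (Ici (1 : ℝ)).indicator (fun s => s⁻¹) t
      - (Real.sqrt (t ^ 2 + H ^ 2))⁻¹) (Ioi 0) := by
    refine (integrable_tailIntegrand hH).integrableOn.congr_fun (fun s hs => ?_) measurableSet_Ioi
    rw [e1, abs_of_pos (mem_Ioi.1 hs)]
  simp_rw [e1]
  rw [integral_comp_abs (f := fun t => (Ici (1 : ℝ)).indicator (fun s => s⁻¹) t
      - (Real.sqrt (t ^ 2 + H ^ 2))⁻¹)]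
  have l1 := intervalIntegral_tendsto_integral_Ioi 0 hI tendsto_id
  have l2 : Tendsto (fun R : ℝ => -Real.log (H⁻¹ + Real.sqrt (R⁻¹ ^ 2 + H⁻¹ ^ 2))) atTop
      (𝓝 (-Real.log (H⁻¹ + Real.sqrt ((0 : ℝ) ^ 2 + H⁻¹ ^ 2)))) := by
    have hH' : 0 < H⁻¹ := by positivity
    have hc : ContinuousAt (fun y : ℝ => -Real.log (H⁻¹ + Real.sqrt (y ^ 2 + H⁻¹ ^ 2))) 0 :=
      (ContinuousAt.log (by fun_prop) (by positivity)).neg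
    exact hc.tendsto.comp tendsto_inv_atTop_zero
  have h3 := tendsto_nhds_unique l1 (l2.congr' ?_)
  · rw [h3, zero_pow two_ne_zero, zero_add, Real.sqrt_sq (by positivity), ← two_mul,
      Real.log_mul two_ne_zero (by positivity), Real.log_inv]
    ring
  · filter_upwards [eventually_ge_atTop 1] with R hR
    have hR0 : 0 < R := by linarith
    obtain ⟨i1, k1⟩ := intervalIntegral_indicator_inv hR
    obtain ⟨i2, k2⟩ := intervalIntegral_inv_sqrt hH R
    simp only [id]
    rw [intervalIntegral.integral_sub i1 i2, k1, k2, Real.arsinh]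
    have e2 : R / H + Real.sqrt (1 + (R / H) ^ 2)
        = R * (H⁻¹ + Real.sqrt (R⁻¹ ^ 2 + H⁻¹ ^ 2)) := by
      have : 1 + (R / H) ^ 2 = R ^ 2 * (R⁻¹ ^ 2 + H⁻¹ ^ 2) := by field_simp
      rw [this, Real.sqrt_mul (by positivity), Real.sqrt_sq hR0.le]; ring
    rw [e2, Real.log_mul hR0.ne' (by positivity)]
    ring

section Profile

variable {f : ℝ → ℝ} {M α β C : ℝ}

lemma frontIntegrand_sub (f : ℝ → ℝ) (x₀ s : ℝ) :
    frontIntegrand f x₀ (x₀ - s) = (deriv f x₀ - deriv f (x₀ - s))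
      * (|s|⁻¹ - (Real.sqrt (s ^ 2 + increment f x₀ s ^ 2))⁻¹) := by
  rw [frontIntegrand, increment, sub_sub_cancel, one_div, one_div, sub_sq_comm (f x₀)]

/-- Near zero the Hölder condition beats `|s|⁻¹`; at infinity the two inverse distances differ by
`O(|s|⁻³)`, as `f` is bounded. -/
lemma IsProfile.integrable_frontIntegrand_sub (hf : IsProfile f M α β C) (x₀ : ℝ) :
    Integrable (fun s => frontIntegrand f x₀ (x₀ - s)) := by
  have hC := hf.slope.const_nonneg
  have hM : 0 ≤ M := (abs_nonneg _).trans (hf.bound 0)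
  simp_rw [frontIntegrand_sub]
  refine ((integrable_domKernel hf.slope.alpha_pos hf.slope.beta_pos).const_mul
    (C + 2 * C * ((2 * M) ^ 2 * 4))).mono' ?_ (ae_of_all _ fun s => ?_)
  · have h1 := hf.slope.continuous.measurable
    have h2 := (hf.continuous_increment x₀).measurable
    exact Measurable.aestronglyMeasurable (by fun_prop)
  have hD := domKernel_nonneg α β s
  rcases eq_or_ne s 0 with rfl | hs
  · simp; positivity
  have hs0 : 0 < |s| := abs_pos.2 hs
  have hsF : |s| ≤ Real.sqrt (s ^ 2 + increment f x₀ s ^ 2) :=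
    Real.abs_le_sqrt (by linarith [sq_nonneg (increment f x₀ s)])
  rw [norm_mul]
  rcases le_total |s| 1 with h | h
  · have h2 := hf.slope.holder x₀ (x₀ - s)
    rw [sub_sub_cancel] at h2
    have h3 : ‖|s|⁻¹ - (Real.sqrt (s ^ 2 + increment f x₀ s ^ 2))⁻¹‖ ≤ |s|⁻¹ := by
      have h4 := inv_anti₀ hs0 hsF
      have h5 : 0 ≤ (Real.sqrt (s ^ 2 + increment f x₀ s ^ 2))⁻¹ := by positivity
      rw [Real.norm_of_nonneg (by linarith)]
      linarith
    calc _ ≤ C * |s| ^ α * |s|⁻¹ := by gcongr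
      _ = C * |s| ^ (α - 1) := by rw [Real.rpow_sub_one hs0.ne']; ring
      _ ≤ C * domKernel α β s := by gcongr; exact rpow_le_domKernel β h
      _ ≤ _ := by gcongr; linarith [show 0 ≤ 2 * C * ((2 * M) ^ 2 * 4) by positivity]
  · have h1 := abs_inv_sqrt_sub_le hs0 0 (increment f x₀ s)
    rw [sq_abs, zero_pow two_ne_zero, add_zero, Real.sqrt_sq_eq_abs, zero_add] at h1
    have h2 : ‖deriv f x₀ - deriv f (x₀ - s)‖ ≤ 2 * C := by
      refine (norm_sub_le _ _).trans ?_
      linarith [hf.slope.bound x₀, hf.slope.bound (x₀ - s)]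
    have h3 : increment f x₀ s ^ 2 ≤ (2 * M) ^ 2 := by
      rw [← sq_abs]; gcongr; exact hf.abs_increment_le x₀ s
    calc _ ≤ 2 * C * ((2 * M) ^ 2 * (|s| ^ 3)⁻¹) := by
          gcongr
          exact h1.trans (by gcongr)
      _ ≤ 2 * C * ((2 * M) ^ 2 * (4 * domKernel α β s)) := by
          gcongr; exact inv_cube_le_domKernel α hf.slope.beta_le h
      _ ≤ _ := by
          have : 0 ≤ C * domKernel α β s := by positivity
          linarith

lemma IsProfile.integrable_frontIntegrand (hf : IsProfile f M α β C) (x₀ : ℝ) :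
    Integrable (frontIntegrand f x₀) := by
  have := (hf.integrable_frontIntegrand_sub x₀).comp_sub_left x₀
  simpa using this

/-- The integral of the tangential component, in terms of the terms of the front equation. -/
lemma IsProfile.integral_tangentialIntegrand (hf : IsProfile f M α β C) (x₀ : ℝ) {H : ℝ}
    (hH : 0 < H) :
    ∫ s, tangentialIntegrand f x₀ H 0 s = 2 * logAbsDerivIntegral (deriv f) x₀
      - (∫ x', frontIntegrand f x₀ x')
      + deriv f x₀ * (2 * Real.eulerMascheroniConstant + 2 * Real.log H - 2 * Real.log 2) := by
  set m := deriv f x₀ with hm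
  -- The kernel of `log |∂ₓ|` on the whole line, before symmetrization. It is the tangential
  -- integrand plus the nonlinear integrand minus the slope times the tail, and folding the line at
  -- zero gives twice `logKernelIntegrand`.
  set P : ℝ → ℝ := fun s => ((if |s| < 1 then m else 0) - deriv f (x₀ - s)) * |s|⁻¹ with hP
  have i1 := hf.integrable_tangentialIntegrand x₀ hH 0
  have i2 := hf.integrable_frontIntegrand_sub x₀
  have i3 := integrable_tailIntegrand hH
  have e1 : ∀ s, P s = tangentialIntegrand f x₀ H 0 s + frontIntegrand f x₀ (x₀ - s)
      - m * tailIntegrand H s := by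
    intro s
    rw [frontIntegrand_sub, tangentialIntegrand, tailIntegrand, zero_pow two_ne_zero, add_zero, hP]
    rcases lt_or_ge |s| 1 with h | h
    · rw [indicator_of_notMem (by simpa using h)]
      simp only [h, if_true]; ring
    · rw [indicator_of_mem (by exact h)]
      simp only [not_lt.2 h, if_false]; ring
  have i12 : Integrable (fun s => tangentialIntegrand f x₀ H 0 s + frontIntegrand f x₀ (x₀ - s)) :=
    i1.add i2
  have iP : Integrable P := by
    refine (i12.sub (i3.const_mul m)).congr (ae_of_all _ fun s => ?_)
    exact (e1 s).symm
  have e2 : ∫ s, P s = (∫ s, tangentialIntegrand f x₀ H 0 s) + (∫ x', frontIntegrand f x₀ x')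
      - m * (2 * Real.log H - 2 * Real.log 2) := by
    simp_rw [e1]
    rw [integral_sub i12 (i3.const_mul m), integral_add i1 i2, integral_const_mul,
      integral_tailIntegrand hH, integral_sub_left_eq_self (frontIntegrand f x₀) volume x₀]
  have e3 : ∫ s, P s = 2 * ∫ s in Ioi 0, logKernelIntegrand (deriv f) x₀ s := by
    have h1 : ∫ s in Ioi 0, P (-s) = ∫ s in Iic 0, P s := by
      rw [integral_comp_neg_Ioi, neg_zero]
    rw [← intervalIntegral.integral_Iic_add_Ioi (b := 0) iP.integrableOn iP.integrableOn, ← h1,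
      ← integral_add iP.comp_neg.integrableOn iP.integrableOn, ← integral_const_mul]
    refine setIntegral_congr_fun measurableSet_Ioi fun s (hs : 0 < s) => ?_
    simp only [hP, logKernelIntegrand, abs_neg, abs_of_pos hs, sub_neg_eq_add, smul_eq_mul, ← hm]
    ring
  have e4 : logAbsDerivIntegral (deriv f) x₀ = -Real.eulerMascheroniConstant * m
      + ∫ s in Ioi 0, logKernelIntegrand (deriv f) x₀ s := rfl
  linarith

/-- The normal velocity of the front with profile `f`. -/
noncomputable def normalVelocity (f : ℝ → ℝ) (x₀ : ℝ) : ℝ :=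
  (Real.sqrt (1 + deriv f x₀ ^ 2))⁻¹ * (2 * logAbsDerivIntegral (deriv f) x₀
    - (∫ x', frontIntegrand f x₀ x')
    - 2 * (Real.log 2 - Real.eulerMascheroniConstant) * deriv f x₀)

/-- The logarithm of the planar velocity cancels that of the tail integral, so the limit does not
depend on `h`. -/
theorem IsProfile.tendsto_normalVelocity (hf : IsProfile f M α β C) {h : ℝ}
    (hh : ∀ x, -h < f x) (x₀ : ℝ) :
    Tendsto (fun ε => inner ℝ (splitVelocityTrunc h f ε (frontPoint f x₀)) (frontNormal f x₀))
      (𝓝[>] 0) (𝓝 (normalVelocity f x₀)) := by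
  have hH : 0 < f x₀ + h := by linarith [hh x₀]
  have := hf.tendsto_split_inner hh x₀
  rw [hf.integral_tangentialIntegrand x₀ hH] at this
  convert this using 2
  rw [normalVelocity]
  congr 1
  ring

theorem IsProfile.isNormalVelocity (hf : IsProfile f M α β C) {u : Plane → Plane}
    (hu : IsFrontVelocity f u) (x₀ : ℝ) :
    IsNormalVelocity (frontTheta f) u (frontPoint f x₀) (frontNormal f x₀)
      (normalVelocity f x₀) := by
  have hh : ∀ x, -(M + 1) < f x := fun x => by linarith [(abs_le.1 (hf.bound x)).1]
  refine isNormalVelocity_of_split hf.continuous.measurable hf.slope.const_nonneg hf.lipschitz hh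
    (fun x => (abs_le.1 (hf.bound x)).2) hu ?_ (hf.tendsto_normalVelocity hh x₀)
  have := hh x₀
  simp only [frontPoint, Matrix.cons_val_one, Matrix.cons_val_fin_one]
  exact this.ne'

lemma IsProfile.lt_of_lt_iInf (hf : IsProfile f M α β C) {h : ℝ} (hh : -h < ⨅ x, f x) (x : ℝ) :
    -h < f x :=
  hh.trans_le (ciInf_le ⟨-M, by rintro _ ⟨y, rfl⟩; exact (abs_le.1 (hf.bound y)).1⟩ x)

theorem IsProfile.exists_unique_velocity (hf : IsProfile f M α β C) :
    ∃ u : Plane → Plane, IsFrontVelocity f u ∧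
      ∀ w : Plane → Plane, IsFrontVelocity f w → w =ᵐ[volume] u := by
  have hh : ∀ x, -(M + 1) < f x := fun x => by linarith [(abs_le.1 (hf.bound x)).1]
  obtain ⟨e, he, -, -⟩ := exists_isFrontVelocity hf.continuous.measurable hf.slope.const_nonneg
    hf.lipschitz hh (fun x => (abs_le.1 (hf.bound x)).2)
  exact ⟨_, he, fun w hw => he.ae_eq hw⟩

theorem IsProfile.ae_tendsto_split (hf : IsProfile f M α β C) {h : ℝ} (hh : ∀ x, -h < f x)
    {u : Plane → Plane} (hu : IsFrontVelocity f u) :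
    ∀ᵐ X : Plane, Tendsto (fun ε => splitVelocityTrunc h f ε X) (𝓝[>] 0) (𝓝 (u X)) := by
  obtain ⟨e, he, -, h2⟩ := exists_isFrontVelocity hf.continuous.measurable hf.slope.const_nonneg
    hf.lipschitz hh (fun x => (abs_le.1 (hf.bound x)).2)
  filter_upwards [he.ae_eq hu, ae_off_graph hf.continuous.measurable,
    ae_off_graph (measurable_const (a := -h))] with X h3 h4 h5
  rw [h3]
  refine tendsto_const_nhds.congr' ?_
  filter_upwards [h2 X h5 h4] with ε hε
  exact hε.symm

end Profile

/-! ### The assumptions on the front, and the Galilean transformation -/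

lemma exists_decay_of_isBigO {g : ℝ → ℝ} (hg : Continuous g) {β : ℝ} (hβ : 0 < β)
    (hO : g =O[cocompact ℝ] fun x => |x| ^ (-β)) :
    ∃ C, ∀ x, ‖g x‖ ≤ C * (1 + |x|) ^ (-β) := by
  have h1 : (fun x : ℝ => |x| ^ (-β)) =O[cocompact ℝ] fun x => (1 + |x|) ^ (-β) := by
    refine Asymptotics.IsBigO.of_bound (2 ^ β) ?_
    filter_upwards [(tendsto_norm_cocompact_atTop (E := ℝ)).eventually_ge_atTop 1] with x hx
    rw [Real.norm_eq_abs] at hx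
    rw [Real.norm_of_nonneg (by positivity), Real.norm_of_nonneg (by positivity),
      Real.rpow_neg (by positivity), Real.rpow_neg (by positivity), ← div_eq_mul_inv,
      le_div_iff₀ (by positivity), inv_mul_le_iff₀ (by positivity),
      ← Real.mul_rpow (by positivity) (by norm_num)]
    gcongr
    linarith
  obtain ⟨c, hc⟩ := (hO.trans h1).bound
  obtain ⟨K, hK, hKc⟩ := mem_cocompact.1 hc
  obtain ⟨B, hB⟩ := hK.exists_bound_of_continuousOn (f := fun x => g x * (1 + |x|) ^ β)
    (Continuous.continuousOn (hg.mul (Continuous.rpow_const (by fun_prop) fun x => Or.inr hβ.le)))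
  refine ⟨max c B, fun x => ?_⟩
  by_cases hx : x ∈ K
  · have h2 := hB x hx
    rw [norm_mul, Real.norm_of_nonneg (by positivity : 0 ≤ (1 + |x|) ^ β)] at h2
    rw [Real.rpow_neg (by positivity), ← div_eq_mul_inv, le_div_iff₀ (by positivity)]
    exact h2.trans (le_max_right _ _)
  · have h2 : ‖g x‖ ≤ c * ‖(1 + |x|) ^ (-β)‖ := hKc hx
    rw [Real.norm_of_nonneg (by positivity : 0 ≤ (1 + |x|) ^ (-β))] at h2
    refine h2.trans ?_
    gcongr
    exact le_max_left _ _

lemma FrontAssumptions.exists_isProfile {T : ℝ} {φ : ℝ → ℝ → ℝ} (hφ : FrontAssumptions T φ)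
    {t : ℝ} (ht : t ∈ Icc 0 T) : ∃ M α β C, IsProfile (fun x => φ x t) M α β C := by
  obtain ⟨M, hM⟩ := hφ.bounded
  obtain ⟨α, C₁, hα, hC₁⟩ := hφ.holder t ht
  obtain ⟨β, hβ, hO⟩ := hφ.decay t ht
  obtain ⟨C₂, hC₂⟩ := exists_decay_of_isBigO ((hφ.contDiff t ht).continuous_deriv le_rfl) hβ hO
  have hC₂0 : 0 ≤ C₂ := by
    have := (norm_nonneg _).trans (hC₂ 0)
    simpa using this
  -- Lowering the decay exponent to at most `1` only weakens the hypothesis, and the kernel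
  -- comparisons rely on it.
  refine ⟨M, α, min β 1, C₁ + C₂, fun x => hM x t ht, hφ.contDiff t ht, by exact_mod_cast hα,
    lt_min hβ one_pos, min_le_right _ _, by positivity, fun x y => ?_, fun x => ?_⟩
  · have := hC₁.dist_le x y
    rw [dist_eq_norm, Real.dist_eq] at this
    refine this.trans ?_
    gcongr
    linarith
  · refine (hC₂ x).trans ?_
    gcongr
    · linarith [NNReal.coe_nonneg C₁]
    · linarith [abs_nonneg x]
    · exact min_le_left _ _

lemma IsProfile.comp_add_const {f : ℝ → ℝ} {M α β C : ℝ} (hf : IsProfile f M α β C) (a : ℝ) :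
    IsProfile (fun x => f (x + a)) M α β (C * (1 + |a|) ^ β) := by
  have hC := hf.slope.const_nonneg
  have hd : deriv (fun x => f (x + a)) = fun x => deriv f (x + a) :=
    funext fun x => deriv_comp_add_const f a x
  have h1 : 1 ≤ (1 + |a|) ^ β :=
    Real.one_le_rpow (by linarith [abs_nonneg a]) hf.slope.beta_pos.le
  refine ⟨fun x => hf.bound _, hf.contDiff.comp (contDiff_id.add contDiff_const), ?_⟩
  rw [hd]
  refine ⟨hf.slope.alpha_pos, hf.slope.beta_pos, hf.slope.beta_le, by positivity, fun x y => ?_,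
    fun x => ?_⟩
  · have := hf.slope.holder (x + a) (y + a)
    rw [add_sub_add_right_eq_sub] at this
    refine this.trans ?_
    gcongr
    exact le_mul_of_one_le_right hC h1
  · refine (hf.slope.decay (x + a)).trans ?_
    have := peetre hf.slope.beta_pos.le a (-x)
    rw [sub_neg_eq_add, abs_neg, add_comm a x] at this
    rw [mul_assoc]
    gcongr

lemma logAbsDerivIntegral_comp_add_const (g : ℝ → ℝ) (a x : ℝ) :
    logAbsDerivIntegral (fun x => g (x + a)) x = logAbsDerivIntegral g (x + a) := by
  have : ∀ s, logKernelIntegrand (fun x => g (x + a)) x s = logKernelIntegrand g (x + a) s := by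
    intro s
    simp only [logKernelIntegrand, add_right_comm x a s, sub_add_eq_add_sub]
  simp only [logAbsDerivIntegral, this]

lemma integral_frontIntegrand_comp_add_const (f : ℝ → ℝ) (a x : ℝ) :
    ∫ x', frontIntegrand (fun x => f (x + a)) x x' = ∫ x', frontIntegrand f (x + a) x' := by
  rw [← integral_add_right_eq_self (frontIntegrand f (x + a)) a]
  congr 1; ext1 x'
  simp only [frontIntegrand, deriv_comp_add_const, add_sub_add_right_eq_sub]

/-- The front equation in terms of the singular integral for `log |∂ₓ|`. -/
lemma frontEquationAt_iff {c T : ℝ} {φ : ℝ → ℝ → ℝ} {x t M α β C : ℝ}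
    (hf : IsProfile (fun y => φ y t) M α β C) :
    FrontEquationAt c T φ x t ↔ timeDeriv T φ x t + c * deriv (fun y => φ y t) x
      + ∫ x', frontIntegrand (fun y => φ y t) x x'
        = 2 * logAbsDerivIntegral (deriv fun y => φ y t) x := by
  constructor
  · rintro ⟨-, L, hL, h⟩
    rwa [hL.unique hf.slope.isLogAbsDeriv] at h
  · exact fun h => ⟨hf.integrable_frontIntegrand x, _, hf.slope.isLogAbsDeriv, h⟩

/-- The chain rule along `(c, 1) = (0, 1) + c • (1, 0)`. Positivity of `T` makes derivatives within
`[0, T]` unique, also at the endpoints. -/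
lemma timeDeriv_galilean {T : ℝ} (hT : 0 < T) {φ : ℝ → ℝ → ℝ}
    (hd : DifferentiableOn ℝ (fun p : ℝ × ℝ => φ p.1 p.2) (univ ×ˢ Icc 0 T)) (c x : ℝ) {t : ℝ}
    (ht : t ∈ Icc 0 T) :
    timeDeriv T (fun y s => φ (y + c * s) s) x t
      = timeDeriv T φ (x + c * t) t + c * deriv (fun y => φ y t) (x + c * t) := by
  set p : ℝ × ℝ := (x + c * t, t) with hp
  have hD := (hd p ⟨mem_univ _, ht⟩).hasFDerivWithinAt
  set D := fderivWithin ℝ (fun p : ℝ × ℝ => φ p.1 p.2) (univ ×ˢ Icc 0 T) p with hDdef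
  have hu : UniqueDiffWithinAt ℝ (Icc 0 T) t := uniqueDiffOn_Icc hT t ht
  have h1 : HasDerivWithinAt (fun s => φ (x + c * s) s) (D (c, 1)) (Icc 0 T) t := by
    have hl : HasDerivWithinAt (fun s : ℝ => (x + c * s, s)) (c, 1) (Icc 0 T) t := by
      have := ((hasDerivAt_id' t).const_mul c).const_add x
      rw [mul_one] at this
      exact (this.prodMk (hasDerivAt_id' t)).hasDerivWithinAt
    exact hD.comp_hasDerivWithinAt_of_eq t hl (fun s hs => ⟨mem_univ _, hs⟩) rfl
  have h2 : HasDerivWithinAt (fun s => φ (x + c * t) s) (D (0, 1)) (Icc 0 T) t := by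
    have hl : HasDerivWithinAt (fun s : ℝ => (x + c * t, s)) (0, 1) (Icc 0 T) t :=
      ((hasDerivAt_const t (x + c * t)).prodMk (hasDerivAt_id' t)).hasDerivWithinAt
    exact hD.comp_hasDerivWithinAt_of_eq t hl (fun s hs => ⟨mem_univ _, hs⟩) rfl
  have h3 : HasDerivAt (fun y => φ y t) (D (1, 0)) (x + c * t) := by
    have hl : HasDerivAt (fun y : ℝ => (y, t)) (1, 0) (x + c * t) :=
      (hasDerivAt_id' _).prodMk (hasDerivAt_const _ t)
    rw [← hasDerivWithinAt_univ] at hl ⊢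
    exact hD.comp_hasDerivWithinAt_of_eq (x + c * t) hl (fun y _ => ⟨mem_univ _, ht⟩) rfl
  rw [timeDeriv, timeDeriv, h1.derivWithin hu, h2.derivWithin hu, h3.deriv]
  have : ((c, 1) : ℝ × ℝ) = (0, 1) + c • (1, 0) := by ext <;> simp
  rw [this, map_add, map_smul, smul_eq_mul]

/-! ### The main theorem -/

theorem mainTheorem1 (T : ℝ) (hT : 0 < T) (φ : ℝ → ℝ → ℝ) (hφ : FrontAssumptions T φ)
    (hφt : ∀ x, DifferentiableOn ℝ (fun t => φ x t) (Icc 0 T)) :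
    -- at each time there is a velocity field with the prescribed far field, and only one
    (∀ t ∈ Icc 0 T, ∃ u : Plane → Plane, IsFrontVelocity (fun x => φ x t) u ∧
      ∀ w : Plane → Plane, IsFrontVelocity (fun x => φ x t) w → w =ᵐ[volume] u) ∧
    -- it is also the sum of the velocity of a planar front and of `-ℛ^⊥ θ*`
    (∀ t ∈ Icc 0 T, ∀ u : Plane → Plane, IsFrontVelocity (fun x => φ x t) u →
      ∀ h : ℝ, -h < ⨅ x, φ x t →
        ∀ᵐ X : Plane, Tendsto (fun ε => splitVelocityTrunc h (fun x => φ x t) ε X)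
          (𝓝[>] 0) (𝓝 (u X))) ∧
    -- `log |∂ₓ| φ_x` is a well-defined continuous function
    (∀ t ∈ Icc 0 T, ∃! L : ℝ → ℝ, IsLogAbsDeriv (deriv (fun x => φ x t)) L) ∧
    -- the normal velocity on the front exists, is the same in both descriptions of the velocity,
    -- and the front moves with it if and only if the front equation holds
    (∀ t ∈ Icc 0 T, ∀ u : Plane → Plane, IsFrontVelocity (fun x => φ x t) u → ∀ x : ℝ,
      ∃ V : ℝ,
        IsNormalVelocity (frontTheta (fun y => φ y t)) u
          (frontPoint (fun y => φ y t) x) (frontNormal (fun y => φ y t) x) V ∧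
        (∀ h : ℝ, -h < ⨅ y, φ y t →
          Tendsto (fun ε => inner ℝ
            (splitVelocityTrunc h (fun y => φ y t) ε (frontPoint (fun y => φ y t) x))
            (frontNormal (fun y => φ y t) x)) (𝓝[>] 0) (𝓝 V)) ∧
        (timeDeriv T φ x t / Real.sqrt (1 + deriv (fun y => φ y t) x ^ 2) = V ↔
          FrontEquationAt (2 * (Real.log 2 - Real.eulerMascheroniConstant)) T φ x t)) ∧
    -- a Galilean transformation removes the drift term
    (DifferentiableOn ℝ (fun p : ℝ × ℝ => φ p.1 p.2) (univ ×ˢ Icc 0 T) →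
      ∀ t ∈ Icc 0 T, ∀ x : ℝ,
        FrontEquationAt (2 * (Real.log 2 - Real.eulerMascheroniConstant)) T φ
            (x + 2 * (Real.log 2 - Real.eulerMascheroniConstant) * t) t ↔
          FrontEquationAt 0 T
            (fun y s => φ (y + 2 * (Real.log 2 - Real.eulerMascheroniConstant) * s) s) x t) := by
  have hprof := fun t ht => hφ.exists_isProfile (t := t) ht
  refine ⟨fun t ht => ?_, fun t ht u hu h hh => ?_, fun t ht => ?_, fun t ht u hu x => ?_,
    fun hd t ht x => ?_⟩
  · obtain ⟨M, α, β, C, hf⟩ := hprof t ht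
    exact hf.exists_unique_velocity
  · obtain ⟨M, α, β, C, hf⟩ := hprof t ht
    exact hf.ae_tendsto_split (hf.lt_of_lt_iInf hh) hu
  · obtain ⟨M, α, β, C, hf⟩ := hprof t ht
    exact ⟨_, hf.slope.isLogAbsDeriv, fun L hL => hL.unique hf.slope.isLogAbsDeriv⟩
  · obtain ⟨M, α, β, C, hf⟩ := hprof t ht
    refine ⟨normalVelocity (fun y => φ y t) x, hf.isNormalVelocity hu x,
      fun h hh => hf.tendsto_normalVelocity (hf.lt_of_lt_iInf hh) x, ?_⟩
    have hq : Real.sqrt (1 + deriv (fun y => φ y t) x ^ 2) ≠ 0 := by positivity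
    rw [frontEquationAt_iff hf, normalVelocity, div_eq_inv_mul,
      mul_right_inj' (inv_ne_zero hq)]
    constructor <;> intro h <;> linarith
  · obtain ⟨M, α, β, C, hf⟩ := hprof t ht
    set c := 2 * (Real.log 2 - Real.eulerMascheroniConstant) with hc
    have hg := hf.comp_add_const (c * t)
    -- The time derivative in the moving frame absorbs the drift; the integral and `log |∂ₓ|`
    -- commute with translations.
    rw [frontEquationAt_iff hf, frontEquationAt_iff (φ := fun y s => φ (y + c * s) s) hg,
      timeDeriv_galilean hT hd c x ht,
      integral_frontIntegrand_comp_add_const (fun y => φ y t) (c * t) x]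
    have hder : deriv (fun y => φ (y + c * t) t) = fun y => deriv (fun y => φ y t) (y + c * t) :=
      funext fun y => deriv_comp_add_const (fun y => φ y t) (c * t) y
    rw [hder, logAbsDerivIntegral_comp_add_const, zero_mul, add_zero]
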